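/- Let $F(x,y,u)=\sum_{n,m\ge 0}F_{n,m}(u)\,x^ny^m$ be a double power series whose coefficients are complex functions of a complex parameter $u$ with $|u|=1$. Let $R,S$ be real numbers and suppose that: - $F_{n,m}(1)$ is real and non-negative, and $|F_{n,m}(u)|\le F_{n,m}(1)$, for all $n,m$ and all $|u|=1$; - the series $F(x,y,1)$ (and hence $F(x,y,u)$ for every $|u|=1$) converges for $|x|<R$, $|y|<S$; - $F(0,y,u)\equiv 0$ and $F(x,0,u)\not\equiv 0$; - for $|x|<R$, $|y|<S$ the function $t\mapsto F(x,y,e^{it})$, $t\in\mathbb R$, is three times continuously differentiable, and its derivatives $\partial_t^kF(x,y,e^{it})$, $0\le k\le 3$, are continuous in $(x,y,t)$ and analytic in $(x,y)$. Suppose further that there are real numbers $0\le x_0<R$ and $0\le y_0<S$ with $$y_0=F(x_0,y_0,1),\qquad 1=F_y(x_0,y_0,1),\qquad F_x(x_0,y_0,1)\neq 0,\qquad F_{yy}(x_0,y_0,1)\ne 0 .$$ For $|u|=1$ let $y(x,u)=\sum_n y_n(u)x^n$ be the solution of $y=F(x,y,u)$ that is analytic in $x$ near $0$ and satisfies $y(0,u)=0$.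 Assume the aperiodic case: there are no integers $d\ge 2$ and $r$ such that $y_n(1)=0$ for all $n\not\equiv r \pmod d$. Let $X_n$ be integer-valued random variables (possibly defined on different probability spaces) such that, for every $n$ with $y_n(1)\ne 0$, $$\mathbb E\big[u^{X_n}\big]=\frac{[x^n]\,y(x,u)}{[x^n]\,y(x,1)}=\frac{y_n(u)}{y_n(1)}\qquad\text{for all } |u|=1 .$$ Derivatives with respect to $u$ are taken along the unit circle, i.e. $F_u(x,y,u)=\frac1{iu}\,\frac{d}{dt}F(x,y,ue^{it})\big|_{t=0}$, and similarly for $F_{uu},F_{xu},F_{yu}$. Set $$\mu=\frac{F_u}{x_0F_x},$$ $$\sigma^2=\frac{1}{x_0F_x^3F_{yy}}\Bigl(F_x^2(F_{yy}F_{uu}-F_{yu}^2)-2F_xF_u(F_{yy}F_{xu}-F_{yx}F_{yu})+F_u^2(F_{yy}F_{xx}-F_{yx}^2)\Bigr)+\mu+\mu^2,$$ where all partial derivatives are evaluated at $(x_0,y_0,1)$. Then $X_n$ has a finite second moment for every $n$ with $y_n(1)\neq0$, the numbers $\mu$ and $\sigma^2$ are real, and as $n\to\infty$ $$\mathbb E[X_n]=\mu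 n+O(1),\qquad \operatorname{Var}[X_n]=\sigma^2n+O(1).$$ Moreover, if $\sigma^2>0$, then $$\frac{X_n-\mathbb E[X_n]}{\sqrt{\operatorname{Var}[X_n]}}\longrightarrow N(0,1)\quad\text{in distribution.}$$ -/

import Mathlib

open MeasureTheory ProbabilityTheory Filter Topology Asymptotics

noncomputable section

namespace SingleEquation

/-- The power series `F(x, y, u) = ∑_{n,m} F_{n,m}(u) x^n y^m`, with coefficients
`a n m u = F_{n,m}(u)` that are functions of a parameter `u` on the complex unit circle. -/
def seriesF (a : ℕ → ℕ → Circle → ℂ) (x y : ℂ) (u : Circle) : ℂ :=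
  ∑' p : ℕ × ℕ, a p.1 p.2 u * x ^ p.1 * y ^ p.2

/-- Partial derivative with respect to `x`. -/
def Dx (G : ℂ → ℂ → Circle → ℂ) : ℂ → ℂ → Circle → ℂ :=
  fun x y u => deriv (fun z => G z y u) x

/-- Partial derivative with respect to `y`. -/
def Dy (G : ℂ → ℂ → Circle → ℂ) : ℂ → ℂ → Circle → ℂ :=
  fun x y u => deriv (fun z => G x z u) y

/-- Partial derivative with respect to `u` along the unit circle: since
`d/dt g(u e^{it}) = i u g'(u)` at `t = 0`, the derivative `g'(u)` is `(i u)⁻¹ d/dt g(u e^{it})`.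
It is the ordinary complex derivative when `g` is holomorphic near `u`. -/
def Du (G : ℂ → ℂ → Circle → ℂ) : ℂ → ℂ → Circle → ℂ :=
  fun x y u => deriv (fun t : ℝ => G x y (u * Circle.exp t)) 0 / (Complex.I * (u : ℂ))

/-- The `k`-th derivative of `t ↦ F(x, y, e^{it})` at `t`. -/
def tDeriv (F : ℂ → ℂ → Circle → ℂ) (k : ℕ) (x y : ℂ) (t : ℝ) : ℂ :=
  iteratedDeriv k (fun s : ℝ => F x y (Circle.exp s)) t

/-- The open bidisc `|x| < R`, `|y| < S`. -/
def bidisc (R S : ℝ) : Set (ℂ × ℂ) :=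
  Metric.ball 0 R ×ˢ Metric.ball 0 S

/-- Standing assumptions on `F(x, y, u) = ∑ F_{n,m}(u) x^n y^m`, on the bidisc with radii `R, S`. -/
structure IsPositiveEquation (a : ℕ → ℕ → Circle → ℂ) (R S : ℝ) : Prop where
  /-- the series converges in the bidisc at `u = 1` (hence, by `norm_le`, for every `u`) -/
  summable : ∀ p ∈ bidisc R S, Summable fun q : ℕ × ℕ => a q.1 q.2 1 * p.1 ^ q.1 * p.2 ^ q.2
  /-- the coefficients `F_{n,m}(1)` are real and nonnegative -/
  coeff_real : ∀ n m, (a n m 1).im = 0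
  coeff_nonneg : ∀ n m, 0 ≤ (a n m 1).re
  /-- `|F_{n,m}(u)| ≤ F_{n,m}(1)` -/
  norm_le : ∀ n m u, ‖a n m u‖ ≤ (a n m 1).re
  /-- `F(0, y, u) ≡ 0` -/
  zero_left : ∀ y ∈ Metric.ball (0 : ℂ) S, ∀ u, seriesF a 0 y u = 0
  /-- `F(x, 0, u) ≢ 0` -/
  not_zero_right : ∃ x ∈ Metric.ball (0 : ℂ) R, ∃ u, seriesF a x 0 u ≠ 0
  /-- `t ↦ F(x, y, e^{it})` is three times continuously differentiable -/
  contDiff : ∀ p ∈ bidisc R S, ContDiff ℝ 3 fun t : ℝ => seriesF a p.1 p.2 (Circle.exp t)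
  /-- the `t`-derivatives are continuous functions of `(x, y, t)` ... -/
  continuous_tDeriv : ∀ k ≤ 3, ContinuousOn
    (fun q : (ℂ × ℂ) × ℝ => tDeriv (seriesF a) k q.1.1 q.1.2 q.2) (bidisc R S ×ˢ Set.univ)
  /-- ... and analytic functions of `(x, y)` -/
  analytic_tDeriv : ∀ k ≤ 3, ∀ t : ℝ, AnalyticOnNhd ℂ
    (fun p : ℂ × ℂ => tDeriv (seriesF a) k p.1 p.2 t) (bidisc R S)

/-- `(x₀, y₀)` is a nonnegative solution of `y = F(x, y, 1)`, `1 = F_y(x, y, 1)` with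
`F_x(x₀, y₀, 1) ≠ 0` and `F_{yy}(x₀, y₀, 1) ≠ 0`. -/
structure IsCharacteristicPoint (F : ℂ → ℂ → Circle → ℂ) (x₀ y₀ : ℝ) : Prop where
  x_nonneg : 0 ≤ x₀
  y_nonneg : 0 ≤ y₀
  eq : (y₀ : ℂ) = F x₀ y₀ 1
  eq_deriv : 1 = Dy F x₀ y₀ 1
  Dx_ne_zero : Dx F x₀ y₀ 1 ≠ 0
  Dyy_ne_zero : Dy (Dy F) x₀ y₀ 1 ≠ 0

/-- `y(x, u)` is, for every `u`, the analytic solution of `y = F(x, y, u)` with `y(0, u) = 0`. -/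
structure IsSolution (F : ℂ → ℂ → Circle → ℂ) (y : ℂ → Circle → ℂ) : Prop where
  analyticAt : ∀ u, AnalyticAt ℂ (fun x => y x u) 0
  map_zero : ∀ u, y 0 u = 0
  eq : ∀ u, ∀ᶠ x in 𝓝 (0 : ℂ), y x u = F x (y x u) u

/-- `[x^n] f(x)`, the `n`-th Taylor coefficient of `f` at `0`. -/
def coeffAt (n : ℕ) (f : ℂ → ℂ) : ℂ :=
  iteratedDeriv n f 0 / (n.factorial : ℂ)

/-- The support of the sequence `c` is contained in no residue class modulo `d` with `d > 1`. -/
def IsAperiodic (c : ℕ → ℂ) : Prop :=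
  ∀ d r : ℕ, 1 ≤ d → (∀ n, ¬ n ≡ r [MOD d] → c n = 0) → d = 1

/-- `μ = F_u / (x₀ F_x)` at `(x₀, y₀, 1)`. -/
def meanConst (F : ℂ → ℂ → Circle → ℂ) (x₀ y₀ : ℝ) : ℂ :=
  Du F x₀ y₀ 1 / (x₀ * Dx F x₀ y₀ 1)

/-- The constant `σ²`, all partial derivatives being evaluated at `(x₀, y₀, 1)`. -/
def varConst (F : ℂ → ℂ → Circle → ℂ) (x₀ y₀ : ℝ) : ℂ :=
  let Fx := Dx F x₀ y₀ 1
  let Fu := Du F x₀ y₀ 1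
  let Fxx := Dx (Dx F) x₀ y₀ 1
  let Fyy := Dy (Dy F) x₀ y₀ 1
  let Fuu := Du (Du F) x₀ y₀ 1
  let Fyx := Dx (Dy F) x₀ y₀ 1
  let Fyu := Du (Dy F) x₀ y₀ 1
  let Fxu := Du (Dx F) x₀ y₀ 1
  1 / (x₀ * Fx ^ 3 * Fyy) *
      (Fx ^ 2 * (Fyy * Fuu - Fyu ^ 2) - 2 * Fx * Fu * (Fyy * Fxu - Fyx * Fyu)
        + Fu ^ 2 * (Fyy * Fxx - Fyx ^ 2))
    + meanConst F x₀ y₀ + meanConst F x₀ y₀ ^ 2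

end SingleEquation

end

/-! The function y(x, u) has a square-root singularity in x, but the proof never studies it. Instead
the equation w = F(x, w, u) is solved for x. As F_x ≠ 0 at (x₀, y₀), the root x = X(w, u) is smooth
near w = y₀, and the condition F_y = 1 makes y₀ a critical point of X(·, 1). Differentiating y and
computing a residue gives n yₙ(u) = (2πi)⁻² ∮∮ x⁻ⁿ F_x / (w − F) dx dw over |w| = y₀ and a small
circle in x (`natCast_mul_coeffAt_eq`). For each w the x-contour is pushed beyond x₀. A pole is
crossed only when w is close to y₀; it is X(w, u), and it contributes X(w, u)⁻ⁿ
(`innerCoeff_eq_of_root`). That no other pole interferes is due to positivity and aperiodicity: a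
second solution with |x| ≤ x₀, |w| = y₀ would be a case of equality in the triangle inequality,
hence a rotational symmetry of F and of y (`IsPositiveEquation.isDominantPoint`). So, up to an error
exponentially smaller than x₀⁻ⁿ and uniform for u near 1, n yₙ(u) is a saddle-point integral of
X(y₀e^{iβ}, u)⁻ⁿ over |β| ≤ δ (`IsDominantPoint.exists_hasLocalization`).

Write X = x₀e^{L(β, t)} with u = e^{it}. Then L = ℓt + (κβ² + 2mβt + pt²)/2 up to cubic terms, with
κ > 0, and Gaussian integration over β leaves exp(−nℓt + n(m²/κ − p)t²/2). Thus ℓ = −iμ and σ² = p −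
m²/κ, and implicit differentiation turns these into the stated constants (`meanConst_eq`,
`varConst_eq`).

As F is only C³ in t, the exponent L is built from the Taylor polynomial F + sF₁ + s²F₂/2, which is
analytic in a complex parameter s. The O(t³) discrepancy is harmless in both applications. For the
moments, at fixed n it does not affect the quadratic Taylor polynomial of the characteristic
function (`IsSmoothFamily.exists_norm_doubleCoeff_sub_taylor_le`), whose coefficients are
s-derivatives at 0. Cauchy's estimates carry the exponentially small errors over to these
derivatives, and integration by parts in the Laplace integrals gives mean and variance up to O(1)
(`cumulants_isBigO_one`, `IsSmoothFamily.cumulants`). For the limit law t is of order n^{-1/2}, so n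
t³ → 0 (`IsSmoothFamily.tendsto_doubleCoeff_div`), and Lévy's continuity theorem applies. Finiteness
of second moments is not assumed; it follows from the quadratic expansion by Fatou's lemma
(`memLp_two_of_charFun_taylor`). -/

namespace SingleEquation

/-! ### Moments and the limit law from characteristic functions. -/

section Probability

/-- A polynomial `a t + b t²` which is `o(t²)` at `0` vanishes. -/
theorem coeff_eq_zero_of_isLittleO_sq {a b : ℂ}
    (h : (fun t : ℝ => a * t + b * (t : ℂ) ^ 2) =o[𝓝 0] fun t : ℝ => t ^ 2) : a = 0 ∧ b = 0 := by
  have hid : Tendsto (fun t : ℝ => (t : ℂ)) (𝓝[≠] 0) (𝓝 0) := by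
    have : Tendsto (fun t : ℝ => (t : ℂ)) (𝓝 0) (𝓝 ((0 : ℝ) : ℂ)) :=
      Complex.continuous_ofReal.tendsto 0
    simpa using this.mono_left nhdsWithin_le_nhds
  have h' := h.mono (nhdsWithin_le_nhds (s := {0}ᶜ))
  have h2 : Tendsto (fun t : ℝ => (a * t + b * (t : ℂ) ^ 2) / (t : ℂ) ^ 2) (𝓝[≠] 0) (𝓝 0) := by
    have h3 : (fun t : ℝ => a * t + b * (t : ℂ) ^ 2) =o[𝓝[≠] 0] fun t : ℝ => (t : ℂ) ^ 2 := by
      refine h'.trans_isBigO (IsBigO.of_bound 1 (Eventually.of_forall fun t => ?_))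
      simp
    exact h3.tendsto_div_nhds_zero
  have hne : ∀ᶠ t : ℝ in 𝓝[≠] 0, t ≠ 0 := eventually_mem_nhdsWithin
  have ha : a = 0 := by
    have h4 : Tendsto (fun t : ℝ => (a * t + b * (t : ℂ) ^ 2) / (t : ℂ) ^ 2 * t - b * t)
        (𝓝[≠] 0) (𝓝 (0 * 0 - b * 0)) := (h2.mul hid).sub (hid.const_mul b)
    have h5 : Tendsto (fun _ : ℝ => a) (𝓝[≠] 0) (𝓝 (0 * 0 - b * 0)) := by
      refine h4.congr' ?_
      filter_upwards [hne] with t ht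
      have : (t : ℂ) ≠ 0 := by exact_mod_cast ht
      field_simp
      ring
    simpa using tendsto_nhds_unique tendsto_const_nhds h5
  refine ⟨ha, ?_⟩
  have h5 : Tendsto (fun _ : ℝ => b) (𝓝[≠] 0) (𝓝 0) := by
    refine h2.congr' ?_
    filter_upwards [hne] with t ht
    have : (t : ℂ) ≠ 0 := by exact_mod_cast ht
    simp [ha, this]
  exact tendsto_nhds_unique tendsto_const_nhds h5

variable {Ω : Type*} [MeasurableSpace Ω] {P : Measure Ω} [IsProbabilityMeasure P]

theorem integrable_cexp_mul_I {X : Ω → ℝ} (hX : Measurable X) (t : ℝ) :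
    Integrable (fun ω => Complex.exp (t * X ω * Complex.I)) P := by
  refine Integrable.of_bound (C := 1) (by fun_prop) (ae_of_all _ fun ω => ?_)
  rw [← Complex.ofReal_mul, Complex.norm_exp_ofReal_mul_I]

/-- In this symmetric second difference of the characteristic function the linear Taylor term
cancels, so it is O(t²) without any knowledge of a mean. -/
theorem integral_two_sub_two_cos {X : Ω → ℝ} (hX : Measurable X) (t : ℝ) :
    ((∫ ω, (2 - 2 * Real.cos (t * X ω)) ∂P : ℝ) : ℂ) =
      2 - (∫ ω, Complex.exp (t * X ω * Complex.I) ∂P)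
        - ∫ ω, Complex.exp ((-t : ℝ) * X ω * Complex.I) ∂P := by
  have h1 := integrable_cexp_mul_I (P := P) hX t
  have h2 := integrable_cexp_mul_I (P := P) hX (-t)
  rw [← integral_complex_ofReal]
  have : (2 : ℂ) = ∫ _, (2 : ℂ) ∂P := by simp
  have h3 : Integrable (fun ω => (2 : ℂ) - Complex.exp (t * X ω * Complex.I)) P :=
    (integrable_const _).sub h1
  rw [this, ← integral_sub (integrable_const _) h1, ← integral_sub h3 h2]
  congr 1
  ext ω
  push_cast
  rw [Complex.cos]
  ring_nf

/-- A random variable whose characteristic function is quadratic up to `O(t³)` at `0`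
has a finite second moment. -/
theorem memLp_two_of_charFun_taylor {X : Ω → ℝ} (hX : Measurable X) {c₁ c₂ : ℂ} {C η : ℝ}
    (hη : 0 < η)
    (h : ∀ t : ℝ, |t| < η → ‖(∫ ω, Complex.exp (t * X ω * Complex.I) ∂P)
      - (1 + c₁ * t + c₂ * (t : ℂ) ^ 2)‖ ≤ C * |t| ^ 3) : MemLp X 2 P := by
  rw [memLp_two_iff_integrable_sq hX.aestronglyMeasurable]
  set B : ℝ := 2 * ‖c₂‖ + 2 * |C| with hB
  set s : ℕ → ℝ := fun k => 1 / ((k : ℝ) + 1) with hs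
  have hspos : ∀ k, 0 < s k := fun k => by positivity
  have hs0 : Tendsto s atTop (𝓝 0) := tendsto_one_div_add_atTop_nhds_zero_nat
  -- These functions are nonnegative and tend to X² as s → 0, so Fatou's lemma bounds the second
  -- moment by expectations that the Taylor expansion controls.
  set g : ℕ → Ω → ℝ := fun k ω => (2 - 2 * Real.cos (s k * X ω)) / s k ^ 2 with hg
  have hg0 : ∀ k ω, 0 ≤ g k ω := fun k ω => by
    have := Real.cos_le_one (s k * X ω)
    exact div_nonneg (by linarith) (by positivity)
  have hgm : ∀ k, Measurable (g k) := fun k => by fun_prop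
  have hgi : ∀ k, Integrable (g k) P := fun k => by
    refine Integrable.of_bound (C := 4 / s k ^ 2) (hgm k).aestronglyMeasurable
      (ae_of_all _ fun ω => ?_)
    rw [Real.norm_of_nonneg (hg0 k ω)]
    have := Real.neg_one_le_cos (s k * X ω)
    exact div_le_div_of_nonneg_right (by linarith) (by positivity)
  have hlim : ∀ ω, Tendsto (fun k => g k ω) atTop (𝓝 (X ω ^ 2)) := by
    intro ω
    have hsin : Tendsto (fun u : ℝ => Real.sinc u) (𝓝 0) (𝓝 1) := by
      have := Real.continuous_sinc.tendsto 0
      simpa using this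
    have h2 : Tendsto (fun k => s k * X ω / 2) atTop (𝓝 0) := by
      simpa using (hs0.mul_const (X ω)).div_const 2
    -- By 2 − 2cos θ = 4 sin²(θ/2), the quotient equals X² sinc²(sX/2).
    have h3 : Tendsto (fun k => X ω ^ 2 * Real.sinc (s k * X ω / 2) ^ 2) atTop
        (𝓝 (X ω ^ 2 * 1 ^ 2)) := ((hsin.comp h2).pow 2).const_mul _
    rw [one_pow, mul_one] at h3
    refine h3.congr fun k => ?_
    by_cases hx : X ω = 0
    · simp [hg, hx]
    have hk : s k * X ω / 2 ≠ 0 := div_ne_zero (mul_ne_zero (hspos k).ne' hx) two_ne_zero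
    rw [Real.sinc_of_ne_zero hk]
    have hc : Real.cos (s k * X ω) = 1 - 2 * Real.sin (s k * X ω / 2) ^ 2 := by
      have := Real.cos_sq' (s k * X ω / 2)
      have h2 := Real.cos_two_mul (s k * X ω / 2)
      rw [show 2 * (s k * X ω / 2) = s k * X ω by ring] at h2
      rw [h2, this]; ring
    simp only [hg, hc]
    have := (hspos k).ne'
    field_simp
    ring
  have hbound : ∀ᶠ k in atTop, ∫ ω, g k ω ∂P ≤ B := by
    have h1 : ∀ᶠ k in atTop, s k < η := hs0.eventually (gt_mem_nhds hη)
    filter_upwards [h1] with k hk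
    have hk0 := hspos k
    have hk1 : s k ≤ 1 := by
      simp only [hs]
      rw [div_le_one (by positivity)]
      linarith [(Nat.cast_nonneg k : (0 : ℝ) ≤ k)]
    have ha := h (s k) (by rwa [abs_of_pos hk0])
    have hb := h (-s k) (by rwa [abs_neg, abs_of_pos hk0])
    have hint := integral_two_sub_two_cos (P := P) hX (s k)
    have hn : ‖((∫ ω, (2 - 2 * Real.cos (s k * X ω)) ∂P : ℝ) : ℂ)‖ ≤ B * s k ^ 2 := by
      rw [hint]
      set u := ∫ ω, Complex.exp (s k * X ω * Complex.I) ∂P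
      set v := ∫ ω, Complex.exp ((-s k : ℝ) * X ω * Complex.I) ∂P
      rw [abs_neg, abs_of_pos hk0] at hb
      rw [abs_of_pos hk0] at ha
      -- The contributions ±c₁s cancel. What is left is the quadratic term and two cubic remainders,
      -- which B collects using s ≤ 1.
      have e : (2 : ℂ) - u - v = -(u - (1 + c₁ * s k + c₂ * (s k : ℂ) ^ 2))
          - (v - (1 + c₁ * (-s k : ℝ) + c₂ * ((-s k : ℝ) : ℂ) ^ 2)) - 2 * c₂ * (s k : ℂ) ^ 2 := by
        push_cast; ring
      rw [e]
      refine (norm_sub_le _ _).trans ?_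
      have h3 : ‖2 * c₂ * (s k : ℂ) ^ 2‖ = 2 * ‖c₂‖ * s k ^ 2 := by
        simp [abs_of_pos hk0]
      have h4 : C * s k ^ 3 ≤ |C| * s k ^ 2 := by
        calc C * s k ^ 3 ≤ |C| * s k ^ 3 := by gcongr; exact le_abs_self C
          _ ≤ |C| * s k ^ 2 := by
              gcongr |C| * ?_
              exact pow_le_pow_of_le_one hk0.le hk1 (by norm_num)
      rw [h3]
      refine (add_le_add_left ((norm_sub_le _ _).trans (add_le_add ?_ hb)) _).trans
        (b := C * s k ^ 3 + C * s k ^ 3 + 2 * ‖c₂‖ * s k ^ 2) ?_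
      · rwa [norm_neg]
      · rw [hB]; nlinarith [h4]
    have e2 : ∫ ω, g k ω ∂P = (∫ ω, (2 - 2 * Real.cos (s k * X ω)) ∂P) / s k ^ 2 := by
      simp only [hg]; rw [integral_div]
    rw [e2, div_le_iff₀ (by positivity)]
    rw [Complex.norm_real] at hn
    exact (le_abs_self _).trans hn
  refine ⟨(hX.pow_const 2).aestronglyMeasurable, ?_⟩
  rw [hasFiniteIntegral_iff_ofReal (ae_of_all _ fun ω => sq_nonneg _)]
  have hfatou : ∫⁻ ω, ENNReal.ofReal (X ω ^ 2) ∂P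
      ≤ liminf (fun k => ∫⁻ ω, ENNReal.ofReal (g k ω) ∂P) atTop := by
    refine le_trans (le_of_eq ?_) (lintegral_liminf_le fun k => (hgm k).ennreal_ofReal)
    refine lintegral_congr fun ω => ?_
    exact ((ENNReal.continuous_ofReal.tendsto _).comp (hlim ω)).liminf_eq.symm
  refine hfatou.trans_lt (lt_of_le_of_lt ?_ (ENNReal.ofReal_lt_top (r := B)))
  have hev : ∀ᶠ k in atTop, ∫⁻ ω, ENNReal.ofReal (g k ω) ∂P ≤ ENNReal.ofReal B := by
    filter_upwards [hbound] with k hk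
    rw [← ofReal_integral_eq_lintegral_ofReal (hgi k) (ae_of_all _ (hg0 k))]
    exact ENNReal.ofReal_le_ofReal hk
  exact liminf_le_of_le (by isBoundedDefault) fun b hb =>
    (hb.and hev).exists.elim fun k hk => hk.1.trans hk.2

theorem charFun_map_eq {Q : Measure Ω} {X : Ω → ℝ} (hX : Measurable X) (t : ℝ) :
    charFun (Q.map X) t = ∫ ω, Complex.exp (t * X ω * Complex.I) ∂Q := by
  rw [charFun_apply_real, integral_map hX.aemeasurable (by fun_prop)]

/-- The first two moments are read off the quadratic Taylor polynomial of the characteristic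
function. -/
theorem moments_of_charFun_taylor {X : Ω → ℝ} (hX : Measurable X) {c₁ c₂ : ℂ} {C η : ℝ}
    (hη : 0 < η)
    (h : ∀ t : ℝ, |t| < η → ‖(∫ ω, Complex.exp (t * X ω * Complex.I) ∂P)
      - (1 + c₁ * t + c₂ * (t : ℂ) ^ 2)‖ ≤ C * |t| ^ 3) :
    c₁ = (∫ ω, X ω ∂P : ℝ) * Complex.I ∧ c₂ = -(∫ ω, X ω ^ 2 ∂P : ℝ) / 2 := by
  have hL := memLp_two_of_charFun_taylor hX hη h
  have hL' : MemLp id 2 (P.map X) := by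
    rw [memLp_map_measure_iff (by fun_prop) hX.aemeasurable]
    simpa using hL
  have : IsProbabilityMeasure (P.map X) := Measure.isProbabilityMeasure_map hX.aemeasurable
  -- With a second moment available, the moments give a quadratic Taylor polynomial as well, and two
  -- such polynomials agreeing up to o(t²) coincide.
  have ht := taylor_isLittleO_univ (f := charFun (P.map X)) (n := 2) (x₀ := 0)
    (contDiff_charFun (by exact_mod_cast hL'))
  simp only [taylorWithinEval_charFun_two_zero hX.aemeasurable hL', sub_zero,
    charFun_map_eq hX] at ht
  have hO : (fun t : ℝ => (∫ ω, Complex.exp (t * X ω * Complex.I) ∂P)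
      - (1 + c₁ * t + c₂ * (t : ℂ) ^ 2)) =o[𝓝 0] fun t : ℝ => t ^ 2 := by
    have h1 : (fun t : ℝ => (∫ ω, Complex.exp (t * X ω * Complex.I) ∂P)
      - (1 + c₁ * t + c₂ * (t : ℂ) ^ 2)) =O[𝓝 0] fun t : ℝ => t ^ 3 := by
      refine IsBigO.of_bound C ?_
      filter_upwards [Metric.ball_mem_nhds (0 : ℝ) hη] with t ht
      rw [norm_pow, Real.norm_eq_abs]
      exact h t (by simpa using ht)
    exact h1.trans_isLittleO (isLittleO_pow_pow (by norm_num))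
  have hd := ht.sub hO
  have := coeff_eq_zero_of_isLittleO_sq
    (a := c₁ - (∫ ω, X ω ∂P : ℝ) * Complex.I) (b := c₂ + (∫ ω, X ω ^ 2 ∂P : ℝ) / 2) (by
      refine hd.congr_left fun t => ?_
      simp only [Pi.pow_apply]
      ring)
  constructor
  · exact sub_eq_zero.1 this.1
  · rw [eq_neg_of_add_eq_zero_left this.2]; ring

end Probability

theorem mul_tendsto_zero_of_isBigO_one {f g : ℕ → ℝ} (hf : f =O[atTop] fun _ => (1 : ℝ))
    (hg : Tendsto g atTop (𝓝 0)) : Tendsto (fun n => f n * g n) atTop (𝓝 0) := by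
  have h := hf.mul_isLittleO ((isLittleO_one_iff ℝ).2 hg)
  simp only [mul_one] at h
  exact (isLittleO_one_iff ℝ).1 h

/-- Central limit theorem from the asymptotics of the characteristic functions on the scale
`n^{-1/2}`. -/
theorem tendstoInDistribution_of_charFun_asymp {Ω : ℕ → Type*} [∀ n, MeasurableSpace (Ω n)]
    (P : (n : ℕ) → Measure (Ω n)) [∀ n, IsProbabilityMeasure (P n)]
    (X : (n : ℕ) → Ω n → ℝ) (hX : ∀ n, Measurable (X n)) {μ σsq : ℝ} (hσ : 0 < σsq)
    (hmean : (fun n : ℕ => (∫ ω, X n ω ∂(P n)) - μ * n) =O[atTop] (fun _ => (1 : ℝ)))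
    (hvar : (fun n : ℕ => variance (X n) (P n) - σsq * n) =O[atTop] (fun _ => (1 : ℝ)))
    (hφ : ∀ (t : ℕ → ℝ) (τ : ℝ), Tendsto (fun n => t n * Real.sqrt n) atTop (𝓝 τ) →
      Tendsto (fun n : ℕ => Complex.exp (-(μ * n * t n) * Complex.I)
        * ∫ ω, Complex.exp (t n * X n ω * Complex.I) ∂(P n)) atTop
        (𝓝 (Complex.exp (-(σsq * τ ^ 2 / 2))))) :
    TendstoInDistribution
      (fun (n : ℕ) (ω : Ω n) => (X n ω - ∫ ω', X n ω' ∂(P n)) / Real.sqrt (variance (X n) (P n)))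
      atTop (id : ℝ → ℝ) P (gaussianReal 0 1) := by
  have hmeas : ∀ n, Measurable (fun ω : Ω n =>
      (X n ω - ∫ ω', X n ω' ∂(P n)) / Real.sqrt (variance (X n) (P n))) := fun n =>
    ((hX n).sub_const _).div_const _
  refine ⟨fun n => (hmeas n).aemeasurable, by fun_prop, ?_⟩
  refine ProbabilityMeasure.tendsto_iff_tendsto_charFun.2 fun ξ => ?_
  set m : ℕ → ℝ := fun n => ∫ ω, X n ω ∂(P n) with hm
  set V : ℕ → ℝ := fun n => variance (X n) (P n) with hV
  -- Up to a phase, the normalized variable has at ξ the characteristic function of X at this t, and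
  -- t√n → ξ/√σ².
  set t : ℕ → ℝ := fun n => ξ / Real.sqrt (V n) with ht
  have hninv : Tendsto (fun n : ℕ => ((n : ℝ))⁻¹) atTop (𝓝 0) := tendsto_inv_atTop_nhds_zero_nat
  have hVn : Tendsto (fun n : ℕ => V n / n) atTop (𝓝 σsq) := by
    have h1 : Tendsto (fun n : ℕ => (V n - σsq * n) * (n : ℝ)⁻¹) atTop (𝓝 0) := by
      exact mul_tendsto_zero_of_isBigO_one hvar hninv
    have h2 := h1.add_const σsq
    rw [zero_add] at h2
    refine h2.congr' ?_
    filter_upwards [eventually_gt_atTop 0] with n hn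
    have : (n : ℝ) ≠ 0 := by positivity
    field_simp
    ring
  have htlim : Tendsto (fun n => t n * Real.sqrt n) atTop (𝓝 (ξ / Real.sqrt σsq)) := by
    have h1 : Tendsto (fun n : ℕ => ξ / Real.sqrt (V n / n)) atTop (𝓝 (ξ / Real.sqrt σsq)) :=
      tendsto_const_nhds.div ((Real.continuous_sqrt.tendsto _).comp hVn)
        (Real.sqrt_pos.2 hσ).ne'
    refine h1.congr' ?_
    filter_upwards [eventually_gt_atTop 0] with n hn
    have hn' : (0 : ℝ) < n := by exact_mod_cast hn
    simp only [ht]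
    rw [Real.sqrt_div' _ hn'.le, div_div_eq_mul_div, div_mul_eq_mul_div]
  have ht0 : Tendsto t atTop (𝓝 0) := by
    have h1 : Tendsto (fun n : ℕ => (Real.sqrt n)⁻¹) atTop (𝓝 0) :=
      tendsto_inv_atTop_zero.comp (Real.tendsto_sqrt_atTop.comp tendsto_natCast_atTop_atTop)
    have h2 := htlim.mul h1
    rw [mul_zero] at h2
    refine h2.congr' ?_
    filter_upwards [eventually_gt_atTop 0] with n hn
    have : Real.sqrt n ≠ 0 := by positivity
    field_simp
  -- Centring at the mean instead of μn costs a phase tending to 1, because the two centres differ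
  -- by O(1) and t → 0.
  have hshift : Tendsto (fun n : ℕ => Complex.exp (-((m n - μ * n) * t n : ℝ) * Complex.I)) atTop
      (𝓝 1) := by
    have h1 : Tendsto (fun n : ℕ => (m n - μ * n) * t n) atTop (𝓝 0) := by
      exact mul_tendsto_zero_of_isBigO_one hmean ht0
    have h2 : Continuous fun x : ℝ => Complex.exp (-(x : ℂ) * Complex.I) := by fun_prop
    have h3 := (h2.tendsto 0).comp h1
    simp only [Complex.ofReal_zero, neg_zero, zero_mul, Complex.exp_zero] at h3
    exact h3
  have hmain := hshift.mul (hφ t _ htlim)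
  have hval : (1 : ℂ) * Complex.exp (-(σsq * ((ξ / Real.sqrt σsq : ℝ) : ℂ) ^ 2 / 2))
      = charFun ((gaussianReal 0 1).map id) ξ := by
    rw [Measure.map_id, charFun_gaussianReal, one_mul]
    congr 1
    rw [← Complex.ofReal_pow, div_pow, Real.sq_sqrt hσ.le]
    push_cast
    have : (σsq : ℂ) ≠ 0 := by exact_mod_cast hσ.ne'
    field_simp
    simp [sq]
  change Tendsto _ _ (𝓝 (charFun ((gaussianReal 0 1).map id) ξ))
  rw [← hval]
  refine hmain.congr fun n => ?_
  change _ = charFun ((P n).map _) ξ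
  rw [charFun_map_eq (hmeas n)]
  rw [← mul_assoc, ← Complex.exp_add, ← integral_const_mul]
  congr 1
  ext ω
  rw [← Complex.exp_add]
  congr 1
  simp only [ht, hm, hV]
  push_cast
  ring

end SingleEquation

namespace SingleEquation

/-! ### Laplace's method for a perturbed Gaussian exponent. -/

section Laplace

theorem re_ge_of_norm_sub_le {z w : ℂ} {e : ℝ} (h : ‖z - w‖ ≤ e) : w.re - e ≤ z.re := by
  have := (Complex.abs_re_le_norm (z - w)).trans h
  rw [Complex.sub_re] at this
  linarith [(abs_le.1 this).1]

theorem norm_cexp_neg_nat_mul (n : ℕ) (z : ℂ) :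
    ‖Complex.exp (-(n * z))‖ = Real.exp (-(n * z.re)) := by
  rw [Complex.norm_exp]
  simp

/-- This supplies the dominating Gaussian. Of the available κNβ²/2, the cubic error consumes κ/8
because δ is small, and the cross term κ/16 after completing a square; everything depending on t
alone is bounded since Nt² ≤ T². -/
theorem laplace_exponent_lower {N κ C δ T M Q β t m p : ℝ} (hκ : 0 < κ) (hC : 0 ≤ C)
    (hN : 1 ≤ N) (hCδ : 32 * C * δ ≤ κ) (hβ : |β| ≤ δ) (hT : 0 ≤ T) (ht : N * t ^ 2 ≤ T ^ 2)
    (hm : |m| ≤ M) (hp : |p| ≤ Q) :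
    κ / 4 * (N * β ^ 2) - (4 * M ^ 2 * T ^ 2 / κ + Q * T ^ 2 + 4 * C * T ^ 3)
      ≤ N * ((κ * β ^ 2 + 2 * m * β * t + p * t ^ 2) / 2 - C * (|β| + |t|) ^ 3) := by
  have hN0 : 0 ≤ N := by linarith
  have htT : |t| ≤ T :=
    abs_le_of_sq_le_sq (by nlinarith [sq_nonneg t]) hT
  have hcube : (|β| + |t|) ^ 3 ≤ 4 * (|β| ^ 3 + |t| ^ 3) := by
    nlinarith [mul_nonneg (add_nonneg (abs_nonneg β) (abs_nonneg t)) (sq_nonneg (|β| - |t|))]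
  have h4 : N * (C * (|β| + |t|) ^ 3) ≤ κ / 8 * (N * β ^ 2) + 4 * C * T ^ 3 := by
    have e1 : N * |β| ^ 3 ≤ δ * (N * β ^ 2) := by
      rw [show N * |β| ^ 3 = |β| * (N * β ^ 2) by rw [← sq_abs β]; ring]
      exact mul_le_mul_of_nonneg_right hβ (by positivity)
    have e2 : N * |t| ^ 3 ≤ T * T ^ 2 := by
      rw [show N * |t| ^ 3 = |t| * (N * t ^ 2) by rw [← sq_abs t]; ring]
      exact mul_le_mul htT ht (by positivity) hT
    calc N * (C * (|β| + |t|) ^ 3) ≤ N * (C * (4 * (|β| ^ 3 + |t| ^ 3))) := by gcongr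
      _ = 4 * C * (N * |β| ^ 3) + 4 * C * (N * |t| ^ 3) := by ring
      _ ≤ 4 * C * (δ * (N * β ^ 2)) + 4 * C * (T * T ^ 2) := by gcongr
      _ = (32 * C * δ) / 8 * (N * β ^ 2) + 4 * C * T ^ 3 := by ring
      _ ≤ _ := by gcongr
  have h7 : -(Q * T ^ 2) ≤ p * (N * t ^ 2) / 2 := by
    have h8 : |p * (N * t ^ 2)| ≤ Q * T ^ 2 := by
      rw [abs_mul, abs_of_nonneg (by positivity : 0 ≤ N * t ^ 2)]
      exact mul_le_mul hp ht (by positivity) ((abs_nonneg p).trans hp)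
    linarith [(abs_le.1 h8).1, (abs_nonneg _).trans h8]
  have h5 : -(κ / 16 * (N * β ^ 2) + 4 * M ^ 2 * T ^ 2 / κ) ≤ m * β * t * N := by
    -- The weights are chosen so that the expanded square contains exactly the cross term mβtN.
    have hx : 0 ≤ (κ / 4 * β + 2 * (m * t)) ^ 2 / κ * N := by positivity
    have e : (κ / 4 * β + 2 * (m * t)) ^ 2 / κ * N
        = κ / 16 * (N * β ^ 2) + m * β * t * N + 4 * m ^ 2 * (N * t ^ 2) / κ := by
      field_simp; ring
    have h9 : 4 * m ^ 2 * (N * t ^ 2) / κ ≤ 4 * M ^ 2 * T ^ 2 / κ := by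
      have : m ^ 2 ≤ M ^ 2 := by rw [← sq_abs m]; exact pow_le_pow_left₀ (abs_nonneg _) hm 2
      gcongr
    linarith
  have h10 : N * ((κ * β ^ 2 + 2 * m * β * t + p * t ^ 2) / 2 - C * (|β| + |t|) ^ 3)
      = κ / 2 * (N * β ^ 2) + m * β * t * N + p * (N * t ^ 2) / 2
        - N * (C * (|β| + |t|) ^ 3) := by ring
  have : 0 ≤ N * β ^ 2 := by positivity
  rw [h10]
  nlinarith

theorem quadratic_form_re {κ β t : ℝ} {m p : ℂ} :
    ((κ * (β : ℂ) ^ 2 + 2 * m * β * t + p * (t : ℂ) ^ 2) / 2).re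
      = (κ * β ^ 2 + 2 * m.re * β * t + p.re * t ^ 2) / 2 := by
  have : (κ * (β : ℂ) ^ 2 + 2 * m * β * t + p * (t : ℂ) ^ 2) / 2
      = (((κ * β ^ 2) / 2 : ℝ) : ℂ) + m * ((β * t : ℝ) : ℂ) + p * ((t ^ 2 / 2 : ℝ) : ℂ) := by
    push_cast; ring
  rw [this, Complex.add_re, Complex.add_re, Complex.re_mul_ofReal, Complex.re_mul_ofReal,
    Complex.ofReal_re]
  ring

theorem aestronglyMeasurable_comp_div {f : ℝ → ℂ} (hf : AEStronglyMeasurable f volume) (c : ℝ) :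
    AEStronglyMeasurable (fun v => f (v / c)) volume := by
  rcases eq_or_ne c 0 with rfl | h0
  · simp only [div_zero]; exact aestronglyMeasurable_const
  · simp only [div_eq_mul_inv]
    refine hf.comp_quasiMeasurePreserving (f := fun v => v * c⁻¹) ⟨by fun_prop, ?_⟩
    rw [Real.map_volume_mul_right (inv_ne_zero h0)]
    exact Measure.smul_absolutelyContinuous

/-- The substitution β = v/√n replaces a fixed window by the whole line, the window surviving in an
indicator, so that dominated convergence applies. At n = 0 both sides vanish. -/
theorem integral_comp_div_indicator (g : ℝ → ℂ) {δ : ℝ} (hδ : 0 < δ) (n : ℕ) :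
    ∫ v : ℝ, (Set.Ioc (-δ) δ).indicator g (v / Real.sqrt n)
      = (Real.sqrt n : ℂ) * ∫ β in (-δ)..δ, g β := by
  rw [Measure.integral_comp_div ((Set.Ioc (-δ) δ).indicator g) (Real.sqrt n),
    abs_of_nonneg (Real.sqrt_nonneg _),
    intervalIntegral.integral_of_le (by linarith), ← integral_indicator measurableSet_Ioc]
  simp

theorem tendsto_sqrt_nat : Tendsto (fun n : ℕ => Real.sqrt n) atTop atTop :=
  Real.tendsto_sqrt_atTop.comp tendsto_natCast_atTop_atTop

/-- On the scale β, t ~ n^{-1/2} the factor n exactly compensates the scaling of the quadratic form,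
while the cubic error becomes n · n^{-3/2}. -/
theorem tendsto_scaled_quadratic {δ κ C τ v : ℝ} {m p : ℂ} (hδ : 0 < δ)
    {Λ : ℕ → ℝ → ℂ} {t : ℕ → ℝ}
    (ht : Tendsto (fun n : ℕ => t n * Real.sqrt n) atTop (𝓝 τ))
    (hΛ : ∀ᶠ n in atTop, ∀ β ∈ Set.Icc (-δ) δ,
      ‖Λ n β - (κ * (β : ℂ) ^ 2 + 2 * m * β * t n + p * (t n : ℂ) ^ 2) / 2‖
        ≤ C * (|β| + |t n|) ^ 3) :
    Tendsto (fun n : ℕ => n * Λ n (v / Real.sqrt n)) atTop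
      (𝓝 ((κ * (v : ℂ) ^ 2 + 2 * m * v * τ + p * (τ : ℂ) ^ 2) / 2)) := by
  have hsinv : Tendsto (fun n : ℕ => (Real.sqrt n)⁻¹) atTop (𝓝 0) :=
    tendsto_inv_atTop_zero.comp tendsto_sqrt_nat
  have hvn : Tendsto (fun n : ℕ => v / Real.sqrt n) atTop (𝓝 0) :=
    tendsto_sqrt_nat.const_div_atTop v
  have hmem : ∀ᶠ n : ℕ in atTop, v / Real.sqrt n ∈ Set.Ioo (-δ) δ :=
    hvn.eventually (Ioo_mem_nhds (by linarith) hδ)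
  have hquad : Tendsto (fun n : ℕ => (κ * (v : ℂ) ^ 2 + 2 * m * v * ((t n * Real.sqrt n : ℝ) : ℂ)
      + p * ((t n * Real.sqrt n : ℝ) : ℂ) ^ 2) / 2) atTop
      (𝓝 ((κ * (v : ℂ) ^ 2 + 2 * m * v * τ + p * (τ : ℂ) ^ 2) / 2)) := by
    have h1 : Tendsto (fun n : ℕ => ((t n * Real.sqrt n : ℝ) : ℂ)) atTop (𝓝 (τ : ℂ)) :=
      (Complex.continuous_ofReal.tendsto _).comp ht
    exact ((tendsto_const_nhds.add (h1.const_mul _)).add ((h1.pow 2).const_mul _)).div_const _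
  have herr : Tendsto (fun n : ℕ => C * (|v| + |t n * Real.sqrt n|) ^ 3 * (Real.sqrt n)⁻¹) atTop
      (𝓝 0) := by
    have h0 : Tendsto (fun n : ℕ => C * (|v| + |t n * Real.sqrt n|) ^ 3) atTop
        (𝓝 (C * (|v| + |τ|) ^ 3)) := ((tendsto_const_nhds.add ht.abs).pow 3).const_mul C
    simpa using h0.mul hsinv
  have hdiff : Tendsto (fun n : ℕ => n * Λ n (v / Real.sqrt n)
      - (κ * (v : ℂ) ^ 2 + 2 * m * v * ((t n * Real.sqrt n : ℝ) : ℂ)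
      + p * ((t n * Real.sqrt n : ℝ) : ℂ) ^ 2) / 2) atTop (𝓝 0) := by
    refine squeeze_zero_norm' ?_ herr
    filter_upwards [hΛ, hmem, eventually_ge_atTop 1] with n hn hm hn1
    have hn0 : (1 : ℝ) ≤ n := by exact_mod_cast hn1
    have hs0 : 0 < Real.sqrt n := Real.sqrt_pos.2 (by linarith)
    have h1 := hn _ ⟨hm.1.le, hm.2.le⟩
    obtain ⟨r, hr⟩ : ∃ r, r = Real.sqrt n := ⟨_, rfl⟩
    have hsq : (n : ℝ) = r ^ 2 := by rw [hr, Real.sq_sqrt (by linarith)]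
    rw [← hr] at hs0 h1 ⊢
    have hsC : (r : ℂ) ≠ 0 := by exact_mod_cast hs0.ne'
    have hsqC : (n : ℂ) = (r : ℂ) ^ 2 := by exact_mod_cast hsq
    have e : (n : ℂ) * Λ n (v / r)
      - (κ * (v : ℂ) ^ 2 + 2 * m * v * ((t n * r : ℝ) : ℂ)
      + p * ((t n * r : ℝ) : ℂ) ^ 2) / 2 = n * (Λ n (v / r)
      - (κ * ((v / r : ℝ) : ℂ) ^ 2 + 2 * m * ((v / r : ℝ) : ℂ) * t n
        + p * (t n : ℂ) ^ 2) / 2) := by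
      rw [hsqC]; push_cast; field_simp
    rw [e, norm_mul, Complex.norm_natCast]
    refine (mul_le_mul_of_nonneg_left h1 (by linarith)).trans (le_of_eq ?_)
    rw [abs_div, abs_mul, abs_of_pos hs0, hsq]
    field_simp
  have hlim := hdiff.add hquad
  simpa only [sub_add_cancel, zero_add] using hlim

/-- Laplace's method for an exponent that is close to a quadratic form in `(β, t)`, on the scale
`β, t ~ n^{-1/2}`. -/
theorem tendsto_sqrt_mul_integral_exp {δ κ C τ : ℝ} {m p : ℂ} (hκ : 0 < κ) (hδ : 0 < δ)
    (hC : 0 ≤ C) (hCδ : 32 * C * δ ≤ κ) {Λ : ℕ → ℝ → ℂ} {t : ℕ → ℝ} {a : ℝ → ℂ}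
    (ha : Continuous a)
    (ht : Tendsto (fun n : ℕ => t n * Real.sqrt n) atTop (𝓝 τ))
    (hcont : ∀ᶠ n in atTop, ContinuousOn (Λ n) (Set.Icc (-δ) δ))
    (hΛ : ∀ᶠ n in atTop, ∀ β ∈ Set.Icc (-δ) δ,
      ‖Λ n β - (κ * (β : ℂ) ^ 2 + 2 * m * β * t n + p * (t n : ℂ) ^ 2) / 2‖
        ≤ C * (|β| + |t n|) ^ 3) :
    Tendsto (fun n : ℕ => (Real.sqrt n : ℂ) * ∫ β in (-δ)..δ, a β * Complex.exp (-(n * Λ n β)))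
      atTop (𝓝 (a 0 * ((2 * Real.pi / κ : ℂ) ^ (1 / 2 : ℂ)
        * Complex.exp ((m ^ 2 / κ - p) * τ ^ 2 / 2)))) := by
  set f : ℕ → ℝ → ℂ := fun n => (Set.Ioc (-δ) δ).indicator
    (fun β => a β * Complex.exp (-(n * Λ n β))) with hf
  refine Tendsto.congr (fun n => integral_comp_div_indicator _ hδ n) ?_
  obtain ⟨A, hA⟩ : ∃ A, ∀ β ∈ Set.Icc (-δ) δ, ‖a β‖ ≤ A :=
    isCompact_Icc.exists_bound_of_continuousOn ha.continuousOn
  obtain ⟨T, hT⟩ : ∃ T, ∀ᶠ n : ℕ in atTop, |t n * Real.sqrt n| ≤ T := by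
    refine ⟨|τ| + 1, ?_⟩
    exact (ht.abs.eventually (gt_mem_nhds (lt_add_one _))).mono fun n hn => hn.le
  set K : ℝ := 4 * ‖m‖ ^ 2 * T ^ 2 / κ + ‖p‖ * T ^ 2 + 4 * C * T ^ 3 with hK
  have hint : Integrable (fun v : ℝ => |A| * Real.exp K * Real.exp (-(κ / 4) * v ^ 2)) :=
    (integrable_exp_neg_mul_sq (by positivity)).const_mul _
  -- The pointwise limit is Gaussian with linear term mτv; completing the square produces m²τ²/(2κ),
  -- which joins −pτ²/2.
  have hval : ∫ v : ℝ, a 0 * Complex.exp (-(κ / 2 : ℂ) * v ^ 2 + -(m * τ) * v + -(p * τ ^ 2 / 2))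
      = a 0 * ((2 * Real.pi / κ : ℂ) ^ (1 / 2 : ℂ)
        * Complex.exp ((m ^ 2 / κ - p) * τ ^ 2 / 2)) := by
    have hκ' : (κ : ℂ) ≠ 0 := by exact_mod_cast hκ.ne'
    rw [integral_const_mul, integral_cexp_quadratic (by
      rw [Complex.neg_re, show (κ / 2 : ℂ) = ((κ / 2 : ℝ) : ℂ) by push_cast; ring,
        Complex.ofReal_re]; linarith)]
    congr 3
    · field_simp
    · field_simp
      ring
  rw [← hval]
  refine tendsto_integral_filter_of_dominated_convergence _ ?_ ?_ hint ?_
  · filter_upwards [hcont] with n hn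
    refine aestronglyMeasurable_comp_div ?_ _
    rw [aestronglyMeasurable_indicator_iff measurableSet_Ioc]
    refine ContinuousOn.aestronglyMeasurable (ContinuousOn.mono ?_ Set.Ioc_subset_Icc_self)
      measurableSet_Ioc
    exact ha.continuousOn.mul (hn.const_mul _).neg.cexp
  · filter_upwards [hΛ, hT, eventually_ge_atTop 1] with n hn hTn hn1
    refine ae_of_all _ fun v => ?_
    have hn0 : (1 : ℝ) ≤ n := by exact_mod_cast hn1
    have hs0 : 0 < Real.sqrt n := Real.sqrt_pos.2 (by linarith)
    have hsq : Real.sqrt n ^ 2 = n := Real.sq_sqrt (by linarith)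
    by_cases hv : v / Real.sqrt n ∈ Set.Ioc (-δ) δ
    swap
    · rw [Set.indicator_of_notMem hv, norm_zero]; positivity
    rw [Set.indicator_of_mem hv]
    have hv' := Set.Ioc_subset_Icc_self hv
    rw [norm_mul, norm_cexp_neg_nat_mul, mul_assoc]
    refine mul_le_mul ((hA _ hv').trans (le_abs_self A)) ?_ (Real.exp_pos _).le (abs_nonneg _)
    rw [← Real.exp_add]
    refine Real.exp_le_exp.2 ?_
    have h2 := re_ge_of_norm_sub_le (hn _ hv')
    rw [quadratic_form_re] at h2
    have h3 := mul_le_mul_of_nonneg_left h2 (by linarith : (0 : ℝ) ≤ n)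
    have h4 := laplace_exponent_lower (t := t n) hκ hC hn0 hCδ (abs_le.2 hv')
      ((abs_nonneg _).trans hTn) (by
        rw [← hsq, ← mul_pow, mul_comm, ← sq_abs]
        exact pow_le_pow_left₀ (abs_nonneg _) hTn 2) (Complex.abs_re_le_norm m)
      (Complex.abs_re_le_norm p)
    have h5 : n * (v / Real.sqrt n) ^ 2 = v ^ 2 := by
      rw [div_pow, hsq]; field_simp
    rw [h5, ← hK] at h4
    linarith
  · refine ae_of_all _ fun v => ?_
    have hvn : Tendsto (fun n : ℕ => v / Real.sqrt n) atTop (𝓝 0) :=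
      tendsto_sqrt_nat.const_div_atTop v
    have hmem : ∀ᶠ n : ℕ in atTop, v / Real.sqrt n ∈ Set.Ioo (-δ) δ :=
      hvn.eventually (Ioo_mem_nhds (by linarith) hδ)
    have hlim := tendsto_scaled_quadratic (v := v) hδ ht hΛ
    have hfin : Tendsto (fun n : ℕ => a (v / Real.sqrt n)
        * Complex.exp (-(n * Λ n (v / Real.sqrt n)))) atTop
        (𝓝 (a 0 * Complex.exp (-((κ * (v : ℂ) ^ 2 + 2 * m * v * τ + p * (τ : ℂ) ^ 2) / 2)))) :=
      ((ha.tendsto 0).comp hvn).mul ((Complex.continuous_exp.tendsto _).comp hlim.neg)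
    have e : -(κ / 2 : ℂ) * v ^ 2 + -(m * τ) * v + -(p * τ ^ 2 / 2)
        = -((κ * (v : ℂ) ^ 2 + 2 * m * v * τ + p * (τ : ℂ) ^ 2) / 2) := by ring
    rw [e]
    refine hfin.congr' ?_
    filter_upwards [hmem] with n hn
    rw [Set.indicator_of_mem (Set.Ioo_subset_Ioc_self hn)]

end Laplace

end SingleEquation

namespace SingleEquation

/-! ### Moments of the weight in the Laplace integral. -/

section LaplaceMoments

/-- The integral of `g(β) e^{iβ - nΛ(β)}` over `[-δ, δ]`. -/
noncomputable def laplaceIntegral (Λ : ℝ → ℂ) (δ : ℝ) (g : ℝ → ℂ) (n : ℕ) : ℂ :=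
  ∫ β in (-δ)..δ, g β * (Complex.exp (β * Complex.I) * Complex.exp (-(n * Λ β)))

/-- The scale `n^{-1/2}`. -/
noncomputable def invSqrt (n : ℕ) : ℝ := (Real.sqrt n)⁻¹

variable {Λ Λ' : ℝ → ℂ} {δ κ C : ℝ} {g h : ℝ → ℂ}

theorem invSqrt_pos {n : ℕ} (hn : 1 ≤ n) : 0 < invSqrt n :=
  inv_pos.2 (Real.sqrt_pos.2 (by exact_mod_cast hn))

theorem natCast_mul_invSqrt_sq {n : ℕ} (hn : 1 ≤ n) : (n : ℝ) * invSqrt n ^ 2 = 1 := by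
  rw [invSqrt, inv_pow, Real.sq_sqrt (Nat.cast_nonneg n)]
  exact mul_inv_cancel₀ (by positivity)

theorem tendsto_invSqrt : Tendsto invSqrt atTop (𝓝 0) :=
  tendsto_inv_atTop_zero.comp tendsto_sqrt_nat

theorem invSqrt_pow_isBigO {i j : ℕ} (hij : i ≤ j) :
    (fun n => invSqrt n ^ j) =O[atTop] fun n => invSqrt n ^ i := by
  have h1 : (fun x : ℝ => x ^ j) =O[𝓝 0] fun x : ℝ => x ^ i := by
    rcases hij.eq_or_lt with rfl | h
    · exact isBigO_refl _ _
    · exact (isLittleO_pow_pow h).isBigO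
  exact h1.comp_tendsto tendsto_invSqrt

theorem geometric_isBigO_invSqrt_pow {q : ℝ} (hq0 : 0 ≤ q) (hq : q < 1) (j : ℕ) :
    (fun n : ℕ => q ^ n) =O[atTop] fun n => invSqrt n ^ j := by
  have h1 : (fun n : ℕ => ((n ^ j : ℕ) : ℝ) * q ^ n) =O[atTop] fun _ => (1 : ℝ) := by
    have := (tendsto_pow_const_mul_const_pow_of_lt_one j hq0 hq).isBigO_one ℝ
    simpa using this
  have h2 : (fun n : ℕ => invSqrt n ^ (2 * j)) =O[atTop] fun n => invSqrt n ^ j :=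
    invSqrt_pow_isBigO (by omega)
  refine IsBigO.trans ?_ h2
  have h3 := h1.mul (isBigO_refl (fun n : ℕ => invSqrt n ^ (2 * j)) atTop)
  simp only [one_mul] at h3
  refine h3.congr' ?_ EventuallyEq.rfl
  filter_upwards [eventually_ge_atTop 1] with n hn
  have := natCast_mul_invSqrt_sq hn
  rw [pow_mul, mul_right_comm]
  push_cast
  rw [← mul_pow, this, one_pow, one_mul]

theorem intervalIntegrable_laplace (hδ : 0 < δ) (hΛ : ContinuousOn Λ (Set.Icc (-δ) δ))
    (hg : ContinuousOn g (Set.Icc (-δ) δ)) (n : ℕ) :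
    IntervalIntegrable (fun β : ℝ => g β * (Complex.exp (β * Complex.I)
      * Complex.exp (-(n * Λ β)))) volume (-δ) δ := by
  refine ContinuousOn.intervalIntegrable ?_
  rw [Set.uIcc_of_le (by linarith)]
  refine hg.mul (ContinuousOn.mul ?_ (hΛ.const_mul _).neg.cexp)
  exact (Continuous.continuousOn (by fun_prop))

theorem laplaceIntegral_add (hδ : 0 < δ) (hΛ : ContinuousOn Λ (Set.Icc (-δ) δ))
    (hg : ContinuousOn g (Set.Icc (-δ) δ)) (hh : ContinuousOn h (Set.Icc (-δ) δ)) (n : ℕ) :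
    laplaceIntegral Λ δ (fun β => g β + h β) n
      = laplaceIntegral Λ δ g n + laplaceIntegral Λ δ h n := by
  simp only [laplaceIntegral, add_mul]
  exact intervalIntegral.integral_add (intervalIntegrable_laplace hδ hΛ hg n)
    (intervalIntegrable_laplace hδ hΛ hh n)

theorem laplaceIntegral_const_mul (c : ℂ) (n : ℕ) :
    laplaceIntegral Λ δ (fun β => c * g β) n = c * laplaceIntegral Λ δ g n := by
  simp only [laplaceIntegral, mul_assoc, intervalIntegral.integral_const_mul]

theorem norm_cexp_laplace_le (hΛre : ∀ β ∈ Set.Icc (-δ) δ, κ * β ^ 2 ≤ (Λ β).re) (n : ℕ) {β : ℝ}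
    (hβ : β ∈ Set.Icc (-δ) δ) :
    ‖Complex.exp (β * Complex.I) * Complex.exp (-(n * Λ β))‖ ≤ Real.exp (-(n * (κ * β ^ 2))) := by
  rw [norm_mul, Complex.norm_exp_ofReal_mul_I, one_mul, norm_cexp_neg_nat_mul]
  refine Real.exp_le_exp.2 (neg_le_neg ?_)
  exact mul_le_mul_of_nonneg_left (hΛre β hβ) (Nat.cast_nonneg n)

theorem integrable_abs_pow_mul_exp_neg_mul_sq {b : ℝ} (hb : 0 < b) (k : ℕ) :
    Integrable fun v : ℝ => |v| ^ k * Real.exp (-b * v ^ 2) := by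
  have h := integrable_rpow_mul_exp_neg_mul_sq hb (s := k) (by
    have : (0 : ℝ) ≤ k := Nat.cast_nonneg k
    linarith)
  simp only [Real.rpow_natCast] at h
  refine h.norm.congr (ae_of_all _ fun v => ?_)
  simp

/-- The weight is dominated by e^{−nκβ²}; under β = v/√n the factor |β|^k yields k powers of
n^{-1/2} and dβ yields one more. -/
theorem laplaceIntegral_isBigO (hδ : 0 < δ) (hκ : 0 < κ)
    (hΛre : ∀ β ∈ Set.Icc (-δ) δ, κ * β ^ 2 ≤ (Λ β).re) (k : ℕ)
    (hg : ∀ β ∈ Set.Icc (-δ) δ, ‖g β‖ ≤ C * |β| ^ k) :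
    laplaceIntegral Λ δ g =O[atTop] fun n => invSqrt n ^ (k + 1) := by
  set M := ∫ v : ℝ, |v| ^ k * Real.exp (-κ * v ^ 2) with hM
  refine IsBigO.of_bound (C * M) ?_
  filter_upwards [eventually_ge_atTop 1] with n hn
  have hs0 : 0 < Real.sqrt n := Real.sqrt_pos.2 (by exact_mod_cast hn)
  have hsq : Real.sqrt n ^ 2 = n := Real.sq_sqrt (Nat.cast_nonneg n)
  have hC : 0 ≤ C := by
    have h1 := (norm_nonneg _).trans (hg δ ⟨by linarith, le_refl _⟩)
    exact nonneg_of_mul_nonneg_left h1 (by positivity)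
  have hint : Integrable fun β : ℝ => |β| ^ k * Real.exp (-(n * (κ * β ^ 2))) := by
    have := integrable_abs_pow_mul_exp_neg_mul_sq (b := n * κ) (by positivity) k
    refine this.congr (ae_of_all _ fun v => ?_)
    simp only
    congr 2; ring
  have h1 : ‖laplaceIntegral Λ δ g n‖
      ≤ ∫ β in (-δ)..δ, C * (|β| ^ k * Real.exp (-(n * (κ * β ^ 2)))) := by
    refine intervalIntegral.norm_integral_le_of_norm_le (by linarith) ?_
      (hint.const_mul C).intervalIntegrable
    refine ae_of_all _ fun β hβ => ?_
    have hβ' := Set.Ioc_subset_Icc_self hβ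
    rw [norm_mul, ← mul_assoc]
    exact mul_le_mul (hg β hβ') (norm_cexp_laplace_le hΛre n hβ') (norm_nonneg _) (by positivity)
  have h2 : ∫ β in (-δ)..δ, C * (|β| ^ k * Real.exp (-(n * (κ * β ^ 2))))
      ≤ C * ∫ β : ℝ, |β| ^ k * Real.exp (-(n * (κ * β ^ 2))) := by
    rw [intervalIntegral.integral_const_mul, intervalIntegral.integral_of_le (by linarith)]
    refine mul_le_mul_of_nonneg_left ?_ hC
    exact setIntegral_le_integral hint (ae_of_all _ fun β => by positivity)
  have h3 : ∫ β : ℝ, |β| ^ k * Real.exp (-(n * (κ * β ^ 2))) = invSqrt n ^ (k + 1) * M := by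
    have := Measure.integral_comp_mul_right (fun v : ℝ => |v| ^ k * Real.exp (-κ * v ^ 2))
      (Real.sqrt n)
    rw [← hM, abs_of_pos (by positivity), smul_eq_mul] at this
    rw [pow_succ, mul_assoc, invSqrt, ← this, ← integral_const_mul]
    congr 1
    ext β
    rw [abs_mul, abs_of_pos hs0, mul_pow, mul_pow, hsq, inv_pow]
    rw [show -κ * (β ^ 2 * n) = -(n * (κ * β ^ 2)) by ring]
    field_simp
  rw [norm_pow, Real.norm_of_nonneg (invSqrt_pos hn).le]
  calc _ ≤ _ := h1
    _ ≤ _ := h2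
    _ = _ := by rw [h3]; ring

/-- Integration by parts. -/
theorem laplaceIntegral_by_parts (hδ : 0 < δ) (hκ : 0 < κ)
    (hΛre : ∀ β ∈ Set.Icc (-δ) δ, κ * β ^ 2 ≤ (Λ β).re)
    (hd : ∀ β ∈ Set.Icc (-δ) δ, HasDerivAt Λ (Λ' β) β)
    (hΛ' : ContinuousOn Λ' (Set.Icc (-δ) δ)) (k j : ℕ) :
    (fun n : ℕ => n * laplaceIntegral Λ δ (fun β => Λ' β * (β : ℂ) ^ k) n
      - k * laplaceIntegral Λ δ (fun β => (β : ℂ) ^ (k - 1)) n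
      - Complex.I * laplaceIntegral Λ δ (fun β => (β : ℂ) ^ k) n)
      =O[atTop] fun n => invSqrt n ^ j := by
  have hΛc : ContinuousOn Λ (Set.Icc (-δ) δ) := fun β hβ =>
    (hd β hβ).continuousAt.continuousWithinAt
  have hpc : ∀ i : ℕ, ContinuousOn (fun β : ℝ => (β : ℂ) ^ i) (Set.Icc (-δ) δ) := fun i =>
    Continuous.continuousOn (by fun_prop)
  set f : ℕ → ℝ → ℂ := fun n β => (β : ℂ) ^ k * (Complex.exp (β * Complex.I)
    * Complex.exp (-(n * Λ β))) with hf
  -- The combination integrates minus the derivative of β^k e^{iβ − nΛ}, so only boundary terms at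
  -- ±δ remain. There Re Λ ≥ κδ², which makes them exponentially small.
  have key : ∀ n : ℕ, n * laplaceIntegral Λ δ (fun β => Λ' β * (β : ℂ) ^ k) n
      - k * laplaceIntegral Λ δ (fun β => (β : ℂ) ^ (k - 1)) n
      - Complex.I * laplaceIntegral Λ δ (fun β => (β : ℂ) ^ k) n = -(f n δ - f n (-δ)) := by
    intro n
    have hder : ∀ β ∈ Set.uIcc (-δ) δ, HasDerivAt (f n)
        ((((k : ℂ) * (β : ℂ) ^ (k - 1) + Complex.I * (β : ℂ) ^ k)
          + (-(n : ℂ)) * (Λ' β * (β : ℂ) ^ k)) *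
          (Complex.exp (β * Complex.I) * Complex.exp (-(n * Λ β)))) β := by
      intro β hβ
      rw [Set.uIcc_of_le (by linarith)] at hβ
      have hid : HasDerivAt (fun x : ℝ => (x : ℂ)) 1 β := Complex.ofRealCLM.hasDerivAt
      have h1 := (hid.pow k)
      have h2 := (hid.mul_const Complex.I).cexp
      have h3 := ((hd β hβ).const_mul (n : ℂ)).neg.cexp
      have := h1.mul (h2.mul h3)
      refine this.congr_deriv ?_
      simp only [Pi.mul_apply, Pi.pow_apply, Pi.neg_apply]
      ring
    have h1 : ContinuousOn (fun β : ℝ => (k : ℂ) * (β : ℂ) ^ (k - 1)) (Set.Icc (-δ) δ) :=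
      (hpc _).const_mul _
    have h2 : ContinuousOn (fun β : ℝ => Complex.I * (β : ℂ) ^ k) (Set.Icc (-δ) δ) :=
      (hpc _).const_mul _
    have h3 : ContinuousOn (fun β : ℝ => -(n : ℂ) * (Λ' β * (β : ℂ) ^ k)) (Set.Icc (-δ) δ) :=
      (hΛ'.mul (hpc _)).const_mul _
    have h12 : ContinuousOn (fun β : ℝ => (k : ℂ) * (β : ℂ) ^ (k - 1) + Complex.I * (β : ℂ) ^ k)
      (Set.Icc (-δ) δ) := h1.add h2
    have hc : ContinuousOn (fun β : ℝ => ((k : ℂ) * (β : ℂ) ^ (k - 1) + Complex.I * (β : ℂ) ^ k)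
        + (-(n : ℂ)) * (Λ' β * (β : ℂ) ^ k)) (Set.Icc (-δ) δ) := h12.add h3
    rw [← intervalIntegral.integral_eq_sub_of_hasDerivAt hder
      (intervalIntegrable_laplace hδ hΛc hc n)]
    change _ = -laplaceIntegral Λ δ (fun β : ℝ => ((k : ℂ) * (β : ℂ) ^ (k - 1)
      + Complex.I * (β : ℂ) ^ k) + (-(n : ℂ)) * (Λ' β * (β : ℂ) ^ k)) n
    rw [laplaceIntegral_add hδ hΛc h12 h3, laplaceIntegral_add hδ hΛc h1 h2,
      laplaceIntegral_const_mul, laplaceIntegral_const_mul,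
      laplaceIntegral_const_mul]
    ring
  simp only [key]
  set q := Real.exp (-(κ * δ ^ 2)) with hq
  have hq1 : q < 1 := by
    have := Real.exp_lt_exp.2 (show -(κ * δ ^ 2) < 0 by simp only [neg_neg_iff_pos]; positivity)
    rwa [Real.exp_zero] at this
  refine IsBigO.trans ?_ (geometric_isBigO_invSqrt_pow (Real.exp_pos _).le hq1 j)
  refine IsBigO.of_bound (2 * δ ^ k) (Eventually.of_forall fun n => ?_)
  have hb : ∀ β ∈ Set.Icc (-δ) δ, β ^ 2 = δ ^ 2 → |β| = δ → ‖f n β‖ ≤ δ ^ k * q ^ n := by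
    intro β hβ h2 habs
    simp only [hf]
    rw [norm_mul, norm_pow, Complex.norm_real, Real.norm_eq_abs, habs]
    refine mul_le_mul_of_nonneg_left ((norm_cexp_laplace_le hΛre n hβ).trans (le_of_eq ?_))
      (by positivity)
    rw [h2, hq, ← Real.exp_nat_mul]
    congr 1; ring
  have hm1 : δ ∈ Set.Icc (-δ) δ := ⟨by linarith, le_refl _⟩
  have hm2 : -δ ∈ Set.Icc (-δ) δ := ⟨le_refl _, by linarith⟩
  rw [norm_neg, Real.norm_of_nonneg (by positivity)]
  refine (norm_sub_le _ _).trans ((add_le_add (hb δ hm1 rfl (abs_of_pos hδ))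
    (hb (-δ) hm2 (by ring) (by rw [abs_neg, abs_of_pos hδ]))).trans (le_of_eq (by ring)))

/-- Two Taylor terms suffice throughout: the parity gain of odd moments covers the second one, and
the remainder falls under `laplaceIntegral_isBigO`. -/
theorem laplaceIntegral_expand (hδ : 0 < δ) (hκ : 0 < κ)
    (hΛc : ContinuousOn Λ (Set.Icc (-δ) δ))
    (hΛre : ∀ β ∈ Set.Icc (-δ) δ, κ * β ^ 2 ≤ (Λ β).re) {c₀ c₁ : ℂ} (i k : ℕ)
    (hg : ContinuousOn g (Set.Icc (-δ) δ))
    (hgt : ∀ β ∈ Set.Icc (-δ) δ,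
      ‖g β - (c₀ * (β : ℂ) ^ i + c₁ * (β : ℂ) ^ (i + 1))‖ ≤ C * |β| ^ k) :
    (fun n => laplaceIntegral Λ δ g n - (c₀ * laplaceIntegral Λ δ (fun β => (β : ℂ) ^ i) n
      + c₁ * laplaceIntegral Λ δ (fun β => (β : ℂ) ^ (i + 1)) n))
      =O[atTop] fun n => invSqrt n ^ (k + 1) := by
  have hp : ∀ (c : ℂ) (i : ℕ), ContinuousOn (fun β : ℝ => c * (β : ℂ) ^ i) (Set.Icc (-δ) δ) :=
    fun c i => Continuous.continuousOn (by fun_prop)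
  have h0 : ContinuousOn (fun β : ℝ => c₀ * (β : ℂ) ^ i + c₁ * (β : ℂ) ^ (i + 1))
    (Set.Icc (-δ) δ) := (hp _ _).add (hp _ _)
  have h1 : ContinuousOn (fun β : ℝ => g β - (c₀ * (β : ℂ) ^ i + c₁ * (β : ℂ) ^ (i + 1)))
    (Set.Icc (-δ) δ) := hg.sub h0
  refine (laplaceIntegral_isBigO hδ hκ hΛre k hgt).congr_left fun n => ?_
  have h2 := laplaceIntegral_add hδ hΛc h1 h0 n
  simp only [sub_add_cancel] at h2
  rw [h2, laplaceIntegral_add hδ hΛc (hp _ _) (hp _ _), laplaceIntegral_const_mul,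
    laplaceIntegral_const_mul]
  ring

theorem invSqrt_sq_mul_natCast_mul {n : ℕ} (hn : 1 ≤ n) (z : ℂ) :
    (invSqrt n : ℂ) ^ 2 * (n * z) = z := by
  have := natCast_mul_invSqrt_sq hn
  have h : (n : ℂ) * (invSqrt n : ℂ) ^ 2 = 1 := by exact_mod_cast this
  calc _ = ((n : ℂ) * (invSqrt n : ℂ) ^ 2) * z := by ring
    _ = z := by rw [h, one_mul]

theorem isBigO_invSqrt_mul {f : ℕ → ℂ} {j : ℕ} (i : ℕ)
    (hf : f =O[atTop] fun n => invSqrt n ^ j) :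
    (fun n => (invSqrt n : ℂ) ^ i * f n) =O[atTop] fun n => invSqrt n ^ (i + j) := by
  have h1 : (fun n => (invSqrt n : ℂ) ^ i) =O[atTop] fun n => invSqrt n ^ i :=
    IsBigO.of_bound 1 (Eventually.of_forall fun n => by simp)
  exact (h1.mul hf).congr_right fun n => by rw [pow_add]

/-- Low moments of the weight `e^{iβ - nΛ(β)}` for an exponent `Λ` with
`Λ'(β) = c₀ β + c₁ β² + O(β³)`. -/
theorem laplaceIntegral_moments (hδ : 0 < δ) (hκ : 0 < κ)
    (hΛre : ∀ β ∈ Set.Icc (-δ) δ, κ * β ^ 2 ≤ (Λ β).re)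
    (hd : ∀ β ∈ Set.Icc (-δ) δ, HasDerivAt Λ (Λ' β) β)
    (hΛ' : ContinuousOn Λ' (Set.Icc (-δ) δ)) {c₀ c₁ : ℂ} (hc₀ : c₀ ≠ 0)
    (hΛt : ∀ β ∈ Set.Icc (-δ) δ, ‖Λ' β - (c₀ * β + c₁ * (β : ℂ) ^ 2)‖ ≤ C * |β| ^ 3) :
    (laplaceIntegral Λ δ (fun β => (β : ℂ) ^ 1) =O[atTop] fun n => invSqrt n ^ 3) ∧
    (laplaceIntegral Λ δ (fun β => (β : ℂ) ^ 3) =O[atTop] fun n => invSqrt n ^ 5) ∧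
    ((fun n => laplaceIntegral Λ δ (fun β => (β : ℂ) ^ 2) n
      - c₀⁻¹ * ((invSqrt n : ℂ) ^ 2 * laplaceIntegral Λ δ (fun β => (β : ℂ) ^ 0) n))
      =O[atTop] fun n => invSqrt n ^ 5) := by
  have hΛc : ContinuousOn Λ (Set.Icc (-δ) δ) := fun β hβ =>
    (hd β hβ).continuousAt.continuousWithinAt
  have hpc : ∀ i : ℕ, ContinuousOn (fun β : ℝ => (β : ℂ) ^ i) (Set.Icc (-δ) δ) := fun i =>
    Continuous.continuousOn (by fun_prop)
  set Z : ℕ → ℕ → ℂ := fun k => laplaceIntegral Λ δ (fun β => (β : ℂ) ^ k) with hZ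
  have hZO : ∀ k, Z k =O[atTop] fun n => invSqrt n ^ (k + 1) := fun k =>
    laplaceIntegral_isBigO (C := 1) hδ hκ hΛre k fun β _ => by simp
  have hup : ∀ {f : ℕ → ℂ} {i j : ℕ}, i ≤ j → (f =O[atTop] fun n => invSqrt n ^ j) →
    f =O[atTop] fun n => invSqrt n ^ i := fun hij hf => hf.trans (invSqrt_pow_isBigO hij)
  have hexp : ∀ k, (fun n => laplaceIntegral Λ δ (fun β => Λ' β * (β : ℂ) ^ k) n
      - (c₀ * Z (k + 1) n + c₁ * Z (k + 1 + 1) n)) =O[atTop] fun n => invSqrt n ^ (3 + k + 1) := by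
    intro k
    refine laplaceIntegral_expand (C := C) hδ hκ hΛc hΛre (k + 1) (3 + k) (hΛ'.mul (hpc k))
      fun β hβ => ?_
    have e : Λ' β * (β : ℂ) ^ k - (c₀ * (β : ℂ) ^ (k + 1) + c₁ * (β : ℂ) ^ (k + 1 + 1))
      = (Λ' β - (c₀ * β + c₁ * (β : ℂ) ^ 2)) * (β : ℂ) ^ k := by ring
    rw [e, norm_mul, norm_pow, Complex.norm_real, Real.norm_eq_abs, pow_add, ← mul_assoc]
    exact mul_le_mul_of_nonneg_right (hΛt β hβ) (by positivity)
  -- Integration by parts, with Λ' replaced by its expansion. At k = 0 the index k − 1 is truncated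
  -- to 0, but its coefficient is 0 as well.
  have hrec : ∀ k, (fun n => c₀ * Z (k + 1) n + c₁ * Z (k + 1 + 1) n
      - (invSqrt n : ℂ) ^ 2 * (k * Z (k - 1) n + Complex.I * Z k n))
      =O[atTop] fun n => invSqrt n ^ (k + 4) := by
    intro k
    have h1 := isBigO_invSqrt_mul 2
      (laplaceIntegral_by_parts hδ hκ hΛre hd hΛ' k (k + 2))
    have h2 := (hup (by omega : k + 4 ≤ 2 + (k + 2)) h1).sub
      (hup (by omega : k + 4 ≤ 3 + k + 1) (hexp k))
    refine h2.congr' ?_ EventuallyEq.rfl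
    filter_upwards [eventually_ge_atTop 1] with n hn
    rw [mul_sub, mul_sub, invSqrt_sq_mul_natCast_mul hn]
    simp only [hZ]
    ring
  have hsolve : ∀ {k j : ℕ} {f : ℕ → ℂ}, (f =O[atTop] fun n => invSqrt n ^ j) →
      (∀ n, f n = c₀ * Z k n) → Z k =O[atTop] fun n => invSqrt n ^ j := by
    intro k j f hf he
    refine (hf.const_mul_left c₀⁻¹).congr_left fun n => ?_
    rw [he, ← mul_assoc, inv_mul_cancel₀ hc₀, one_mul]
  -- The trivial bound for the k-th moment is n^{-(k+1)/2}. Odd moments gain a further n^{-1/2}, as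
  -- they vanish for a centred Gaussian; this comes out of the recursion at k = 0, and at k = 2 for
  -- the third moment.
  have h1 : Z 1 =O[atTop] fun n => invSqrt n ^ 3 := by
    have ha := hup (by norm_num : 3 ≤ 0 + 4) (hrec 0)
    have hb := isBigO_invSqrt_mul 2 ((hZO 0).const_mul_left Complex.I)
    have hc := (hZO 2).const_mul_left c₁
    refine hsolve ((ha.add hb).sub hc) fun n => ?_
    simp
  have h3 : Z 3 =O[atTop] fun n => invSqrt n ^ 5 := by
    have ha := hup (by norm_num : 5 ≤ 2 + 4) (hrec 2)
    have hb := isBigO_invSqrt_mul 2 ((h1.const_mul_left 2).add ((hZO 2).const_mul_left Complex.I))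
    have hc := (hZO 4).const_mul_left c₁
    refine hsolve ((ha.add hb).sub hc) fun n => ?_
    simp
  refine ⟨h1, h3, ?_⟩
  -- At k = 1 the recursion reads c₀Z₂ = Z₀/n up to Z₁/n and Z₃, both already known to be
  -- O(n^{-5/2}).
  have ha := hup (by norm_num : 5 ≤ 1 + 4) (hrec 1)
  have hb := isBigO_invSqrt_mul 2 (h1.const_mul_left Complex.I)
  have hc := h3.const_mul_left c₁
  refine (((ha.add hb).sub hc).const_mul_left c₀⁻¹).congr_left fun n => ?_
  simp only [hZ, Nat.cast_one, one_mul, Nat.sub_self, Nat.reduceAdd]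
  field_simp
  ring

end LaplaceMoments

end SingleEquation

namespace SingleEquation

/-! ### Cumulants of Laplace integrals up to O(1). -/

section LaplaceCumulants

theorem isBigO_natCast_pow_mul {f : ℕ → ℂ} {i j : ℕ}
    (hf : f =O[atTop] fun n => invSqrt n ^ (j + 2 * i)) :
    (fun n : ℕ => (n : ℂ) ^ i * f n) =O[atTop] fun n => invSqrt n ^ j := by
  have h1 : (fun n : ℕ => (n : ℂ) ^ i) =O[atTop] fun n : ℕ => (n : ℝ) ^ i :=
    IsBigO.of_bound 1 (Eventually.of_forall fun n => by simp)
  refine (h1.mul hf).congr' EventuallyEq.rfl ?_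
  filter_upwards [eventually_ge_atTop 1] with n hn
  rw [pow_add, pow_mul, mul_left_comm, ← mul_pow, natCast_mul_invSqrt_sq hn, one_pow, mul_one]

/-- First two cumulants of a family of Laplace integrals, up to bounded error. -/
theorem cumulants_isBigO_one {Λ Λ' L₁ L₂ : ℝ → ℂ} {δ κ C : ℝ} (hδ : 0 < δ) (hκ : 0 < κ)
    (hΛre : ∀ β ∈ Set.Icc (-δ) δ, κ * β ^ 2 ≤ (Λ β).re)
    (hd : ∀ β ∈ Set.Icc (-δ) δ, HasDerivAt Λ (Λ' β) β)
    (hΛ' : ContinuousOn Λ' (Set.Icc (-δ) δ)) {c₀ c₁ ℓ m b p p' : ℂ} (hc₀ : c₀ ≠ 0)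
    (hΛt : ∀ β ∈ Set.Icc (-δ) δ, ‖Λ' β - (c₀ * β + c₁ * (β : ℂ) ^ 2)‖ ≤ C * |β| ^ 3)
    (hL₁ : ContinuousOn L₁ (Set.Icc (-δ) δ)) (hL₂ : ContinuousOn L₂ (Set.Icc (-δ) δ))
    (hL₁t : ∀ β ∈ Set.Icc (-δ) δ, ‖L₁ β - (ℓ + m * β + b * (β : ℂ) ^ 2)‖ ≤ C * |β| ^ 3)
    (hL₂t : ∀ β ∈ Set.Icc (-δ) δ, ‖L₂ β - (p + p' * β)‖ ≤ C * |β| ^ 2)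
    (hZ : invSqrt =O[atTop] laplaceIntegral Λ δ (fun _ => 1)) {q₀ q₁ q₂ : ℕ → ℂ}
    (h₀ : (fun n => q₀ n - laplaceIntegral Λ δ (fun _ => 1) n) =O[atTop] fun n => invSqrt n ^ 9)
    (h₁ : (fun n => q₁ n + n * laplaceIntegral Λ δ L₁ n) =O[atTop] fun n => invSqrt n ^ 9)
    (h₂ : (fun n => q₂ n - (n ^ 2 * laplaceIntegral Λ δ (fun β => L₁ β ^ 2) n
      - n * laplaceIntegral Λ δ L₂ n)) =O[atTop] fun n => invSqrt n ^ 9) :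
    ((fun n => q₁ n / q₀ n + n * ℓ) =O[atTop] fun _ => (1 : ℝ)) ∧
    ((fun n => q₂ n / q₀ n - (q₁ n / q₀ n) ^ 2 - n * (m ^ 2 / c₀ - p))
      =O[atTop] fun _ => (1 : ℝ)) := by
  have hΛc : ContinuousOn Λ (Set.Icc (-δ) δ) := fun β hβ =>
    (hd β hβ).continuousAt.continuousWithinAt
  have hC : 0 ≤ C := by
    have h1 := (norm_nonneg _).trans (hL₂t δ ⟨by linarith, le_refl _⟩)
    exact nonneg_of_mul_nonneg_left h1 (by positivity)
  have hup : ∀ {f : ℕ → ℂ} {i j : ℕ}, i ≤ j → (f =O[atTop] fun n => invSqrt n ^ j) →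
    f =O[atTop] fun n => invSqrt n ^ i := fun hij hf => hf.trans (invSqrt_pow_isBigO hij)
  obtain ⟨hM1, hM3, hM2⟩ := laplaceIntegral_moments hδ hκ hΛre hd hΛ' hc₀ hΛt
  simp only [pow_zero] at hM2
  have hM2O : laplaceIntegral Λ δ (fun β => (β : ℂ) ^ 2) =O[atTop] fun n => invSqrt n ^ 3 :=
    laplaceIntegral_isBigO (C := 1) hδ hκ hΛre 2 fun β _ => by simp
  set Z := laplaceIntegral Λ δ (fun _ => 1) with hZdef
  -- Subtracting ℓ at the outset lets the terms of order n² in the variance cancel algebraically,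
  -- before anything is estimated.
  set D : ℝ → ℂ := fun β => L₁ β - ℓ with hD
  have hDc : ContinuousOn D (Set.Icc (-δ) δ) := hL₁.sub continuousOn_const
  have hDt : ∀ β ∈ Set.Icc (-δ) δ, ‖D β - (m * (β : ℂ) ^ 1 + b * (β : ℂ) ^ (1 + 1))‖
      ≤ C * |β| ^ 3 := fun β hβ => by
    refine le_trans (le_of_eq ?_) (hL₁t β hβ)
    congr 1; simp only [hD]; ring
  have hDsq : ContinuousOn (fun β => D β ^ 2) (Set.Icc (-δ) δ) := hDc.pow 2
  set I₁ := laplaceIntegral Λ δ D with hI₁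
  set I₂ := laplaceIntegral Λ δ (fun β => D β ^ 2) with hI₂
  set J := laplaceIntegral Λ δ L₂ with hJ
  have hI₁O : I₁ =O[atTop] fun n => invSqrt n ^ 3 := by
    have h := hup (by norm_num : 3 ≤ 3 + 1) (laplaceIntegral_expand hδ hκ hΛc hΛre 1 3 hDc hDt)
    refine (h.add ((hM1.const_mul_left m).add (hM2O.const_mul_left b))).congr_left fun n => ?_
    simp [hI₁]
  -- Here D² = m²β² + 2mbβ³ + O(β⁴), and the odd term is negligible because the third moment is
  -- O(n^{-5/2}).
  have hI₂O : (fun n => I₂ n - m ^ 2 / c₀ * ((invSqrt n : ℂ) ^ 2 * Z n))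
      =O[atTop] fun n => invSqrt n ^ 5 := by
    set B := C * (2 * ‖m‖ * 1 + 2 * ‖b‖ * δ + C * δ ^ 2) + ‖b‖ ^ 2 with hB
    have hsq : ∀ β ∈ Set.Icc (-δ) δ,
        ‖D β ^ 2 - (m ^ 2 * (β : ℂ) ^ 2 + (2 * m * b) * (β : ℂ) ^ (2 + 1))‖ ≤ B * |β| ^ 4 := by
      intro β hβ
      set r := D β - (m * (β : ℂ) ^ 1 + b * (β : ℂ) ^ (1 + 1)) with hr
      have hrn := hDt β hβ
      rw [← hr] at hrn
      have e : D β ^ 2 - (m ^ 2 * (β : ℂ) ^ 2 + (2 * m * b) * (β : ℂ) ^ (2 + 1))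
        = r * (2 * m * β + 2 * b * (β : ℂ) ^ 2 + r) + b ^ 2 * (β : ℂ) ^ 4 := by
        rw [hr]; ring
      have hβδ : |β| ≤ δ := abs_le.2 hβ
      have h1 : ‖2 * m * β + 2 * b * (β : ℂ) ^ 2 + r‖
          ≤ (2 * ‖m‖ * 1 + 2 * ‖b‖ * δ + C * δ ^ 2) * |β| := by
        refine (norm_add₃_le).trans ?_
        have e1 : ‖2 * m * (β : ℂ)‖ = 2 * ‖m‖ * 1 * |β| := by simp
        have e2 : ‖2 * b * (β : ℂ) ^ 2‖ ≤ 2 * ‖b‖ * δ * |β| := by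
          have : ‖2 * b * (β : ℂ) ^ 2‖ = 2 * ‖b‖ * |β| * |β| := by
            rw [norm_mul, norm_mul, norm_pow, Complex.norm_real, Real.norm_eq_abs, RCLike.norm_ofNat]
            ring
          rw [this]; gcongr
        have e3 : ‖r‖ ≤ C * δ ^ 2 * |β| := hrn.trans (by
          rw [pow_succ, ← mul_assoc]; gcongr)
        linarith
      rw [e]
      refine (norm_add_le _ _).trans ?_
      rw [norm_mul, norm_mul, norm_pow, norm_pow, Complex.norm_real, Real.norm_eq_abs, hB, add_mul]
      refine add_le_add_left ((mul_le_mul hrn h1 (norm_nonneg _) (by positivity)).trans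
        (le_of_eq (by ring))) _
    have h := laplaceIntegral_expand hδ hκ hΛc hΛre 2 4 hDsq hsq
    have h2 := (hM2.const_mul_left (m ^ 2)).add (hM3.const_mul_left (2 * m * b))
    refine (h.add h2).congr_left fun n => ?_
    simp only [hI₂, Nat.reduceAdd]
    field_simp
    ring
  have hJO : (fun n => J n - p * Z n) =O[atTop] fun n => invSqrt n ^ 3 := by
    have h := laplaceIntegral_expand (c₀ := p) (c₁ := p') hδ hκ hΛc hΛre 0 2 hL₂ fun β hβ => by
      simpa using hL₂t β hβ
    refine (h.add (hM1.const_mul_left p')).congr_left fun n => ?_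
    simp only [hJ, hZdef, pow_zero, Nat.zero_add]
    ring
  have hL₁I : ∀ n, laplaceIntegral Λ δ L₁ n = ℓ * Z n + I₁ n := fun n => by
    have h := laplaceIntegral_add (h := D) (g := fun _ => ℓ * 1) hδ hΛc continuousOn_const hDc n
    rw [laplaceIntegral_const_mul] at h
    rw [← h]
    congr 1; ext β; simp [hD]
  have hL₁sq : ∀ n, laplaceIntegral Λ δ (fun β => L₁ β ^ 2) n
      = ℓ ^ 2 * Z n + 2 * ℓ * I₁ n + I₂ n := fun n => by
    have hc1 : ContinuousOn (fun β => 2 * ℓ * D β) (Set.Icc (-δ) δ) := hDc.const_mul _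
    have hc0 : ContinuousOn (fun _ : ℝ => ℓ ^ 2 * (1 : ℂ)) (Set.Icc (-δ) δ) := continuousOn_const
    have hc01 : ContinuousOn (fun β : ℝ => ℓ ^ 2 * (1 : ℂ) + 2 * ℓ * D β) (Set.Icc (-δ) δ) :=
      hc0.add hc1
    have h := laplaceIntegral_add hδ hΛc hc01 hDsq n
    have h' := laplaceIntegral_add hδ hΛc hc0 hc1 n
    rw [laplaceIntegral_const_mul, laplaceIntegral_const_mul] at h'
    rw [← h', ← h]
    congr 1; ext β; simp only [hD]; ring
  set e₀ : ℕ → ℂ := fun n => q₀ n - Z n with he₀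
  set e₁ : ℕ → ℂ := fun n => q₁ n + n * laplaceIntegral Λ δ L₁ n with he₁
  set e₂ : ℕ → ℂ := fun n => q₂ n - (n ^ 2 * laplaceIntegral Λ δ (fun β => L₁ β ^ 2) n
      - n * laplaceIntegral Λ δ L₂ n) with he₂
  -- The denominator is at least of order n^{-1/2}, so a numerator of that order gives a bounded
  -- quotient.
  have hs1 : (fun n => invSqrt n ^ 1) =O[atTop] q₀ := by
    have h1 : e₀ =o[atTop] Z := by
      refine (h₀.trans_isLittleO ?_).trans_isBigO hZ
      have : (fun x : ℝ => x ^ 9) =o[𝓝 0] fun x : ℝ => x ^ 1 := isLittleO_pow_pow (by norm_num)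
      exact (this.comp_tendsto tendsto_invSqrt).congr_right fun n => by simp
    have h2 : q₀ = fun n => Z n + e₀ n := by ext n; simp [he₀]
    rw [h2]
    have h3 : Z =O[atTop] fun n => e₀ n + Z n := h1.right_isBigO_add
    refine (hZ.trans h3).congr (fun n => by simp) fun n => by ring
  have hq0 : ∀ᶠ n in atTop, q₀ n ≠ 0 := by
    filter_upwards [hs1.eq_zero_imp, eventually_ge_atTop 1] with n hn hn1 h0
    exact (pow_pos (invSqrt_pos hn1) 1).ne' (hn h0)
  have hdiv : ∀ {f : ℕ → ℂ}, (f =O[atTop] fun n => invSqrt n ^ 1) →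
      (fun n => f n / q₀ n) =O[atTop] fun _ => (1 : ℝ) := by
    intro f hf
    have h := (hf.trans hs1).mul (isBigO_refl (fun n => (q₀ n)⁻¹) atTop)
    refine (h.trans (IsBigO.of_bound 1 ?_)).congr_left fun n => by rw [div_eq_mul_inv]
    filter_upwards [hq0] with n hn
    rw [mul_inv_cancel₀ hn]; simp
  have hn1 : ∀ {f : ℕ → ℂ}, (f =O[atTop] fun n => invSqrt n ^ 3) →
      (fun n : ℕ => (n : ℂ) ^ 1 * f n) =O[atTop] fun n => invSqrt n ^ 1 := fun hf =>
    isBigO_natCast_pow_mul (i := 1) (j := 1) hf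
  have hn2 : ∀ {f : ℕ → ℂ}, (f =O[atTop] fun n => invSqrt n ^ 5) →
      (fun n : ℕ => (n : ℂ) ^ 2 * f n) =O[atTop] fun n => invSqrt n ^ 1 := fun hf =>
    isBigO_natCast_pow_mul (i := 2) (j := 1) hf
  have hnum₁ : (fun n : ℕ => -((n : ℂ) ^ 1 * I₁ n) + e₁ n + ℓ * ((n : ℂ) ^ 1 * e₀ n))
      =O[atTop] fun n => invSqrt n ^ 1 :=
    ((hn1 hI₁O).neg_left.add (hup (by norm_num) h₁)).add
      ((hn1 (hup (by norm_num) h₀)).const_mul_left ℓ)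
  have hA : (fun n => q₁ n / q₀ n + n * ℓ) =O[atTop] fun _ => (1 : ℝ) := by
    refine (hdiv hnum₁).congr' ?_ EventuallyEq.rfl
    filter_upwards [hq0] with n hn
    have : q₁ n = e₁ n - n * (ℓ * Z n + I₁ n) := by simp only [he₁]; rw [hL₁I]; ring
    have hz : Z n = q₀ n - e₀ n := by simp [he₀]
    rw [this, hz]
    field_simp
    ring
  refine ⟨hA, ?_⟩
  -- The numerator of the second moment about −nℓ, minus its leading term. Each factor n costs two
  -- powers of n^{-1/2}, so the worst error n²e₀ needs order 5; the assumed order 9 is ample.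
  have hnum₂ : (fun n : ℕ => (n : ℂ) ^ 2 * (I₂ n - m ^ 2 / c₀ * ((invSqrt n : ℂ) ^ 2 * Z n))
      - (n : ℂ) ^ 1 * (J n - p * Z n) + e₂ n + 2 * ℓ * ((n : ℂ) ^ 1 * e₁ n)
      + ℓ ^ 2 * ((n : ℂ) ^ 2 * e₀ n) - (m ^ 2 / c₀ - p) * ((n : ℂ) ^ 1 * e₀ n))
      =O[atTop] fun n => invSqrt n ^ 1 :=
    (((((hn2 hI₂O).sub (hn1 hJO)).add (hup (by norm_num) h₂)).add
      ((hn1 (hup (by norm_num) h₁)).const_mul_left _)).add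
      ((hn2 (hup (by norm_num) h₀)).const_mul_left _)).sub
      ((hn1 (hup (by norm_num) h₀)).const_mul_left _)
  -- Moving the centre from −nℓ to the actual mean q₁/q₀ changes the second moment by the square of
  -- a bounded quantity.
  have hA2 : (fun n => (q₁ n / q₀ n + n * ℓ) ^ 2) =O[atTop] fun _ => (1 : ℝ) := by
    simpa using hA.pow 2
  refine ((hdiv hnum₂).sub hA2).congr' ?_ EventuallyEq.rfl
  filter_upwards [hq0, eventually_ge_atTop 1] with n hn hn1
  have hq₁ : q₁ n = e₁ n - n * (ℓ * Z n + I₁ n) := by simp only [he₁]; rw [hL₁I]; ring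
  have hq₂ : q₂ n = e₂ n + (n ^ 2 * (ℓ ^ 2 * Z n + 2 * ℓ * I₁ n + I₂ n) - n * J n) := by
    simp only [he₂]; rw [hL₁sq]; ring
  have hz : e₀ n = q₀ n - Z n := rfl
  have hs : (n : ℂ) ^ 2 * (I₂ n - m ^ 2 / c₀ * ((invSqrt n : ℂ) ^ 2 * Z n))
      = n ^ 2 * I₂ n - m ^ 2 / c₀ * (n * Z n) := by
    have := invSqrt_sq_mul_natCast_mul hn1 (n * Z n)
    rw [← this]; ring
  rw [hs, hq₁, hq₂, hz]
  field_simp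
  ring

end LaplaceCumulants

end SingleEquation

namespace SingleEquation

/-! ### Partial derivatives in two complex variables. -/

section Bivariate

/-- Partial derivative in the first variable. -/
noncomputable def dx (G : ℂ × ℂ → ℂ) (p : ℂ × ℂ) : ℂ := deriv (fun z => G (z, p.2)) p.1

/-- Partial derivative in the second variable. -/
noncomputable def dy (G : ℂ × ℂ → ℂ) (p : ℂ × ℂ) : ℂ := deriv (fun z => G (p.1, z)) p.2

variable {G : ℂ × ℂ → ℂ} {p : ℂ × ℂ}

theorem hasDerivAt_fst_comp (h : DifferentiableAt ℂ G p) :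
    HasDerivAt (fun z => G (z, p.2)) (fderiv ℂ G p (1, 0)) p.1 :=
  HasFDerivAt.comp_hasDerivAt (l := G) (f := fun z => (z, p.2)) p.1 h.hasFDerivAt
    ((hasDerivAt_id _).prodMk (hasDerivAt_const _ _))

theorem hasDerivAt_snd_comp (h : DifferentiableAt ℂ G p) :
    HasDerivAt (fun z => G (p.1, z)) (fderiv ℂ G p (0, 1)) p.2 :=
  HasFDerivAt.comp_hasDerivAt (l := G) (f := fun z => (p.1, z)) p.2 h.hasFDerivAt
    ((hasDerivAt_const _ _).prodMk (hasDerivAt_id _))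

theorem dx_eq_fderiv (h : DifferentiableAt ℂ G p) : dx G p = fderiv ℂ G p (1, 0) :=
  (hasDerivAt_fst_comp h).deriv

theorem dy_eq_fderiv (h : DifferentiableAt ℂ G p) : dy G p = fderiv ℂ G p (0, 1) :=
  (hasDerivAt_snd_comp h).deriv

theorem hasDerivAt_dx (h : DifferentiableAt ℂ G p) :
    HasDerivAt (fun z => G (z, p.2)) (dx G p) p.1 := dx_eq_fderiv h ▸ hasDerivAt_fst_comp h

theorem hasDerivAt_dy (h : DifferentiableAt ℂ G p) :
    HasDerivAt (fun z => G (p.1, z)) (dy G p) p.2 := dy_eq_fderiv h ▸ hasDerivAt_snd_comp h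

theorem analyticAt_dx (h : AnalyticAt ℂ G p) : AnalyticAt ℂ (dx G) p := by
  have h1 : AnalyticAt ℂ (fun q => fderiv ℂ G q (1, 0)) p :=
    ((ContinuousLinearMap.apply ℂ ℂ ((1, 0) : ℂ × ℂ)).analyticAt _).comp h.fderiv
  refine h1.congr ?_
  filter_upwards [h.eventually_analyticAt] with q hq
  exact (dx_eq_fderiv hq.differentiableAt).symm

theorem analyticAt_dy (h : AnalyticAt ℂ G p) : AnalyticAt ℂ (dy G) p := by
  have h1 : AnalyticAt ℂ (fun q => fderiv ℂ G q (0, 1)) p :=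
    ((ContinuousLinearMap.apply ℂ ℂ ((0, 1) : ℂ × ℂ)).analyticAt _).comp h.fderiv
  refine h1.congr ?_
  filter_upwards [h.eventually_analyticAt] with q hq
  exact (dy_eq_fderiv hq.differentiableAt).symm

/-- Chain rule along a curve in `ℂ²`. -/
theorem hasDerivAt_comp_curve {a b : ℂ → ℂ} {a' b' z : ℂ} (h : DifferentiableAt ℂ G (a z, b z))
    (ha : HasDerivAt a a' z) (hb : HasDerivAt b b' z) :
    HasDerivAt (fun s => G (a s, b s)) (dx G (a z, b z) * a' + dy G (a z, b z) * b') z := by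
  have h1 := h.hasFDerivAt.comp_hasDerivAt z (ha.prodMk hb)
  refine h1.congr_deriv ?_
  have : ((a', b') : ℂ × ℂ) = a' • ((1, 0) : ℂ × ℂ) + b' • ((0, 1) : ℂ × ℂ) := by simp
  rw [this, map_add, map_smul, map_smul, dx_eq_fderiv h, dy_eq_fderiv h]
  simp [mul_comm]

variable {R S : ℝ}

theorem isOpen_bidisc : IsOpen (bidisc R S) := Metric.isOpen_ball.prod Metric.isOpen_ball

theorem mem_bidisc {x w : ℂ} : (x, w) ∈ bidisc R S ↔ ‖x‖ < R ∧ ‖w‖ < S := by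
  simp [bidisc]

end Bivariate

/-! ### The coefficients as double contour integrals. -/

section DoubleIntegral

variable {G : ℂ × ℂ → ℂ} {R S y₀ : ℝ}

/-- The integrand `G_x / (w - G)`. -/
noncomputable def kern (G : ℂ × ℂ → ℂ) (x w : ℂ) : ℂ := dx G (x, w) / (w - G (x, w))

/-- `[x^{n-1}] G_x / (w - G)` as a contour integral. -/
noncomputable def innerCoeff (G : ℂ × ℂ → ℂ) (n : ℕ) (r : ℝ) (w : ℂ) : ℂ :=
  (2 * Real.pi * Complex.I)⁻¹ * ∮ x in C(0, r), (x ^ n)⁻¹ * kern G x w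

/-- Residue of `G_x / (w - G)` at a fixed point of `w ↦ G(x, w)`. -/
theorem circleIntegral_kern_eq (hG : AnalyticOnNhd ℂ G (bidisc R S)) (hy₀ : 0 < y₀) (hS : y₀ < S)
    {x v v' : ℂ} (hx : ‖x‖ < R) (hv : ‖v‖ < y₀) (hfix : v = G (x, v))
    (hdy : ∀ w, ‖w‖ ≤ y₀ → ‖dy G (x, w)‖ ≤ 1 / 2)
    (hv' : v' = dx G (x, v) + dy G (x, v) * v') :
    (2 * Real.pi * Complex.I)⁻¹ * ∮ w in C(0, y₀), kern G x w = v' := by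
  set f : ℂ → ℂ := fun w => w - G (x, w) with hf
  have hmem : ∀ w, ‖w‖ < S → (x, w) ∈ bidisc R S := fun w hw => mem_bidisc.2 ⟨hx, hw⟩
  have hfd : ∀ w, ‖w‖ < S → HasDerivAt f (1 - dy G (x, w)) w := fun w hw =>
    (hasDerivAt_id w).sub (hasDerivAt_dy (p := (x, w)) (hG _ (hmem w hw)).differentiableAt)
  have hfdiff : DifferentiableOn ℂ f (Metric.ball 0 S) := fun w hw =>
    (hfd w (by simpa using hw)).differentiableAt.differentiableWithinAt
  have hvS : ‖v‖ < S := hv.trans hS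
  have hball : Metric.ball (0 : ℂ) S ∈ 𝓝 v := Metric.isOpen_ball.mem_nhds (by simpa using hvS)
  -- Factoring w − G(x, w) = (w − v)k(w) with k holomorphic; once k is shown to be zero-free, the
  -- kernel has v as its only, simple, pole in the disc.
  set k : ℂ → ℂ := dslope f v with hk
  have hkd : DifferentiableOn ℂ k (Metric.ball 0 S) :=
    (Complex.differentiableOn_dslope hball).2 hfdiff
  have hfv : f v = 0 := by simp only [hf]; rw [← hfix, sub_self]
  have hfk : ∀ w, f w = (w - v) * k w := fun w => by
    have := sub_smul_dslope f v w
    rw [hfv, sub_zero, smul_eq_mul] at this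
    exact this.symm
  have hfne : ∀ w, ‖w‖ ≤ y₀ → w ≠ v → f w ≠ 0 := by
    intro w hw hne h0
    -- G(x, ·) is a contraction on the disc, so v is its only fixed point there.
    have hlip : ‖G (x, w) - G (x, v)‖ ≤ 1 / 2 * ‖w - v‖ := by
      refine (convex_closedBall (0 : ℂ) y₀).norm_image_sub_le_of_norm_hasDerivWithin_le
        (f := fun w => G (x, w)) (f' := fun w => dy G (x, w)) (fun u hu => ?_) (fun u hu => ?_)
        (by simpa using hv.le) (by simpa using hw)
      · have hu' : ‖u‖ < S := lt_of_le_of_lt (by simpa using hu) hS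
        exact (hasDerivAt_dy (p := (x, u)) (hG _ (hmem u hu')).differentiableAt).hasDerivWithinAt
      · exact hdy u (by simpa using hu)
    have h1 : w = G (x, w) := sub_eq_zero.1 h0
    rw [← h1, ← hfix] at hlip
    have : 0 < ‖w - v‖ := norm_pos_iff.2 (sub_ne_zero.2 hne)
    linarith
  have hkv : k v = 1 - dy G (x, v) := by
    rw [hk, dslope_same]; exact (hfd v hvS).deriv
  have hkv0 : k v ≠ 0 := by
    rw [hkv]
    intro h0
    have h1 := hdy v hv.le
    rw [← sub_eq_zero.1 h0] at h1
    norm_num at h1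
  have hkne : ∀ w, ‖w‖ ≤ y₀ → k w ≠ 0 := by
    intro w hw
    rcases eq_or_ne w v with rfl | hne
    · exact hkv0
    · intro h0
      exact hfne w hw hne (by rw [hfk, h0, mul_zero])
  set g : ℂ → ℂ := fun w => dx G (x, w) / k w with hg
  have hgd : DifferentiableOn ℂ g (Metric.closedBall 0 y₀) := by
    intro w hw
    have hw' : ‖w‖ ≤ y₀ := by simpa using hw
    have hwS : ‖w‖ < S := hw'.trans_lt hS
    have h1 : DifferentiableAt ℂ (fun w => dx G (x, w)) w :=
      (hasDerivAt_dy (p := (x, w)) (analyticAt_dx (hG _ (hmem w hwS))).differentiableAt).differentiableAt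
    have h2 : DifferentiableAt ℂ k w := hkd.differentiableAt
      (Metric.isOpen_ball.mem_nhds (by simpa using hwS))
    exact (h1.div h2 (hkne w hw')).differentiableWithinAt
  have hcauchy := hgd.circleIntegral_sub_inv_smul (w := v) (by simpa using hv)
  have hcongr : ∮ w in C(0, y₀), kern G x w = ∮ w in C(0, y₀), (w - v)⁻¹ • g w := by
    refine circleIntegral.integral_congr hy₀.le fun w _ => ?_
    simp only [kern, hg, smul_eq_mul]
    change dx G (x, w) / f w = _
    rw [hfk, div_eq_mul_inv, mul_inv, div_eq_mul_inv]
    ring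
  rw [hcongr, hcauchy, smul_eq_mul, ← mul_assoc,
    inv_mul_cancel₀ Complex.two_pi_I_ne_zero, one_mul]
  simp only [hg]
  -- The residue is G_x/(1 − G_y) at (x, v), which is the implicit derivative v'.
  rw [div_eq_iff hkv0, hkv]
  linear_combination -hv'

theorem dy_zero_left (hG0 : ∀ w, ‖w‖ < S → G (0, w) = 0) {w : ℂ} (hw : ‖w‖ < S) :
    dy G (0, w) = 0 := by
  have h : (fun z => G (0, z)) =ᶠ[𝓝 w] fun _ => 0 := by
    filter_upwards [Metric.isOpen_ball.mem_nhds (show w ∈ Metric.ball (0 : ℂ) S by simpa using hw)]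
      with z hz
    exact hG0 z (by simpa using hz)
  simp only [dy]
  rw [h.deriv_eq]; simp

/-- Both G and G_y vanish identically on x = 0; compactness of the w-disc makes the smallness for
nearby x uniform. -/
theorem eventually_small_zero_left (hG : AnalyticOnNhd ℂ G (bidisc R S)) (hR : 0 < R) (hS : y₀ < S)
    (hG0 : ∀ w, ‖w‖ < S → G (0, w) = 0) {ε : ℝ} (hε : 0 < ε) :
    ∀ᶠ x in 𝓝 (0 : ℂ), ∀ w, ‖w‖ ≤ y₀ → ‖G (x, w)‖ < ε ∧ ‖dy G (x, w)‖ < ε := by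
  have h := (isCompact_closedBall (0 : ℂ) y₀).eventually_forall_of_forall_eventually
    (x₀ := (0 : ℂ)) (P := fun x w => ‖G (x, w)‖ < ε ∧ ‖dy G (x, w)‖ < ε) fun w hw => by
      have hw' : ‖w‖ < S := lt_of_le_of_lt (by simpa using hw) hS
      have hm : ((0 : ℂ), w) ∈ bidisc R S := mem_bidisc.2 ⟨by simpa using hR, hw'⟩
      have h1 := (hG _ hm).continuousAt.norm
      have h2 := (analyticAt_dy (hG _ hm)).continuousAt.norm
      refine (h1.eventually_lt continuousAt_const ?_).and (h2.eventually_lt continuousAt_const ?_)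
      · rw [hG0 w hw', norm_zero]; exact hε
      · rw [dy_zero_left hG0 hw', norm_zero]; exact hε
  filter_upwards [h] with x hx w hw
  exact hx w (by simpa using hw)

/-- Using y' instead of y costs only the factor n, and y' is precisely the residue found in
`circleIntegral_kern_eq`. -/
theorem coeffAt_succ_eq_circleIntegral_deriv {y : ℂ → ℂ} {r : ℝ} (hr : 0 < r)
    (hy : AnalyticOnNhd ℂ y (Metric.closedBall 0 r)) (k : ℕ) :
    ((k + 1 : ℕ) : ℂ) * coeffAt (k + 1) y
      = (2 * Real.pi * Complex.I)⁻¹ * ∮ x in C(0, r), (x ^ (k + 1))⁻¹ * deriv y x := by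
  have hd : DifferentiableOn ℂ (deriv y) (Metric.closedBall 0 r) := fun x hx =>
    (hy x hx).deriv.differentiableAt.differentiableWithinAt
  have h := hd.circleIntegral_one_div_sub_center_pow_smul hr k
  simp only [sub_zero, one_div, smul_eq_mul] at h
  rw [h, coeffAt, iteratedDeriv_succ', Nat.factorial_succ]
  have h1 : ((k + 1 : ℕ) : ℂ) ≠ 0 := Nat.cast_ne_zero.2 (Nat.succ_ne_zero k)
  have h2 : (k.factorial : ℂ) ≠ 0 := Nat.cast_ne_zero.2 (Nat.factorial_ne_zero k)
  have h3 := Complex.two_pi_I_ne_zero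
  push_cast at h1 ⊢
  field_simp

theorem circleIntegral_swap {f : ℂ → ℂ → ℂ} {r s : ℝ} (hr : 0 ≤ r) (hs : 0 ≤ s)
    (hf : ContinuousOn (Function.uncurry f) (Metric.sphere 0 r ×ˢ Metric.sphere 0 s)) :
    ∮ x in C(0, r), ∮ w in C(0, s), f x w = ∮ w in C(0, s), ∮ x in C(0, r), f x w := by
  simp only [circleIntegral, smul_eq_mul, ← intervalIntegral.integral_const_mul]
  have hc : Continuous fun q : ℝ × ℝ => f (circleMap 0 r q.1) (circleMap 0 s q.2) :=
    hf.comp_continuous (f := fun q : ℝ × ℝ => (circleMap 0 r q.1, circleMap 0 s q.2))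
      (by fun_prop) fun q => ⟨circleMap_mem_sphere _ hr _, circleMap_mem_sphere _ hs _⟩
  rw [intervalIntegral_intervalIntegral_swap]
  · congr 1; ext a; congr 1; ext b; ring
  · have : Continuous (Function.uncurry fun a b : ℝ => deriv (circleMap 0 r) a
        * (deriv (circleMap 0 s) b * f (circleMap 0 r a) (circleMap 0 s b))) := by
      simp only [deriv_circleMap, Function.uncurry_def]
      have h1 : Continuous fun q : ℝ × ℝ => circleMap 0 r q.1 * Complex.I := by fun_prop
      have h2 : Continuous fun q : ℝ × ℝ => circleMap 0 s q.2 * Complex.I := by fun_prop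
      exact h1.mul (h2.mul hc)
    refine (this.continuousOn.integrableOn_compact (K := Set.uIcc 0 (2 * Real.pi) ×ˢ
      Set.uIcc 0 (2 * Real.pi)) (isCompact_uIcc.prod isCompact_uIcc)).mono_set ?_
    exact Set.prod_mono Set.uIoc_subset_uIcc Set.uIoc_subset_uIcc

theorem continuousOn_kern {A : Set (ℂ × ℂ)} (hG : AnalyticOnNhd ℂ G (bidisc R S))
    (hA : A ⊆ bidisc R S) (hne : ∀ p ∈ A, p.2 - G p ≠ 0) :
    ContinuousOn (fun p : ℂ × ℂ => kern G p.1 p.2) A := fun p hp =>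
  ((analyticAt_dx (hG p (hA hp))).continuousAt.div
    (continuousAt_snd.sub (hG p (hA hp)).continuousAt) (hne p hp)).continuousWithinAt

/-- The coefficients of the solution of `y = G(x, y)` as double contour integrals. -/
theorem natCast_mul_coeffAt_eq (hG : AnalyticOnNhd ℂ G (bidisc R S)) (hR : 0 < R) (hy₀ : 0 < y₀)
    (hS : y₀ < S) (hG0 : ∀ w, ‖w‖ < S → G (0, w) = 0) {y : ℂ → ℂ} (hy : AnalyticAt ℂ y 0)
    (hy0 : y 0 = 0) (hfix : ∀ᶠ x in 𝓝 (0 : ℂ), y x = G (x, y x)) :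
    ∃ r₀ > 0, ∀ r : ℝ, 0 < r → r < r₀ → ∀ n : ℕ, 1 ≤ n →
      (n : ℂ) * coeffAt n y
        = (2 * Real.pi * Complex.I)⁻¹ * ∮ w in C(0, y₀), innerCoeff G n r w := by
  have hylt : ∀ᶠ x in 𝓝 (0 : ℂ), ‖y x‖ < y₀ := by
    have := hy.continuousAt.norm
    refine this.eventually_lt continuousAt_const ?_
    rw [hy0, norm_zero]; exact hy₀
  have hxR : ∀ᶠ x in 𝓝 (0 : ℂ), ‖x‖ < R := by
    filter_upwards [Metric.ball_mem_nhds (0 : ℂ) hR] with x hx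
    simpa using hx
  -- Of the two smallness bounds, 1/2 on G_y provides the contraction, and y₀ on |G| excludes zeros
  -- of w − G on |w| = y₀, which the interchange of integrals requires.
  have hall := (((hfix.eventually_nhds.and hylt).and hxR).and
    (hy.eventually_analyticAt)).and
    (eventually_small_zero_left hG hR hS hG0 (lt_min (by norm_num : (0 : ℝ) < 1 / 2) hy₀))
  obtain ⟨r₀, hr₀, hball⟩ := Metric.eventually_nhds_iff_ball.1 hall
  refine ⟨r₀, hr₀, fun r hr hrr n hn => ?_⟩
  have hcb : ∀ x, ‖x‖ ≤ r → x ∈ Metric.ball (0 : ℂ) r₀ := fun x hx => by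
    simpa using hx.trans_lt hrr
  obtain ⟨k, rfl⟩ : ∃ k, n = k + 1 := ⟨n - 1, by omega⟩
  rw [coeffAt_succ_eq_circleIntegral_deriv hr fun x hx => (hball x (hcb x (by simpa using hx))).1.2]
  simp only [innerCoeff, circleIntegral.integral_const_mul]
  rw [← circleIntegral_swap hr.le hy₀.le]
  · rw [← circleIntegral.integral_const_mul (2 * Real.pi * Complex.I)⁻¹
      (fun x => ∮ w in C(0, y₀), (x ^ (k + 1))⁻¹ * kern G x w)]
    congr 1
    refine circleIntegral.integral_congr hr.le fun x hx => ?_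
    have hxr : ‖x‖ = r := by simpa using hx
    obtain ⟨⟨⟨⟨hf, hlt⟩, hR'⟩, han⟩, hsm⟩ := hball x (hcb x hxr.le)
    have hres := circleIntegral_kern_eq hG hy₀ hS hR' hlt hf.self_of_nhds
      (fun w hw => (hsm w hw).2.le.trans (min_le_left _ _)) (v' := deriv y x) (by
        have h1 := hasDerivAt_comp_curve (G := G) (a := fun z => z) (b := y) (z := x)
          (hG _ (mem_bidisc.2 ⟨hR', hlt.trans hS⟩)).differentiableAt (hasDerivAt_id x)
          han.differentiableAt.hasDerivAt
        rw [mul_one] at h1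
        exact (h1.congr_of_eventuallyEq hf).deriv)
    simp only [circleIntegral.integral_const_mul]
    rw [← hres]
    ring
  · have hk := continuousOn_kern (A := Metric.sphere 0 r ×ˢ Metric.sphere 0 y₀) hG (by
        rintro ⟨x, w⟩ ⟨hx, hw⟩
        have hx' : ‖x‖ = r := by simpa using hx
        have hw' : ‖w‖ = y₀ := by simpa using hw
        exact mem_bidisc.2 ⟨(hball x (hcb x hx'.le)).1.1.2, hw' ▸ hS⟩) (by
        rintro ⟨x, w⟩ ⟨hx, hw⟩ h0
        have hx' : ‖x‖ = r := by simpa using hx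
        have hw' : ‖w‖ = y₀ := by simpa using hw
        have h1 := ((hball x (hcb x hx'.le)).2 w hw'.le).1
        rw [← sub_eq_zero.1 h0] at h1
        exact absurd (h1.trans_le (min_le_right _ _)) (by simp [hw']))
    refine ContinuousOn.mul (ContinuousOn.inv₀ ?_ ?_) hk
    · exact Continuous.continuousOn (by fun_prop)
    · rintro ⟨x, w⟩ ⟨hx, -⟩
      have hx' : ‖x‖ = r := by simpa using hx
      exact pow_ne_zero _ (norm_pos_iff.1 (hx' ▸ hr))

end DoubleIntegral

end SingleEquation

namespace SingleEquation

/-! ### Moving the x-contour outwards. -/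

section ContourShift

variable {G : ℂ × ℂ → ℂ} {R S : ℝ}

theorem circleIntegral_eq_of_differentiableAt {f : ℂ → ℂ} {r ρ : ℝ} (hr : 0 < r) (hrρ : r ≤ ρ)
    (hf : ∀ x : ℂ, x ≠ 0 → ‖x‖ ≤ ρ → DifferentiableAt ℂ f x) :
    ∮ x in C(0, ρ), f x = ∮ x in C(0, r), f x := by
  refine Complex.circleIntegral_eq_of_differentiable_on_annulus_off_countable hr hrρ
    Set.countable_empty (fun x hx => ?_) (fun x hx => ?_)
  · have h1 : ‖x‖ ≤ ρ := by simpa using hx.1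
    have h2 : r ≤ ‖x‖ := by simpa using hx.2
    exact (hf x (norm_pos_iff.1 (hr.trans_le h2)) h1).continuousAt.continuousWithinAt
  · have h1 : ‖x‖ < ρ := by simpa using hx.1.1
    have h2 : r < ‖x‖ := by simpa using hx.1.2
    exact hf x (norm_pos_iff.1 (hr.trans h2)) h1.le

theorem differentiableAt_kern (hG : AnalyticOnNhd ℂ G (bidisc R S)) {x w : ℂ} (hx : ‖x‖ < R)
    (hw : ‖w‖ < S) (hne : w - G (x, w) ≠ 0) : DifferentiableAt ℂ (fun z => kern G z w) x := by
  have hm : (x, w) ∈ bidisc R S := mem_bidisc.2 ⟨hx, hw⟩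
  have h1 := (hasDerivAt_dx (p := (x, w)) (analyticAt_dx (hG _ hm)).differentiableAt)
  have h2 := (hasDerivAt_dx (p := (x, w)) (hG _ hm).differentiableAt)
  exact h1.differentiableAt.div ((differentiableAt_const w).sub h2.differentiableAt) hne

theorem innerCoeff_eq_of_ne (hG : AnalyticOnNhd ℂ G (bidisc R S)) {w : ℂ} (hw : ‖w‖ < S)
    {r ρ : ℝ} (hr : 0 < r) (hrρ : r ≤ ρ) (hρ : ρ < R) (hne : ∀ x, ‖x‖ ≤ ρ → w - G (x, w) ≠ 0)
    (n : ℕ) : innerCoeff G n r w = innerCoeff G n ρ w := by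
  rw [innerCoeff, innerCoeff, circleIntegral_eq_of_differentiableAt hr hrρ]
  intro x hx0 hx
  exact ((differentiableAt_id.pow n).inv (pow_ne_zero n hx0)).mul
    (differentiableAt_kern hG (hx.trans_lt hρ) hw (hne x hx))

theorem norm_innerCoeff_le {w : ℂ} {r B : ℝ} (hr : 0 < r)
    (hB : ∀ x, ‖x‖ = r → ‖kern G x w‖ ≤ B) (n : ℕ) :
    ‖innerCoeff G n r w‖ ≤ r * B * (r⁻¹) ^ n := by
  have h := circleIntegral.norm_two_pi_i_inv_smul_integral_le_of_norm_le_const (c := 0)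
    (f := fun x => (x ^ n)⁻¹ * kern G x w) (C := (r⁻¹) ^ n * B) hr.le fun x hx => by
      have hx' : ‖x‖ = r := by simpa using hx
      rw [norm_mul, norm_inv, norm_pow, hx', inv_pow]
      exact mul_le_mul_of_nonneg_left (hB x hx') (by positivity)
  rw [innerCoeff]
  rw [smul_eq_mul] at h
  refine h.trans (le_of_eq ?_)
  ring

/-- The residue at X, by induction from x⁻ⁿ⁻¹(x − X)⁻¹ = X⁻¹(x⁻ⁿ(x − X)⁻¹ − x⁻ⁿ⁻¹), where the last
term has the same integral over both circles. -/
theorem circleIntegral_pow_inv_mul_sub_inv {X : ℂ} {r ρ : ℝ} (hr : 0 < r) (hrX : r < ‖X‖)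
    (hXρ : ‖X‖ < ρ) (n : ℕ) :
    (∮ x in C(0, ρ), (x ^ n)⁻¹ * (x - X)⁻¹) - (∮ x in C(0, r), (x ^ n)⁻¹ * (x - X)⁻¹)
      = 2 * Real.pi * Complex.I * (X ^ n)⁻¹ := by
  have hX : X ≠ 0 := norm_pos_iff.1 (hr.trans hrX)
  induction n with
  | zero =>
    simp only [pow_zero, inv_one, one_mul, mul_one]
    rw [circleIntegral.integral_sub_inv_of_mem_ball (by simpa using hXρ),
      Complex.circleIntegral_eq_zero_of_differentiable_on_off_countable hr.le Set.countable_empty,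
      sub_zero]
    · intro x hx
      have hx' : ‖x‖ ≤ r := by simpa using hx
      refine ((continuousAt_id.sub continuousAt_const).inv₀ ?_).continuousWithinAt
      exact sub_ne_zero.2 fun h => absurd (hx'.trans_lt hrX) (by simp [← h])
    · intro x hx
      have hx' : ‖x‖ < r := by simpa using hx.1
      refine (differentiableAt_id.sub (differentiableAt_const X)).inv ?_
      exact sub_ne_zero.2 fun h => absurd (hx'.trans hrX) (by simp [← h])
  | succ n ih =>
    have hstep : ∀ s : ℝ, 0 < s → s ≠ ‖X‖ → ∮ x in C(0, s), (x ^ (n + 1))⁻¹ * (x - X)⁻¹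
        = X⁻¹ * ((∮ x in C(0, s), (x ^ n)⁻¹ * (x - X)⁻¹) - ∮ x in C(0, s), (x ^ (n + 1))⁻¹) := by
      intro s hs hsX
      have hx0 : ∀ x ∈ Metric.sphere (0 : ℂ) s, x ≠ 0 ∧ x - X ≠ 0 := fun x hx => by
        have hx' : ‖x‖ = s := by simpa using hx
        exact ⟨norm_pos_iff.1 (hx' ▸ hs), sub_ne_zero.2 fun h => hsX (by rw [← hx', h])⟩
      have hc1 : ∀ k : ℕ, ContinuousOn (fun x : ℂ => (x ^ k)⁻¹) (Metric.sphere 0 s) := fun k x hx =>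
        ((continuousAt_id.pow k).inv₀ (pow_ne_zero k (hx0 x hx).1)).continuousWithinAt
      have hc2 : ContinuousOn (fun x : ℂ => (x - X)⁻¹) (Metric.sphere 0 s) := fun x hx =>
        ((continuousAt_id.sub continuousAt_const).inv₀ (hx0 x hx).2).continuousWithinAt
      have hc3 : ContinuousOn (fun x : ℂ => (x ^ n)⁻¹ * (x - X)⁻¹) (Metric.sphere 0 s) :=
        (hc1 n).mul hc2
      rw [← circleIntegral.integral_sub (hc3.circleIntegrable hs.le)
        ((hc1 _).circleIntegrable hs.le), ← circleIntegral.integral_const_mul]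
      refine circleIntegral.integral_congr hs.le fun x hx => ?_
      obtain ⟨h1, h2⟩ := hx0 x hx
      field_simp
      ring
    rw [hstep ρ (hr.trans (hrX.trans hXρ)) hXρ.ne', hstep r hr hrX.ne, ← mul_sub]
    have hpow : ∮ x in C(0, ρ), (x ^ (n + 1))⁻¹ = ∮ x in C(0, r), (x ^ (n + 1))⁻¹ :=
      circleIntegral_eq_of_differentiableAt hr (hrX.trans hXρ).le fun x hx _ =>
        (differentiableAt_id.pow _).inv (pow_ne_zero _ hx)
    rw [hpow, sub_sub_sub_cancel_right, ih, pow_succ, mul_inv]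
    ring

/-- Moving the contour across a single simple pole. -/
theorem innerCoeff_eq_of_root (hG : AnalyticOnNhd ℂ G (bidisc R S)) {w X : ℂ} (hw : ‖w‖ < S)
    {r ρ : ℝ} (hr : 0 < r) (hrX : r < ‖X‖) (hXρ : ‖X‖ < ρ) (hρ : ρ < R) (hroot : G (X, w) = w)
    (hdx : dx G (X, w) ≠ 0) (huniq : ∀ x, ‖x‖ ≤ ρ → G (x, w) = w → x = X) (n : ℕ) :
    innerCoeff G n r w = (X ^ n)⁻¹ + innerCoeff G n ρ w := by
  set f : ℂ → ℂ := fun x => w - G (x, w) with hf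
  have hfd : ∀ x, ‖x‖ < R → HasDerivAt f (-dx G (x, w)) x := fun x hx => by
    have := (hasDerivAt_dx (p := (x, w)) (hG _ (mem_bidisc.2 ⟨hx, hw⟩)).differentiableAt)
    exact this.const_sub w
  have hfdiff : DifferentiableOn ℂ f (Metric.ball 0 R) := fun x hx =>
    (hfd x (by simpa using hx)).differentiableAt.differentiableWithinAt
  have hXR : ‖X‖ < R := hXρ.trans hρ
  have hball : Metric.ball (0 : ℂ) R ∈ 𝓝 X := Metric.isOpen_ball.mem_nhds (by simpa using hXR)
  set k : ℂ → ℂ := dslope f X with hk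
  have hkd : DifferentiableOn ℂ k (Metric.ball 0 R) :=
    (Complex.differentiableOn_dslope hball).2 hfdiff
  have hfX : f X = 0 := by simp only [hf]; rw [hroot, sub_self]
  have hfk : ∀ x, f x = (x - X) * k x := fun x => by
    have := sub_smul_dslope f X x
    rw [hfX, sub_zero, smul_eq_mul] at this
    exact this.symm
  have hkne : ∀ x, ‖x‖ ≤ ρ → k x ≠ 0 := by
    intro x hx
    rcases eq_or_ne x X with rfl | hne
    · rw [hk, dslope_same, (hfd x hXR).deriv]
      exact neg_ne_zero.2 hdx
    · intro h0
      have h1 : f x = 0 := by rw [hfk, h0, mul_zero]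
      exact hne (huniq x hx (sub_eq_zero.1 h1).symm)
  have hkat : ∀ x, ‖x‖ ≤ ρ → DifferentiableAt ℂ k x ∧ DifferentiableAt ℂ (deriv k) x := fun x hx => by
    have hm : Metric.ball (0 : ℂ) R ∈ 𝓝 x :=
      Metric.isOpen_ball.mem_nhds (by simpa using hx.trans_lt hρ)
    exact ⟨hkd.differentiableAt hm, (hkd.deriv Metric.isOpen_ball).differentiableAt hm⟩
  set h : ℂ → ℂ := fun x => deriv k x / k x with hh
  have hhd : ∀ x, ‖x‖ ≤ ρ → DifferentiableAt ℂ h x := fun x hx =>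
    (hkat x hx).2.div (hkat x hx).1 (hkne x hx)
  -- As f = (x − X)k and f' = −G_x, the kernel is −f'/f = −1/(x − X) − k'/k. The second part is
  -- holomorphic on the whole disc; the sign of the first makes the inner contour exceed the outer
  -- one by +X⁻ⁿ.
  have hkern : ∀ x, ‖x‖ ≤ ρ → x ≠ X → kern G x w = -(x - X)⁻¹ - h x := by
    intro x hx hne
    have h1 : HasDerivAt f (1 * k x + (x - X) * deriv k x) x := by
      have : f = fun x => (x - X) * k x := funext hfk
      rw [this]
      exact ((hasDerivAt_id x).sub_const X).mul (hkat x hx).1.hasDerivAt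
    have h2 := h1.unique (hfd x (hx.trans_lt hρ))
    have h3 : dx G (x, w) = -(1 * k x + (x - X) * deriv k x) := by rw [h2, neg_neg]
    have h4 := hkne x hx
    have h5 := sub_ne_zero.2 hne
    change dx G (x, w) / f x = _
    rw [hfk, h3, hh]
    field_simp
    ring
  have hsplit : ∀ s : ℝ, 0 < s → s ≤ ρ → s ≠ ‖X‖ → ∮ x in C(0, s), (x ^ n)⁻¹ * kern G x w
      = -(∮ x in C(0, s), (x ^ n)⁻¹ * (x - X)⁻¹) - ∮ x in C(0, s), (x ^ n)⁻¹ * h x := by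
    intro s hs hsρ hsX
    have hx0 : ∀ x ∈ Metric.sphere (0 : ℂ) s, x ≠ 0 ∧ x ≠ X ∧ ‖x‖ ≤ ρ := fun x hx => by
      have hx' : ‖x‖ = s := by simpa using hx
      exact ⟨norm_pos_iff.1 (hx' ▸ hs), fun h => hsX (by rw [← hx', h]), hx'.le.trans hsρ⟩
    have hc1 : ContinuousOn (fun x : ℂ => (x ^ n)⁻¹) (Metric.sphere 0 s) := fun x hx =>
      ((continuousAt_id.pow n).inv₀ (pow_ne_zero n (hx0 x hx).1)).continuousWithinAt
    have hc2 : ContinuousOn (fun x : ℂ => (x - X)⁻¹) (Metric.sphere 0 s) := fun x hx =>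
      ((continuousAt_id.sub continuousAt_const).inv₀
        (sub_ne_zero.2 (hx0 x hx).2.1)).continuousWithinAt
    have hc3 : ContinuousOn h (Metric.sphere 0 s) := fun x hx =>
      (hhd x (hx0 x hx).2.2).continuousAt.continuousWithinAt
    have e : -(∮ x in C(0, s), (x ^ n)⁻¹ * (x - X)⁻¹)
        = ∮ x in C(0, s), (-1) * ((x ^ n)⁻¹ * (x - X)⁻¹) := by
      rw [circleIntegral.integral_const_mul]; ring
    have hc4 : ContinuousOn (fun x : ℂ => (-1) * ((x ^ n)⁻¹ * (x - X)⁻¹)) (Metric.sphere 0 s) :=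
      continuousOn_const.mul (hc1.mul hc2)
    have hc5 : ContinuousOn (fun x : ℂ => (x ^ n)⁻¹ * h x) (Metric.sphere 0 s) := hc1.mul hc3
    rw [e, ← circleIntegral.integral_sub (hc4.circleIntegrable hs.le) (hc5.circleIntegrable hs.le)]
    refine circleIntegral.integral_congr hs.le fun x hx => ?_
    rw [hkern x (hx0 x hx).2.2 (hx0 x hx).2.1]
    ring
  have hshift : ∮ x in C(0, ρ), (x ^ n)⁻¹ * h x = ∮ x in C(0, r), (x ^ n)⁻¹ * h x :=
    circleIntegral_eq_of_differentiableAt hr (hrX.trans hXρ).le fun x hx0 hx =>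
      ((differentiableAt_id.pow n).inv (pow_ne_zero n hx0)).mul (hhd x hx)
  have hpole := circleIntegral_pow_inv_mul_sub_inv hr hrX hXρ n
  rw [innerCoeff, innerCoeff, hsplit r hr (hrX.trans hXρ).le hrX.ne,
    hsplit ρ (hr.trans (hrX.trans hXρ)) le_rfl hXρ.ne', hshift]
  have h3 := Complex.two_pi_I_ne_zero
  rw [eq_comm, ← sub_eq_zero]
  have h4 : (X ^ n)⁻¹ = (2 * Real.pi * Complex.I)⁻¹ * (2 * Real.pi * Complex.I * (X ^ n)⁻¹) := by
    rw [← mul_assoc, inv_mul_cancel₀ h3, one_mul]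
  rw [h4, ← hpole]
  ring

end ContourShift

/-! ### Uniform perturbations of F. -/

section RootBranch

variable {F G : ℂ × ℂ → ℂ} {R S x₀ y₀ : ℝ}

/-- `G` is analytic on the bidisc and uniformly `η`-close to `F` there. -/
structure IsNear (F G : ℂ × ℂ → ℂ) (R S η : ℝ) : Prop where
  analytic : AnalyticOnNhd ℂ G (bidisc R S)
  le : ∀ p ∈ bidisc R S, ‖G p - F p‖ ≤ η

theorem IsNear.mono {η η' : ℝ} (h : IsNear F G R S η) (hη : η ≤ η') : IsNear F G R S η' :=
  ⟨h.analytic, fun p hp => (h.le p hp).trans hη⟩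

/-- Cauchy's estimate on discs of radius s < R − R' about x, followed by s ↑ R − R'. This is how
sup-norm closeness of G to F controls G_x. -/
theorem IsNear.norm_dx_sub_le {η R' : ℝ} (h : IsNear F G R S η)
    (hF : AnalyticOnNhd ℂ F (bidisc R S)) (hR' : R' < R) {x w : ℂ} (hx : ‖x‖ ≤ R')
    (hw : ‖w‖ < S) : ‖dx G (x, w) - dx F (x, w)‖ ≤ η / (R - R') := by
  have hm : ∀ z ∈ Metric.ball x (R - R'), (z, w) ∈ bidisc R S := fun z hz => by
    refine mem_bidisc.2 ⟨?_, hw⟩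
    have h1 : ‖z - x‖ < R - R' := by simpa [dist_eq_norm] using hz
    calc ‖z‖ = ‖x + (z - x)‖ := by congr 1; ring
      _ ≤ ‖x‖ + ‖z - x‖ := norm_add_le _ _
      _ < R := by linarith
  have hd : ∀ z ∈ Metric.ball x (R - R'), HasDerivAt (fun z => G (z, w) - F (z, w))
      (dx G (z, w) - dx F (z, w)) z := fun z hz =>
    (hasDerivAt_dx (p := (z, w)) (h.analytic _ (hm z hz)).differentiableAt).sub
      (hasDerivAt_dx (p := (z, w)) (hF _ (hm z hz)).differentiableAt)
  have hpos : 0 < R - R' := by linarith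
  rw [← (hd x (Metric.mem_ball_self hpos)).deriv]
  have key : ∀ s, 0 < s → s < R - R' →
      ‖deriv (fun z => G (z, w) - F (z, w)) x‖ ≤ η / s := fun s hs hsR => by
    have hsub : Metric.closedBall x s ⊆ Metric.ball x (R - R') :=
      Metric.closedBall_subset_ball hsR
    refine Complex.norm_deriv_le_of_forall_mem_sphere_norm_le hs ?_ fun z hz => h.le _
      (hm z (hsub (Metric.sphere_subset_closedBall hz)))
    refine DifferentiableOn.diffContOnCl fun z hz => ?_
    refine (hd z (hsub ?_)).differentiableAt.differentiableWithinAt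
    rwa [closure_ball x hs.ne'] at hz
  have ht : Tendsto (fun s => η / s) (𝓝[<] (R - R')) (𝓝 (η / (R - R'))) :=
    (tendsto_const_nhds.div tendsto_id hpos.ne').mono_left nhdsWithin_le_nhds
  refine ge_of_tendsto ht ?_
  filter_upwards [Ioo_mem_nhdsLT hpos] with s hs
  exact key s hs.1 hs.2

end RootBranch

end SingleEquation

namespace SingleEquation

/-! ### Roots of w = G(x, w) near x₀. -/

section RootBranch

variable {F G : ℂ × ℂ → ℂ} {R S x₀ y₀ : ℝ}

/-- Near `(x₀, y₀)` the equation `w = G(x, w)` has a unique root `x`, for all `G` close to `F`. -/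
structure HasRootBranch (F : ℂ × ℂ → ℂ) (R S x₀ y₀ ε δ η κ : ℝ) : Prop where
  ε_pos : 0 < ε
  ε_lt : ε < x₀
  ε_lt' : x₀ + ε < R
  δ_pos : 0 < δ
  η_pos : 0 < η
  κ_pos : 0 < κ
  norm_lt : ∀ w : ℂ, ‖w - y₀‖ ≤ δ → ‖w‖ < S
  expand : ∀ G, IsNear F G R S η → ∀ w : ℂ, ‖w - y₀‖ ≤ δ →
    ∀ x ∈ Metric.closedBall (x₀ : ℂ) ε, ∀ x' ∈ Metric.closedBall (x₀ : ℂ) ε,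
      κ * ‖x - x'‖ ≤ ‖G (x, w) - G (x', w)‖
  dx_ne_zero : ∀ G, IsNear F G R S η → ∀ w : ℂ, ‖w - y₀‖ ≤ δ →
    ∀ x ∈ Metric.closedBall (x₀ : ℂ) ε, dx G (x, w) ≠ 0
  exists_root : ∀ ε' > 0, ε' ≤ ε → ∃ δ' > 0, δ' ≤ δ ∧ ∃ η' > 0, η' ≤ η ∧ ∀ G, IsNear F G R S η' →
    ∀ w : ℂ, ‖w - y₀‖ ≤ δ' → ∃ X ∈ Metric.closedBall (x₀ : ℂ) ε', G (X, w) = w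

theorem norm_lt_of_mem_closedBall {ε : ℝ} (hx₀ : 0 < x₀) (h : x₀ + ε < R) {x : ℂ}
    (hx : x ∈ Metric.closedBall (x₀ : ℂ) ε) : ‖x‖ < R := by
  have h1 : ‖x - x₀‖ ≤ ε := by simpa [dist_eq_norm] using hx
  calc ‖x‖ = ‖(x₀ : ℂ) + (x - x₀)‖ := by congr 1; ring
    _ ≤ ‖(x₀ : ℂ)‖ + ‖x - x₀‖ := norm_add_le _ _
    _ ≤ x₀ + ε := by rw [Complex.norm_real, Real.norm_of_nonneg hx₀.le]; linarith
    _ < R := h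

/-- Contraction principle: a map which is `‖A‖/2`-close to the affine map of slope `A` and nearly
solves the equation at the centre has a root. -/
theorem exists_root_of_almost_linear {g : ℂ → ℂ} {A c w : ℂ} {ε : ℝ} (hA : A ≠ 0) (hε : 0 < ε)
    (hg : ∀ x ∈ Metric.closedBall c ε, ∀ x' ∈ Metric.closedBall c ε,
      ‖g x - g x' - A * (x - x')‖ ≤ ‖A‖ / 2 * ‖x - x'‖)
    (hc : ‖w - g c‖ ≤ ‖A‖ / 2 * ε) : ∃ X ∈ Metric.closedBall c ε, g X = w := by
  set T : ℂ → ℂ := fun x => x + (w - g x) / A with hT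
  have hA' : 0 < ‖A‖ := norm_pos_iff.2 hA
  have hlip : ∀ x ∈ Metric.closedBall c ε, ∀ x' ∈ Metric.closedBall c ε,
      ‖T x - T x'‖ ≤ 1 / 2 * ‖x - x'‖ := by
    intro x hx x' hx'
    have e : T x - T x' = -(g x - g x' - A * (x - x')) / A := by
      simp only [hT]; field_simp; ring
    rw [e, norm_div, norm_neg, div_le_iff₀ hA']
    calc _ ≤ _ := hg x hx x' hx'
      _ = _ := by ring
  have hmaps : Set.MapsTo T (Metric.closedBall c ε) (Metric.closedBall c ε) := by
    intro x hx
    have hcc : c ∈ Metric.closedBall c ε := Metric.mem_closedBall_self hε.le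
    have h1 := hlip x hx c hcc
    have hx' : ‖x - c‖ ≤ ε := by simpa [dist_eq_norm] using hx
    have h2 : ‖T c - c‖ ≤ ε / 2 := by
      have e : T c - c = (w - g c) / A := by simp [hT]
      rw [e, norm_div, div_le_iff₀ hA']
      linarith
    rw [mem_closedBall_iff_norm]
    calc ‖T x - c‖ = ‖(T x - T c) + (T c - c)‖ := by congr 1; ring
      _ ≤ ‖T x - T c‖ + ‖T c - c‖ := norm_add_le _ _
      _ ≤ ε := by linarith
  have hcontr : ContractingWith (1 / 2) (hmaps.restrict T _ _) := by
    refine ⟨by rw [← NNReal.coe_lt_coe]; norm_num, LipschitzWith.of_dist_le_mul fun a b => ?_⟩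
    rw [Subtype.dist_eq, Subtype.dist_eq, dist_eq_norm, dist_eq_norm]
    have := hlip a a.2 b b.2
    simpa using this
  obtain ⟨X, hX, hfix, -⟩ := hcontr.exists_fixedPoint' (Metric.isClosed_closedBall.isComplete) hmaps
    (Metric.mem_closedBall_self hε.le) (edist_ne_top _ _)
  refine ⟨X, hX, ?_⟩
  have h1 : (w - g X) / A = 0 := by
    have : X + (w - g X) / A = X := hfix
    simpa using this
  rcases div_eq_zero_iff.1 h1 with h2 | h2
  · exact (sub_eq_zero.1 h2).symm
  · exact absurd h2 hA

/-- In a small box F_x stays within ‖A‖/4 of its value A at the centre, and G_x within another ‖A‖/4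
of F_x. Hence x ↦ G(x, w) differs from a map of slope A by a map with Lipschitz constant ‖A‖/2: it
expands distances, and the contraction principle yields a root. One box serves all nearby G. -/
theorem exists_hasRootBranch (hF : AnalyticOnNhd ℂ F (bidisc R S)) (hx₀ : 0 < x₀) (hR : x₀ < R)
    (hy₀ : 0 < y₀) (hS : y₀ < S) (hfix : F (x₀, y₀) = y₀) (hA : dx F (x₀, y₀) ≠ 0) :
    ∃ ε δ η, HasRootBranch F R S x₀ y₀ ε δ η (‖dx F (x₀, y₀)‖ / 2) := by
  set A := dx F (x₀, y₀) with hAdef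
  have hA' : 0 < ‖A‖ := norm_pos_iff.2 hA
  have hm : ((x₀ : ℂ), (y₀ : ℂ)) ∈ bidisc R S := mem_bidisc.2
    ⟨by rwa [Complex.norm_real, Real.norm_of_nonneg hx₀.le],
      by rwa [Complex.norm_real, Real.norm_of_nonneg hy₀.le]⟩
  have hcont := (analyticAt_dx (hF _ hm)).continuousAt
  have hopen : bidisc R S ∈ 𝓝 ((x₀ : ℂ), (y₀ : ℂ)) := isOpen_bidisc.mem_nhds hm
  have h1 := hcont.eventually (Metric.ball_mem_nhds (dx F (x₀, y₀)) (show 0 < ‖A‖ / 4 by positivity))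
  obtain ⟨e, he, heb⟩ := Metric.eventually_nhds_iff_ball.1 (h1.and hopen)
  set ε := min (e / 2) (min (x₀ / 2) ((R - x₀) / 2)) with hε
  set δ := e / 2 with hδ
  -- Chosen so that the Cauchy estimate for G_x − F_x on |x| ≤ x₀ + ε gives exactly ‖A‖/4.
  set η := ‖A‖ / 4 * (R - (x₀ + ε)) with hη
  have hεpos : 0 < ε := lt_min (by linarith) (lt_min (by linarith) (by linarith))
  have hεe : ε ≤ e / 2 := min_le_left _ _
  have hεx : ε ≤ x₀ / 2 := (min_le_right _ _).trans (min_le_left _ _)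
  have hεR : ε ≤ (R - x₀) / 2 := (min_le_right _ _).trans (min_le_right _ _)
  have hRε : 0 < R - (x₀ + ε) := by linarith
  have hbox : ∀ x ∈ Metric.closedBall (x₀ : ℂ) ε, ∀ w : ℂ, ‖w - y₀‖ ≤ δ →
      (x, w) ∈ Metric.ball ((x₀ : ℂ), (y₀ : ℂ)) e := by
    intro x hx w hw
    rw [← ball_prod_same]
    refine ⟨?_, ?_⟩
    · exact Metric.mem_ball.2 (lt_of_le_of_lt (Metric.mem_closedBall.1 hx) (by linarith))
    · rw [Metric.mem_ball, dist_eq_norm]; linarith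
  have hwS : ∀ w : ℂ, ‖w - y₀‖ ≤ δ → ‖w‖ < S := fun w hw =>
    (mem_bidisc.1 (heb _ (hbox x₀ (Metric.mem_closedBall_self hεpos.le) w hw)).2).2
  have hdx : ∀ G, IsNear F G R S η → ∀ w : ℂ, ‖w - y₀‖ ≤ δ →
      ∀ x ∈ Metric.closedBall (x₀ : ℂ) ε, ‖dx G (x, w) - A‖ ≤ ‖A‖ / 2 := by
    intro G hG w hw x hx
    have h2 := (heb _ (hbox x hx w hw)).1
    rw [dist_eq_norm, ← hAdef] at h2
    have hxn : ‖x‖ ≤ x₀ + ε := by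
      have h1 : ‖x - x₀‖ ≤ ε := by simpa [dist_eq_norm] using hx
      calc ‖x‖ = ‖(x₀ : ℂ) + (x - x₀)‖ := by congr 1; ring
        _ ≤ ‖(x₀ : ℂ)‖ + ‖x - x₀‖ := norm_add_le _ _
        _ ≤ x₀ + ε := by rw [Complex.norm_real, Real.norm_of_nonneg hx₀.le]; linarith
    have h3 := hG.norm_dx_sub_le hF (R' := x₀ + ε) (by linarith) hxn (hwS w hw)
    rw [hη, mul_div_assoc, div_self hRε.ne', mul_one] at h3
    calc ‖dx G (x, w) - A‖ = ‖(dx G (x, w) - dx F (x, w)) + (dx F (x, w) - A)‖ := by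
          congr 1; ring
      _ ≤ _ := norm_add_le _ _
      _ ≤ ‖A‖ / 2 := by linarith
  have hlin : ∀ G, IsNear F G R S η → ∀ w : ℂ, ‖w - y₀‖ ≤ δ →
      ∀ x ∈ Metric.closedBall (x₀ : ℂ) ε, ∀ x' ∈ Metric.closedBall (x₀ : ℂ) ε,
        ‖G (x, w) - G (x', w) - A * (x - x')‖ ≤ ‖A‖ / 2 * ‖x - x'‖ := by
    intro G hG w hw x hx x' hx'
    have := (convex_closedBall (x₀ : ℂ) ε).norm_image_sub_le_of_norm_hasDerivWithin_le
      (f := fun x => G (x, w) - A * x) (f' := fun x => dx G (x, w) - A * 1) (C := ‖A‖ / 2)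
      (fun u hu => ?_) (fun u hu => by rw [mul_one]; exact hdx G hG w hw u hu) hx' hx
    · refine le_trans (le_of_eq ?_) this
      congr 1; ring
    · have hmu : (u, w) ∈ bidisc R S := (heb _ (hbox u hu w hw)).2
      exact ((hasDerivAt_dx (p := (u, w)) (hG.analytic _ hmu).differentiableAt).sub
        ((hasDerivAt_id u).const_mul A)).hasDerivWithinAt
  refine ⟨ε, δ, η, hεpos, by linarith, by linarith, by positivity, by positivity, by positivity,
    hwS, ?_, ?_, ?_⟩
  · intro G hG w hw x hx x' hx'
    have h2 := hlin G hG w hw x hx x' hx'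
    have h3 : ‖A * (x - x')‖ ≤ ‖G (x, w) - G (x', w)‖ + ‖G (x, w) - G (x', w) - A * (x - x')‖ := by
      calc ‖A * (x - x')‖ = ‖(G (x, w) - G (x', w)) - (G (x, w) - G (x', w) - A * (x - x'))‖ := by
            congr 1; ring
        _ ≤ _ := norm_sub_le _ _
    rw [norm_mul] at h3
    linarith
  · intro G hG w hw x hx h0
    have h2 := hdx G hG w hw x hx
    rw [h0, zero_sub, norm_neg] at h2
    linarith
  · intro ε' hε' hεε'
    -- The residual at the centre of the disc is split in two: moving w away from y₀ and replacing F
    -- by G may each cost ‖A‖ε'/4.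
    have hc0 : ContinuousAt (fun w : ℂ => w - F (x₀, w)) y₀ :=
      continuousAt_id.sub (hasDerivAt_dy (p := ((x₀ : ℂ), (y₀ : ℂ)))
        (hF _ hm).differentiableAt).continuousAt
    have hev := hc0.eventually (Metric.ball_mem_nhds _ (show 0 < ‖A‖ / 4 * ε' by positivity))
    obtain ⟨d, hd, hdb⟩ := Metric.eventually_nhds_iff_ball.1 hev
    refine ⟨min δ (d / 2), lt_min (by positivity) (by linarith), min_le_left _ _,
      min η (‖A‖ / 4 * ε'), lt_min (by positivity) (by positivity), min_le_left _ _,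
      fun G hG w hw => ?_⟩
    have hwδ : ‖w - y₀‖ ≤ δ := hw.trans (min_le_left _ _)
    have hsub : Metric.closedBall (x₀ : ℂ) ε' ⊆ Metric.closedBall (x₀ : ℂ) ε :=
      Metric.closedBall_subset_closedBall hεε'
    refine exists_root_of_almost_linear (g := fun x => G (x, w)) hA hε' (fun x hx x' hx' =>
      hlin G (hG.mono (min_le_left _ _)) w hwδ x (hsub hx) x' (hsub hx')) ?_
    have h2 := hdb w (by
      rw [mem_ball_iff_norm]
      exact (hw.trans (min_le_right _ _)).trans_lt (by linarith))
    simp only [hfix, sub_self] at h2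
    rw [dist_eq_norm, sub_zero] at h2
    have h3 := hG.le (x₀, w)
      (heb _ (hbox x₀ (Metric.mem_closedBall_self hεpos.le) w hwδ)).2
    calc ‖w - G (x₀, w)‖ = ‖(w - F (x₀, w)) - (G (x₀, w) - F (x₀, w))‖ := by congr 1; ring
      _ ≤ _ := norm_sub_le _ _
      _ ≤ ‖A‖ / 4 * ε' + ‖A‖ / 4 * ε' := add_le_add h2.le (h3.trans (min_le_right _ _))
      _ = _ := by ring

/-- A root of `w = G(x, w)` in the closed disc of radius `ε` about `x₀` (if there is one). -/
noncomputable def root (G : ℂ × ℂ → ℂ) (x₀ ε : ℝ) (w : ℂ) : ℂ :=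
  Classical.epsilon fun X => X ∈ Metric.closedBall (x₀ : ℂ) ε ∧ G (X, w) = w

theorem root_spec {ε : ℝ} {w : ℂ} (h : ∃ X ∈ Metric.closedBall (x₀ : ℂ) ε, G (X, w) = w) :
    root G x₀ ε w ∈ Metric.closedBall (x₀ : ℂ) ε ∧ G (root G x₀ ε w, w) = w :=
  Classical.epsilon_spec (p := fun X => X ∈ Metric.closedBall (x₀ : ℂ) ε ∧ G (X, w) = w) h

/-- A root-free closed region of `|x| ≤ x₀` stays root-free for slightly larger `|x|`. -/
theorem exists_radius_of_ne (hF : AnalyticOnNhd ℂ F (bidisc R S)) (hR : x₀ < R)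
    {B K : Set ℂ} (hB : IsClosed B) (hK : IsCompact K) (hKS : ∀ w ∈ K, ‖w‖ < S)
    (hne : ∀ x ∈ B, ‖x‖ ≤ x₀ → ∀ w ∈ K, F (x, w) ≠ w) :
    ∃ ρ > x₀, ρ < R ∧ ∀ ρ' ≤ ρ, ∃ c > 0, ∀ x ∈ B, ‖x‖ ≤ ρ' → ∀ w ∈ K, c ≤ ‖w - F (x, w)‖ := by
  set R' := (x₀ + R) / 2 with hR'
  have hcomp : ∀ s : ℝ, IsCompact ((Metric.closedBall (0 : ℂ) s ∩ B) ×ˢ K) := fun s =>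
    ((isCompact_closedBall _ _).inter_right hB).prod hK
  have hcont : ∀ s < R, ContinuousOn (fun p : ℂ × ℂ => p.2 - F p)
      ((Metric.closedBall (0 : ℂ) s ∩ B) ×ˢ K) := fun s hs p hp => by
    have hm : p ∈ bidisc R S := by
      rw [← Prod.mk.eta (p := p)]
      exact mem_bidisc.2 ⟨lt_of_le_of_lt (by simpa using hp.1.1) hs, hKS _ hp.2⟩
    exact (continuousAt_snd.sub (hF p hm).continuousAt).continuousWithinAt
  have hρ : ∃ ρ > x₀, ρ < R ∧ ∀ x ∈ B, ‖x‖ ≤ ρ → ∀ w ∈ K, F (x, w) ≠ w := by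
    set Z := ((Metric.closedBall (0 : ℂ) R' ∩ B) ×ˢ K) ∩ (fun p : ℂ × ℂ => p.2 - F p) ⁻¹' {0} with hZ
    have hZc : IsCompact Z := by
      refine (hcomp R').of_isClosed_subset ?_ Set.inter_subset_left
      exact (hcont R' (by rw [hR']; linarith)).preimage_isClosed_of_isClosed
        (hcomp R').isClosed isClosed_singleton
    rcases Z.eq_empty_or_nonempty with hZe | hZn
    · refine ⟨R', by rw [hR']; linarith, by rw [hR']; linarith, fun x hx hxn w hw h0 => ?_⟩
      have : (x, w) ∈ Z := ⟨⟨⟨by simpa using hxn, hx⟩, hw⟩, by simp [h0]⟩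
      rw [hZe] at this
      exact this
    -- A zero with |x| minimal; by hypothesis it lies beyond x₀, and the midpoint between the two
    -- radii is root-free.
    · obtain ⟨q, hq, hmin⟩ := hZc.exists_isMinOn hZn (f := fun p : ℂ × ℂ => ‖p.1‖)
        (by fun_prop)
      have hqx : x₀ < ‖q.1‖ := by
        by_contra hcon
        push Not at hcon
        refine hne q.1 hq.1.1.2 hcon q.2 hq.1.2 ?_
        have := hq.2
        simp only [Set.mem_preimage, Set.mem_singleton_iff] at this
        exact (sub_eq_zero.1 this).symm
      have hqR : ‖q.1‖ ≤ R' := by simpa using hq.1.1.1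
      refine ⟨(x₀ + ‖q.1‖) / 2, by linarith, by rw [hR'] at hqR; linarith,
        fun x hx hxn w hw h0 => ?_⟩
      have : (x, w) ∈ Z := ⟨⟨⟨by simpa using (by linarith : ‖x‖ ≤ R'), hx⟩, hw⟩, by simp [h0]⟩
      have h1 : ‖q.1‖ ≤ ‖x‖ := hmin this
      linarith
  obtain ⟨ρ, hρx, hρR, hρne⟩ := hρ
  refine ⟨ρ, hρx, hρR, fun ρ' hρ' => ?_⟩
  rcases ((Metric.closedBall (0 : ℂ) ρ' ∩ B) ×ˢ K).eq_empty_or_nonempty with he | hn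
  · refine ⟨1, one_pos, fun x hx hxn w hw => ?_⟩
    have : (x, w) ∈ (Metric.closedBall (0 : ℂ) ρ' ∩ B) ×ˢ K := ⟨⟨by simpa using hxn, hx⟩, hw⟩
    rw [he] at this
    exact this.elim
  · obtain ⟨q, hq, hmin⟩ := (hcomp ρ').exists_isMinOn hn (hcont ρ' (hρ'.trans_lt hρR)).norm
    refine ⟨‖q.2 - F q‖, norm_pos_iff.2 (sub_ne_zero.2 fun h => ?_), fun x hx hxn w hw => ?_⟩
    · exact hρne q.1 hq.1.2 ((by simpa using hq.1.1 : ‖q.1‖ ≤ ρ').trans hρ') q.2 hq.2 h.symm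
    · exact hmin (show (x, w) ∈ _ from ⟨⟨by simpa using hxn, hx⟩, hw⟩)

end RootBranch

end SingleEquation

namespace SingleEquation

/-! ### Localization of the coefficients at the dominant root. -/

section Localization

variable {F G : ℂ × ℂ → ℂ} {R S x₀ y₀ : ℝ}

/-- `n [x^n] y(x)` as a double contour integral, see `natCast_mul_coeffAt_eq`. -/
noncomputable def doubleCoeff (G : ℂ × ℂ → ℂ) (y₀ : ℝ) (n : ℕ) (r : ℝ) : ℂ :=
  (2 * Real.pi * Complex.I)⁻¹ * ∮ w in C(0, y₀), innerCoeff G n r w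

theorem doubleCoeff_eq_integral (G : ℂ × ℂ → ℂ) (y₀ : ℝ) (n : ℕ) (r : ℝ) :
    doubleCoeff G y₀ n r = (2 * Real.pi : ℂ)⁻¹ * ∫ β in (-Real.pi)..Real.pi,
      circleMap 0 y₀ β * innerCoeff G n r (circleMap 0 y₀ β) := by
  have hper : Function.Periodic
      (fun β => circleMap 0 y₀ β * innerCoeff G n r (circleMap 0 y₀ β)) (2 * Real.pi) := fun β => by
    simp only [periodic_circleMap 0 y₀ β]
  have h := hper.intervalIntegral_add_eq 0 (-Real.pi)
  rw [zero_add, show -Real.pi + 2 * Real.pi = Real.pi by ring] at h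
  rw [doubleCoeff, ← h]
  simp only [circleIntegral, deriv_circleMap, smul_eq_mul]
  have e : ∀ β : ℝ, circleMap 0 y₀ β * Complex.I * innerCoeff G n r (circleMap 0 y₀ β)
      = Complex.I * (circleMap 0 y₀ β * innerCoeff G n r (circleMap 0 y₀ β)) := fun β => by ring
  simp only [e, intervalIntegral.integral_const_mul]
  have := Complex.I_ne_zero
  field_simp

theorem continuous_innerCoeff (hG : AnalyticOnNhd ℂ G (bidisc R S)) (hy₀ : 0 ≤ y₀) (hS : y₀ < S)
    {r : ℝ} (hr : 0 < r) (hrR : r < R)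
    (hne : ∀ x w : ℂ, ‖x‖ = r → ‖w‖ = y₀ → w - G (x, w) ≠ 0) (n : ℕ) :
    Continuous fun β : ℝ => innerCoeff G n r (circleMap 0 y₀ β) := by
  have hk := continuousOn_kern (A := Metric.sphere 0 r ×ˢ Metric.sphere 0 y₀) hG (by
      rintro ⟨x, w⟩ ⟨hx, hw⟩
      have hx' : ‖x‖ = r := by simpa using hx
      have hw' : ‖w‖ = y₀ := by simpa using hw
      exact mem_bidisc.2 ⟨hx' ▸ hrR, hw' ▸ hS⟩) (by
      rintro ⟨x, w⟩ ⟨hx, hw⟩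
      exact hne x w (by simpa using hx) (by simpa using hw))
  have hc : Continuous fun q : ℝ × ℝ => kern G (circleMap 0 r q.2) (circleMap 0 y₀ q.1) :=
    hk.comp_continuous (f := fun q : ℝ × ℝ => (circleMap 0 r q.2, circleMap 0 y₀ q.1))
      (by fun_prop) fun q => ⟨circleMap_mem_sphere _ hr.le _, circleMap_mem_sphere _ hy₀ _⟩
  have hp : Continuous fun q : ℝ × ℝ => ((circleMap 0 r q.2) ^ n)⁻¹ := by
    refine Continuous.inv₀ (by fun_prop) fun q => pow_ne_zero n ?_
    exact circleMap_ne_center hr.ne'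
  have hd : Continuous fun q : ℝ × ℝ => circleMap 0 r q.2 * Complex.I := by fun_prop
  simp only [innerCoeff, circleIntegral, deriv_circleMap, smul_eq_mul]
  refine continuous_const.mul ?_
  exact intervalIntegral.continuous_parametric_intervalIntegral_of_continuous'
    (f := fun β θ => circleMap 0 r θ * Complex.I *
      ((circleMap 0 r θ ^ n)⁻¹ * kern G (circleMap 0 r θ) (circleMap 0 y₀ β)))
    (hd.mul (hp.mul hc)) _ _

/-- `(x₀, y₀)` is the only solution of `w = F(x, w)` with `|x| ≤ x₀` and `|w| = y₀`, and it is a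
simple solution in `x`. -/
structure IsDominantPoint (F : ℂ × ℂ → ℂ) (R S x₀ y₀ : ℝ) : Prop where
  analytic : AnalyticOnNhd ℂ F (bidisc R S)
  x_pos : 0 < x₀
  x_lt : x₀ < R
  y_pos : 0 < y₀
  y_lt : y₀ < S
  fix : F (x₀, y₀) = y₀
  dx_ne : dx F (x₀, y₀) ≠ 0
  unique : ∀ x w : ℂ, ‖x‖ ≤ x₀ → ‖w‖ = y₀ → F (x, w) = w → x = x₀ ∧ w = y₀

/-- The contribution of the roots `x = X(w)`, `w = y₀ e^{iβ}`, `|β| ≤ δ`, to the coefficients. -/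
noncomputable def mainPart (G : ℂ × ℂ → ℂ) (x₀ y₀ ε δ : ℝ) (n : ℕ) : ℂ :=
  (2 * Real.pi : ℂ)⁻¹ * ∫ β in (-δ)..δ,
    circleMap 0 y₀ β * (root G x₀ ε (circleMap 0 y₀ β) ^ n)⁻¹

/-- The roots `x = X(w)`, `w = y₀ e^{iβ}`, `|β| ≤ δ₀`, of `w = G(x, w)` for all `G` near `F`. -/
structure HasRootFunction (F : ℂ × ℂ → ℂ) (R S x₀ y₀ ε δ₀ η₀ κ : ℝ) : Prop where
  ε_pos : 0 < ε
  ε_lt : ε < x₀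
  ε_lt' : x₀ + ε < R
  δ_pos : 0 < δ₀
  δ_le : δ₀ ≤ Real.pi
  η_pos : 0 < η₀
  κ_pos : 0 < κ
  root_mem : ∀ G, IsNear F G R S η₀ → ∀ β : ℝ, |β| ≤ δ₀ →
    root G x₀ ε (circleMap 0 y₀ β) ∈ Metric.closedBall (x₀ : ℂ) ε
  root_eq : ∀ G, IsNear F G R S η₀ → ∀ β : ℝ, |β| ≤ δ₀ →
    G (root G x₀ ε (circleMap 0 y₀ β), circleMap 0 y₀ β) = circleMap 0 y₀ β
  expand : ∀ G, IsNear F G R S η₀ → ∀ β : ℝ, |β| ≤ δ₀ →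
    ∀ x ∈ Metric.closedBall (x₀ : ℂ) ε, ∀ x' ∈ Metric.closedBall (x₀ : ℂ) ε,
      κ * ‖x - x'‖ ≤ ‖G (x, circleMap 0 y₀ β) - G (x', circleMap 0 y₀ β)‖
  zero_free : ∃ c > 0, ∀ G, IsNear F G R S η₀ → ∀ x w : ℂ, ‖x‖ ≤ x₀ - ε → ‖w‖ = y₀ →
    c ≤ ‖w - G (x, w)‖

/-- Localization of the coefficients, uniformly for all `G` near `F`. -/
structure HasLocalization (F : ℂ × ℂ → ℂ) (R S x₀ y₀ ε δ₀ η₀ κ : ℝ) : Prop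
    extends HasRootFunction F R S x₀ y₀ ε δ₀ η₀ κ where
  approx : ∀ δ, 0 < δ → δ ≤ δ₀ → ∃ ρ > x₀, ∃ η > 0, η ≤ η₀ ∧ ∃ C, ∀ G, IsNear F G R S η →
    ∀ r, 0 < r → r < x₀ - ε → ∀ n,
      ‖doubleCoeff G y₀ n r - mainPart G x₀ y₀ ε δ n‖ ≤ C * (ρ⁻¹) ^ n

theorem norm_circleMap_sub_le (hy₀ : 0 ≤ y₀) (β : ℝ) : ‖circleMap 0 y₀ β - y₀‖ ≤ y₀ * |β| := by
  have e : circleMap 0 y₀ β - y₀ = y₀ * (Complex.exp (Complex.I * β) - 1) := by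
    rw [circleMap, mul_comm Complex.I]; ring
  rw [e, norm_mul, Complex.norm_real, Real.norm_of_nonneg hy₀]
  exact mul_le_mul_of_nonneg_left (by simpa using Real.norm_exp_I_mul_ofReal_sub_one_le (x := β)) hy₀

/-- Expansion converts a residual into a distance, the root for G' being an approximate root for G.
The case G = G' gives continuity in β, the case β = β' gives stability in G. -/
theorem HasRootFunction.norm_root_sub_le {ε δ₀ η₀ κ : ℝ} (h : HasRootFunction F R S x₀ y₀ ε δ₀ η₀ κ)
    {G' : ℂ × ℂ → ℂ} (hG : IsNear F G R S η₀) (hG' : IsNear F G' R S η₀) {β β' : ℝ} (hβ : |β| ≤ δ₀)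
    (hβ' : |β'| ≤ δ₀) : κ * ‖root G x₀ ε (circleMap 0 y₀ β) - root G' x₀ ε (circleMap 0 y₀ β')‖
      ≤ ‖circleMap 0 y₀ β - G (root G' x₀ ε (circleMap 0 y₀ β'), circleMap 0 y₀ β)‖ := by
  have h1 := h.expand G hG β hβ _ (h.root_mem G hG β hβ) _ (h.root_mem G' hG' β' hβ')
  rwa [h.root_eq G hG β hβ] at h1

theorem HasRootFunction.continuousOn_root {ε δ₀ η₀ κ : ℝ}
    (h : HasRootFunction F R S x₀ y₀ ε δ₀ η₀ κ) (hx₀ : 0 < x₀) (hy₀ : 0 ≤ y₀) (hS : y₀ < S)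
    (hG : IsNear F G R S η₀) :
    ContinuousOn (fun β : ℝ => root G x₀ ε (circleMap 0 y₀ β)) (Set.Icc (-δ₀) δ₀) := by
  intro β₀ hβ₀
  have hm : (root G x₀ ε (circleMap 0 y₀ β₀), circleMap 0 y₀ β₀) ∈ bidisc R S := by
    refine mem_bidisc.2 ⟨norm_lt_of_mem_closedBall hx₀ h.ε_lt' (h.root_mem G hG _ (abs_le.2 hβ₀)), ?_⟩
    simpa [abs_of_nonneg hy₀] using hS
  have hc : ContinuousAt (fun β : ℝ => κ⁻¹ * ‖circleMap 0 y₀ β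
      - G (root G x₀ ε (circleMap 0 y₀ β₀), circleMap 0 y₀ β)‖) β₀ := by
    have h1 : ContinuousAt (fun β : ℝ => G (root G x₀ ε (circleMap 0 y₀ β₀), circleMap 0 y₀ β)) β₀ :=
      ContinuousAt.comp (g := G) (f := fun β : ℝ => (root G x₀ ε (circleMap 0 y₀ β₀), circleMap 0 y₀ β))
        (hG.analytic _ hm).continuousAt (by fun_prop)
    have h2 : ContinuousAt (fun β : ℝ => circleMap 0 y₀ β) β₀ := by fun_prop
    exact continuousAt_const.mul (h2.sub h1).norm
  rw [ContinuousWithinAt, tendsto_iff_norm_sub_tendsto_zero]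
  have h0 : Tendsto (fun β : ℝ => κ⁻¹ * ‖circleMap 0 y₀ β
      - G (root G x₀ ε (circleMap 0 y₀ β₀), circleMap 0 y₀ β)‖) (𝓝[Set.Icc (-δ₀) δ₀] β₀) (𝓝 0) := by
    have := hc.tendsto.mono_left (nhdsWithin_le_nhds (s := Set.Icc (-δ₀) δ₀))
    rwa [h.root_eq G hG _ (abs_le.2 hβ₀), sub_self, norm_zero, mul_zero] at this
  refine squeeze_zero' (Eventually.of_forall fun _ => norm_nonneg _) ?_ h0
  filter_upwards [self_mem_nhdsWithin] with β hβ
  rw [inv_mul_eq_div, le_div_iff₀' h.κ_pos]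
  exact h.norm_root_sub_le hG hG (abs_le.2 hβ) (abs_le.2 hβ₀)

theorem IsNear.exists_norm_dx_le (hF : AnalyticOnNhd ℂ F (bidisc R S)) (hS : y₀ < S) {ρ : ℝ}
    (hρ : ρ < R) (η : ℝ) : ∃ M > 0, ∀ G, IsNear F G R S η → ∀ x w : ℂ, ‖x‖ ≤ ρ → ‖w‖ ≤ y₀ →
      ‖dx G (x, w)‖ ≤ M := by
  have hK : IsCompact (Metric.closedBall (0 : ℂ) ρ ×ˢ Metric.closedBall (0 : ℂ) y₀) :=
    (isCompact_closedBall _ _).prod (isCompact_closedBall _ _)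
  have hc : ContinuousOn (dx F) (Metric.closedBall (0 : ℂ) ρ ×ˢ Metric.closedBall (0 : ℂ) y₀) := by
    rintro ⟨x, w⟩ ⟨hx, hw⟩
    exact (analyticAt_dx (hF _ (mem_bidisc.2 ⟨lt_of_le_of_lt (by simpa using hx) hρ,
      lt_of_le_of_lt (by simpa using hw) hS⟩))).continuousAt.continuousWithinAt
  obtain ⟨M, hM⟩ := hK.exists_bound_of_continuousOn hc
  refine ⟨|M| + |η / (R - ρ)| + 1, by positivity, fun G hG x w hx hw => ?_⟩
  have h1 := hM (x, w) ⟨by simpa using hx, by simpa using hw⟩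
  have h2 := hG.norm_dx_sub_le hF hρ hx (hw.trans_lt hS)
  calc ‖dx G (x, w)‖ = ‖(dx G (x, w) - dx F (x, w)) + dx F (x, w)‖ := by congr 1; ring
    _ ≤ _ := norm_add_le _ _
    _ ≤ _ := by linarith [le_abs_self M, le_abs_self (η / (R - ρ))]

theorem le_norm_sub_of_isNear {η c : ℝ} (hG : IsNear F G R S η) (hη : η ≤ c / 2) {x w : ℂ}
    (hm : (x, w) ∈ bidisc R S) (hc : c ≤ ‖w - F (x, w)‖) : c / 2 ≤ ‖w - G (x, w)‖ := by
  have h1 := hG.le _ hm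
  have h2 : ‖w - F (x, w)‖ ≤ ‖w - G (x, w)‖ + ‖G (x, w) - F (x, w)‖ := by
    calc ‖w - F (x, w)‖ = ‖(w - G (x, w)) + (G (x, w) - F (x, w))‖ := by congr 1; ring
      _ ≤ _ := norm_add_le _ _
  linarith

theorem norm_kern_le {x w : ℂ} {M c : ℝ} (hM : ‖dx G (x, w)‖ ≤ M) (hc : 0 < c)
    (h : c ≤ ‖w - G (x, w)‖) : ‖kern G x w‖ ≤ M / c := by
  rw [kern, norm_div]
  exact div_le_div₀ ((norm_nonneg _).trans hM) hM hc h

/-- By dominance and compactness, w − F is bounded below for x away from x₀ up to a radius ρ₁ > x₀,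
and for w at angle at least δ even for all x up to a radius ρ₂ > x₀. Pushing the x-contour out to
these radii crosses one pole for w near y₀ and none otherwise; what remains is O(ρ⁻ⁿ). The lower
bounds survive small perturbations of F, which gives uniformity in G. -/
theorem IsDominantPoint.exists_hasLocalization (h : IsDominantPoint F R S x₀ y₀) :
    ∃ ε δ₀ η₀ κ, HasLocalization F R S x₀ y₀ ε δ₀ η₀ κ := by
  obtain ⟨ε, δ₁, η₁, hb⟩ := exists_hasRootBranch h.analytic h.x_pos h.x_lt h.y_pos h.y_lt h.fix h.dx_ne
  set κ := ‖dx F (x₀, y₀)‖ / 2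
  have hκ := hb.κ_pos
  have hε := hb.ε_pos
  have hx₀ := h.x_pos
  have hy₀ := h.y_pos
  have hcn : ∀ β : ℝ, ‖circleMap 0 y₀ β‖ = y₀ := fun β => by simp [abs_of_pos hy₀]
  have hcm : ∀ {x : ℂ} {w : ℂ}, ‖x‖ < R → ‖w‖ = y₀ → (x, w) ∈ bidisc R S := fun hx hw =>
    mem_bidisc.2 ⟨hx, hw ▸ h.y_lt⟩
  obtain ⟨ρ₁, hρ₁, hρ₁R, hfar⟩ := exists_radius_of_ne (x₀ := x₀) h.analytic h.x_lt
    (B := {x | ε ≤ ‖x - x₀‖}) (isClosed_le continuous_const (by fun_prop)) (isCompact_sphere 0 y₀)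
    (fun w hw => by rw [show ‖w‖ = y₀ by simpa using hw]; exact h.y_lt) fun x hx hxn w hw h0 => by
      have h1 := (h.unique x w hxn (by simpa using hw) h0).1
      rw [h1] at hx
      simp at hx
      linarith
  obtain ⟨c₁, hc₁, hfar⟩ := hfar ρ₁ le_rfl
  -- The root must keep a definite distance from the circle |x| = ρ₁, hence half of the gap.
  set ε₂ := min ε ((ρ₁ - x₀) / 2) with hε₂
  have hε₂pos : 0 < ε₂ := lt_min hε (by linarith)
  have hε₂le : ε₂ ≤ (ρ₁ - x₀) / 2 := min_le_right _ _
  obtain ⟨δ₂, hδ₂, hδ₂le, η₂, hη₂, hη₂le, hroot⟩ := hb.exists_root ε₂ hε₂pos (min_le_left _ _)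
  set δ₀ := min (δ₂ / y₀) Real.pi with hδ₀
  have hδ₀pos : 0 < δ₀ := lt_min (by positivity) Real.pi_pos
  set η₀ := min η₂ (c₁ / 2) with hη₀
  have hη₀pos : 0 < η₀ := lt_min hη₂ (by positivity)
  have hw₂ : ∀ β : ℝ, |β| ≤ δ₀ → ‖circleMap 0 y₀ β - y₀‖ ≤ δ₂ := fun β hβ => by
    refine (norm_circleMap_sub_le hy₀.le β).trans ?_
    have : |β| ≤ δ₂ / y₀ := hβ.trans (min_le_left _ _)
    rwa [le_div_iff₀' hy₀] at this
  have hex : ∀ G, IsNear F G R S η₀ → ∀ β : ℝ, |β| ≤ δ₀ →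
      ∃ X ∈ Metric.closedBall (x₀ : ℂ) ε₂, G (X, circleMap 0 y₀ β) = circleMap 0 y₀ β :=
    fun G hG β hβ => hroot G (hG.mono (min_le_left _ _)) _ (hw₂ β hβ)
  have hspec : ∀ G, IsNear F G R S η₀ → ∀ β : ℝ, |β| ≤ δ₀ →
      root G x₀ ε (circleMap 0 y₀ β) ∈ Metric.closedBall (x₀ : ℂ) ε ∧
        G (root G x₀ ε (circleMap 0 y₀ β), circleMap 0 y₀ β) = circleMap 0 y₀ β :=
    fun G hG β hβ => root_spec (by
      obtain ⟨X, hX, hX'⟩ := hex G hG β hβ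
      exact ⟨X, Metric.closedBall_subset_closedBall (min_le_left _ _) hX, hX'⟩)
  have hexp : ∀ G, IsNear F G R S η₀ → ∀ β : ℝ, |β| ≤ δ₀ →
      ∀ x ∈ Metric.closedBall (x₀ : ℂ) ε, ∀ x' ∈ Metric.closedBall (x₀ : ℂ) ε,
      κ * ‖x - x'‖ ≤ ‖G (x, circleMap 0 y₀ β) - G (x', circleMap 0 y₀ β)‖ :=
    fun G hG β hβ => hb.expand G (hG.mono ((min_le_left _ _).trans hη₂le)) _
      ((hw₂ β hβ).trans hδ₂le)
  -- `root` is only specified up to the ε-disc; injectivity identifies its choice with the root in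
  -- the smaller ε₂-disc.
  have hrootlt : ∀ G, IsNear F G R S η₀ → ∀ β : ℝ, |β| ≤ δ₀ →
      ‖root G x₀ ε (circleMap 0 y₀ β) - x₀‖ ≤ ε₂ := fun G hG β hβ => by
    obtain ⟨X, hX, hX'⟩ := hex G hG β hβ
    have h1 := hexp G hG β hβ _ (hspec G hG β hβ).1 X
      (Metric.closedBall_subset_closedBall (min_le_left _ _) hX)
    rw [(hspec G hG β hβ).2, hX', sub_self, norm_zero] at h1
    have h2 : ‖root G x₀ ε (circleMap 0 y₀ β) - X‖ = 0 :=
      le_antisymm (nonpos_of_mul_nonpos_right h1 hκ) (norm_nonneg _)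
    rw [sub_eq_zero.1 (norm_eq_zero.1 h2)]
    simpa [dist_eq_norm] using hX
  have hfar' : ∀ G, IsNear F G R S η₀ → ∀ x w : ℂ, ε ≤ ‖x - x₀‖ → ‖x‖ ≤ ρ₁ → ‖w‖ = y₀ →
      c₁ / 2 ≤ ‖w - G (x, w)‖ := fun G hG x w hx hxρ hw =>
    le_norm_sub_of_isNear hG (min_le_right _ _) (hcm (hxρ.trans_lt hρ₁R) hw)
      (hfar x hx hxρ w (by simpa using hw))
  have hsmall : ∀ x : ℂ, ‖x‖ ≤ x₀ - ε → ε ≤ ‖x - x₀‖ := fun x hx => by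
    have h1 : ‖(x₀ : ℂ)‖ ≤ ‖x‖ + ‖x - x₀‖ := by
      calc ‖(x₀ : ℂ)‖ = ‖x - (x - x₀)‖ := by congr 1; ring
        _ ≤ _ := norm_sub_le _ _
    rw [Complex.norm_real, Real.norm_of_nonneg hx₀.le] at h1
    linarith
  have hrf : HasRootFunction F R S x₀ y₀ ε δ₀ η₀ κ := ⟨hε, hb.ε_lt, hb.ε_lt', hδ₀pos, min_le_right _ _, hη₀pos, hκ,
    fun G hG β hβ => (hspec G hG β hβ).1, fun G hG β hβ => (hspec G hG β hβ).2, hexp,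
    ⟨c₁ / 2, by positivity, fun G hG x w hx hw => hfar' G hG x w (hsmall x hx) (by linarith) hw⟩⟩
  refine ⟨ε, δ₀, η₀, κ, hrf, ?_⟩
  intro δ hδ hδδ₀
  have hδπ : δ ≤ Real.pi := hδδ₀.trans (min_le_right _ _)
  -- The arc at angle at least δ from y₀. It avoids the dominant point, so no x with |x| ≤ x₀ is a
  -- root for w in it.
  set K : Set ℂ := (circleMap 0 y₀) '' (Set.Icc (-Real.pi) Real.pi ∩ {β | δ ≤ |β|}) with hK
  have hKc : IsCompact K := (isCompact_Icc.inter_right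
    (isClosed_le continuous_const continuous_abs)).image (continuous_circleMap 0 y₀)
  obtain ⟨ρ₂, hρ₂, hρ₂R, hout⟩ := exists_radius_of_ne (x₀ := x₀) h.analytic h.x_lt
    (B := Set.univ) isClosed_univ hKc
    (by rintro w ⟨β, -, rfl⟩; rw [hcn]; exact h.y_lt) (by
      rintro x - hxn w ⟨β, ⟨⟨hβ1, hβ2⟩, hβ3⟩, rfl⟩ h0
      have h1 := (h.unique x _ hxn (hcn β) h0).2
      have h2 := congrArg Complex.re h1
      simp only [circleMap, zero_add, Complex.re_ofReal_mul, Complex.exp_ofReal_mul_I_re,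
        Complex.ofReal_re] at h2
      have h3 : Real.cos β = 1 := by
        have : y₀ * (Real.cos β - 1) = 0 := by linarith
        rcases mul_eq_zero.1 this with h4 | h4
        · exact absurd h4 hy₀.ne'
        · linarith
      have hpi := Real.pi_pos
      rw [Real.cos_eq_one_iff_of_lt_of_lt (by linarith) (by linarith)] at h3
      rw [h3] at hβ3
      simp at hβ3
      linarith)
  obtain ⟨c₂, hc₂, hout⟩ := hout ρ₂ le_rfl
  obtain ⟨M₁, hM₁, hdx₁⟩ := IsNear.exists_norm_dx_le h.analytic h.y_lt hρ₁R η₀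
  obtain ⟨M₂, hM₂, hdx₂⟩ := IsNear.exists_norm_dx_le h.analytic h.y_lt hρ₂R η₀
  -- Lower bound for |w − G| on |x| = ρ₁: the first entry holds away from x₀, the second follows
  -- from expansion and the distance of the root to that circle.
  set c₃ := min (c₁ / 2) (κ * ((ρ₁ - x₀) / 2)) with hc₃
  have hρ₁x : 0 < ρ₁ - x₀ := by linarith
  have hc₃pos : 0 < c₃ := lt_min (by positivity) (by positivity)
  set ρ := min ρ₁ ρ₂ with hρ
  have hρx : x₀ < ρ := lt_min hρ₁ hρ₂
  have hρpos : 0 < ρ := hx₀.trans hρx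
  set C₁ := ρ₁ * (M₁ / c₃) with hC₁
  set C₂ := ρ₂ * (M₂ / (c₂ / 2)) with hC₂
  have hρ₁pos : 0 < ρ₁ := hx₀.trans hρ₁
  have hρ₂pos : 0 < ρ₂ := hx₀.trans hρ₂
  have hC₁pos : 0 < C₁ := by positivity
  have hC₂pos : 0 < C₂ := by positivity
  refine ⟨ρ, hρx, min η₀ (c₂ / 2), lt_min hη₀pos (by positivity), min_le_left _ _,
    (2 * Real.pi)⁻¹ * (y₀ * C₂ * (Real.pi - δ) + y₀ * C₁ * (2 * δ) + y₀ * C₂ * (Real.pi - δ)),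
    fun G hG r hr hrε n => ?_⟩
  have hG₀ : IsNear F G R S η₀ := hG.mono (min_le_left _ _)
  have hrx : r < x₀ := by linarith
  have hp₁ : (ρ₁⁻¹) ^ n ≤ (ρ⁻¹) ^ n :=
    pow_le_pow_left₀ (by positivity) (inv_anti₀ hρpos (min_le_left _ _)) n
  have hp₂ : (ρ₂⁻¹) ^ n ≤ (ρ⁻¹) ^ n :=
    pow_le_pow_left₀ (by positivity) (inv_anti₀ hρpos (min_le_right _ _)) n
  have hbig : ∀ β : ℝ, -Real.pi ≤ β → β ≤ Real.pi → δ ≤ |β| →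
      ‖circleMap 0 y₀ β * innerCoeff G n r (circleMap 0 y₀ β)‖ ≤ y₀ * C₂ * (ρ⁻¹) ^ n := by
    intro β hβ1 hβ2 hβ3
    have hlow : ∀ x, ‖x‖ ≤ ρ₂ → c₂ / 2 ≤ ‖circleMap 0 y₀ β - G (x, circleMap 0 y₀ β)‖ := fun x hx =>
      le_norm_sub_of_isNear hG (min_le_right _ _) (hcm (hx.trans_lt hρ₂R) (hcn β))
        (hout x trivial hx _ ⟨β, ⟨⟨hβ1, hβ2⟩, hβ3⟩, rfl⟩)
    rw [norm_mul, hcn, innerCoeff_eq_of_ne hG.analytic (by rw [hcn]; exact h.y_lt) hr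
      (hrx.trans hρ₂).le hρ₂R (fun x hx => norm_pos_iff.1 ((half_pos hc₂).trans_le (hlow x hx)))]
    have := norm_innerCoeff_le hρ₂pos (fun x hx => norm_kern_le
      (hdx₂ G hG₀ x (circleMap 0 y₀ β) hx.le (hcn β).le) (half_pos hc₂) (hlow x hx.le)) n
    calc _ ≤ y₀ * (C₂ * (ρ₂⁻¹) ^ n) := mul_le_mul_of_nonneg_left this hy₀.le
      _ ≤ y₀ * (C₂ * (ρ⁻¹) ^ n) := by gcongr
      _ = _ := by ring
  have hin : ∀ β : ℝ, |β| ≤ δ →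
      ‖circleMap 0 y₀ β * innerCoeff G n r (circleMap 0 y₀ β)
        - circleMap 0 y₀ β * (root G x₀ ε (circleMap 0 y₀ β) ^ n)⁻¹‖ ≤ y₀ * C₁ * (ρ⁻¹) ^ n := by
    intro β hβ
    have hβ₀ := hβ.trans hδδ₀
    set w := circleMap 0 y₀ β with hw
    set X := root G x₀ ε w with hX
    obtain ⟨hXm, hXe⟩ := hspec G hG₀ β hβ₀
    have hXm' : ‖X - x₀‖ ≤ ε := by simpa [dist_eq_norm] using hXm
    have hX2 := hrootlt G hG₀ β hβ₀
    have hXup : ‖X‖ ≤ x₀ + ε₂ := by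
      calc ‖X‖ = ‖(x₀ : ℂ) + (X - x₀)‖ := by congr 1; ring
        _ ≤ ‖(x₀ : ℂ)‖ + ‖X - x₀‖ := norm_add_le _ _
        _ ≤ x₀ + ε₂ := by rw [Complex.norm_real, Real.norm_of_nonneg hx₀.le]; linarith
    have hXlow : r < ‖X‖ := by
      by_contra hcon
      push Not at hcon
      have : x₀ ≤ ‖X‖ + ‖X - x₀‖ := by
        calc x₀ = ‖(x₀ : ℂ)‖ := by rw [Complex.norm_real, Real.norm_of_nonneg hx₀.le]
          _ = ‖X - (X - x₀)‖ := by congr 1; ring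
          _ ≤ _ := norm_sub_le _ _
      linarith
    have hXρ : ‖X‖ < ρ₁ := by linarith
    have huniq : ∀ x, ‖x‖ ≤ ρ₁ → G (x, w) = w → x = X := by
      intro x hx hxe
      rcases le_or_gt ε ‖x - x₀‖ with h1 | h1
      · have := hfar' G hG₀ x w h1 hx (hcn β)
        rw [hxe, sub_self, norm_zero] at this
        linarith
      · have h2 := hexp G hG₀ β hβ₀ x (by simpa [dist_eq_norm] using h1.le) X hXm
        rw [hxe, hXe, sub_self, norm_zero] at h2
        have h3 : ‖x - X‖ = 0 := le_antisymm (nonpos_of_mul_nonpos_right h2 hκ) (norm_nonneg _)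
        exact sub_eq_zero.1 (norm_eq_zero.1 h3)
    have hlow : ∀ x, ‖x‖ = ρ₁ → c₃ ≤ ‖w - G (x, w)‖ := by
      intro x hx
      rcases le_or_gt ε ‖x - x₀‖ with h1 | h1
      · exact (min_le_left _ _).trans (hfar' G hG₀ x w h1 hx.le (hcn β))
      · have h2 := hexp G hG₀ β hβ₀ X hXm x (by simpa [dist_eq_norm] using h1.le)
        rw [hXe] at h2
        refine (min_le_right _ _).trans (le_trans ?_ h2)
        refine mul_le_mul_of_nonneg_left ?_ hκ.le
        have : ‖x‖ ≤ ‖X‖ + ‖X - x‖ := by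
          calc ‖x‖ = ‖X - (X - x)‖ := by congr 1; ring
            _ ≤ _ := norm_sub_le _ _
        linarith
    have hdxne : dx G (X, w) ≠ 0 := hb.dx_ne_zero G (hG₀.mono ((min_le_left _ _).trans hη₂le)) w
      ((hw₂ β hβ₀).trans hδ₂le) X hXm
    rw [innerCoeff_eq_of_root hG.analytic (by rw [hcn]; exact h.y_lt) hr hXlow hXρ hρ₁R hXe hdxne
      huniq n, mul_add, add_sub_cancel_left, norm_mul, hw, hcn]
    have := norm_innerCoeff_le (G := G) (w := w) hρ₁pos (fun x hx => norm_kern_le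
      (hdx₁ G hG₀ x w hx.le (hcn β).le) hc₃pos (hlow x hx)) n
    calc _ ≤ y₀ * (C₁ * (ρ₁⁻¹) ^ n) := mul_le_mul_of_nonneg_left this hy₀.le
      _ ≤ y₀ * (C₁ * (ρ⁻¹) ^ n) := by gcongr
      _ = _ := by ring
  have hcI : Continuous fun β : ℝ => circleMap 0 y₀ β * innerCoeff G n r (circleMap 0 y₀ β) :=
    (continuous_circleMap 0 y₀).mul (continuous_innerCoeff hG.analytic hy₀.le h.y_lt hr
      (hrx.trans h.x_lt) (fun x w hx hw => norm_pos_iff.1 ((half_pos hc₁).trans_le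
        (hfar' G hG₀ x w (hsmall x (hx ▸ hrε.le)) (by linarith) hw))) n)
  have hloc : ContinuousOn (fun β : ℝ => circleMap 0 y₀ β *
      (root G x₀ ε (circleMap 0 y₀ β) ^ n)⁻¹) (Set.uIcc (-δ) δ) := by
    rw [Set.uIcc_of_le (by linarith)]
    have h1 := (hrf.continuousOn_root hx₀ hy₀.le h.y_lt hG₀).mono
      (Set.Icc_subset_Icc (neg_le_neg hδδ₀) hδδ₀)
    refine (continuous_circleMap 0 y₀).continuousOn.mul ((h1.pow n).inv₀ fun β hβ => ?_)
    have h2 := hrootlt G hG₀ β ((abs_le.2 hβ).trans hδδ₀)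
    refine pow_ne_zero n fun (h0 : root G x₀ ε (circleMap 0 y₀ β) = 0) => ?_
    rw [h0, zero_sub, norm_neg, Complex.norm_real, Real.norm_of_nonneg hx₀.le] at h2
    linarith [min_le_left ε ((ρ₁ - x₀) / 2), hb.ε_lt]
  have hi := fun a b : ℝ => hcI.intervalIntegrable (μ := volume) a b
  have hloci := hloc.intervalIntegrable (μ := volume)
  have hsplit : doubleCoeff G y₀ n r - mainPart G x₀ y₀ ε δ n = (2 * Real.pi : ℂ)⁻¹ *
      ((∫ β in (-Real.pi)..(-δ), circleMap 0 y₀ β * innerCoeff G n r (circleMap 0 y₀ β))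
      + (∫ β in (-δ)..δ, (circleMap 0 y₀ β * innerCoeff G n r (circleMap 0 y₀ β)
        - circleMap 0 y₀ β * (root G x₀ ε (circleMap 0 y₀ β) ^ n)⁻¹))
      + ∫ β in δ..Real.pi, circleMap 0 y₀ β * innerCoeff G n r (circleMap 0 y₀ β)) := by
    rw [doubleCoeff_eq_integral, mainPart, intervalIntegral.integral_sub (hi _ _) hloci,
      ← intervalIntegral.integral_add_adjacent_intervals (hi _ (-δ)) (hi (-δ) Real.pi),
      ← intervalIntegral.integral_add_adjacent_intervals (hi (-δ) δ) (hi δ Real.pi)]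
    ring
  have hb1 := intervalIntegral.norm_integral_le_of_norm_le_const (a := -Real.pi) (b := -δ)
    (C := y₀ * C₂ * (ρ⁻¹) ^ n)
    (f := fun β => circleMap 0 y₀ β * innerCoeff G n r (circleMap 0 y₀ β)) fun β hβ => by
      rw [Set.uIoc_of_le (by linarith)] at hβ
      exact hbig β hβ.1.le (by linarith [hβ.2]) (by rw [abs_of_nonpos] <;> linarith [hβ.2])
  have hb2 := intervalIntegral.norm_integral_le_of_norm_le_const (a := -δ) (b := δ)
    (C := y₀ * C₁ * (ρ⁻¹) ^ n)
    (f := fun β => circleMap 0 y₀ β * innerCoeff G n r (circleMap 0 y₀ β)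
        - circleMap 0 y₀ β * (root G x₀ ε (circleMap 0 y₀ β) ^ n)⁻¹) fun β hβ => by
      rw [Set.uIoc_of_le (by linarith)] at hβ
      exact hin β (abs_le.2 ⟨hβ.1.le, hβ.2⟩)
  have hb3 := intervalIntegral.norm_integral_le_of_norm_le_const (a := δ) (b := Real.pi)
    (C := y₀ * C₂ * (ρ⁻¹) ^ n)
    (f := fun β => circleMap 0 y₀ β * innerCoeff G n r (circleMap 0 y₀ β)) fun β hβ => by
      rw [Set.uIoc_of_le (by linarith)] at hβ
      exact hbig β (by linarith [hβ.1]) hβ.2 (hβ.1.le.trans (le_abs_self β))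
  rw [show |-δ - -Real.pi| = Real.pi - δ by rw [abs_of_nonneg] <;> linarith] at hb1
  rw [show |δ - -δ| = 2 * δ by rw [abs_of_nonneg] <;> linarith] at hb2
  rw [show |Real.pi - δ| = Real.pi - δ by rw [abs_of_nonneg]; linarith] at hb3
  have hnpi : ‖(2 * Real.pi : ℂ)⁻¹‖ = (2 * Real.pi)⁻¹ := by
    rw [norm_inv, norm_mul, Complex.norm_real, Real.norm_of_nonneg Real.pi_pos.le]; simp
  rw [hsplit, norm_mul, hnpi, mul_assoc]
  refine mul_le_mul_of_nonneg_left ?_ (by positivity)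
  calc _ ≤ _ := norm_add₃_le
    _ ≤ _ := add_le_add (add_le_add hb1 hb2) hb3
    _ = _ := by ring

end Localization

end SingleEquation

namespace SingleEquation

/-! ### Power series with nonnegative coefficients. -/

section NonnegCoeff

/-- `f` is the sum on `|z| < R` of a power series with nonnegative coefficients. -/
def HasNonnegCoeff (f : ℂ → ℂ) (R : ℝ) : Prop :=
  ∃ c : ℕ → ℝ, (∀ n, 0 ≤ c n) ∧ ∀ z : ℂ, ‖z‖ < R → HasSum (fun n => (c n : ℂ) * z ^ n) (f z)

theorem HasNonnegCoeff.deriv {f : ℂ → ℂ} {R : ℝ} (h : HasNonnegCoeff f R) :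
    HasNonnegCoeff (deriv f) R := by
  obtain ⟨c, hc, hf⟩ := h
  refine ⟨fun n => (n + 1) * c (n + 1), fun n => mul_nonneg (by positivity) (hc _), fun z hz => ?_⟩
  obtain ⟨s, hzs, hsR⟩ := exists_between hz
  have hs : 0 ≤ s := (norm_nonneg z).trans hzs.le
  have hsum : Summable fun n => c n * s ^ n := by
    have h1 := (hf s (by rwa [Complex.norm_real, Real.norm_of_nonneg hs])).summable
    exact_mod_cast h1
  have h2 := Complex.hasSum_deriv_of_summable_norm (U := Metric.ball 0 s) (z := z)
    (F := fun n z => (c n : ℂ) * z ^ n) hsum (fun n => by fun_prop) Metric.isOpen_ball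
    (fun n w hw => by
      have hw' : ‖w‖ ≤ s := by simpa using (Metric.ball_subset_closedBall hw)
      rw [norm_mul, norm_pow, Complex.norm_real, Real.norm_of_nonneg (hc n)]
      exact mul_le_mul_of_nonneg_left (pow_le_pow_left₀ (norm_nonneg _) hw' n) (hc n))
    (by simpa using hzs)
  have h3 : (fun w => ∑' n, (c n : ℂ) * w ^ n) =ᶠ[𝓝 z] f := by
    filter_upwards [Metric.isOpen_ball.mem_nhds (show z ∈ Metric.ball (0 : ℂ) R by simpa using hz)]
      with w hw
    exact (hf w (by simpa using hw)).tsum_eq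
  rw [h3.deriv_eq] at h2
  have h4 := (hasSum_nat_add_iff' 1).2 h2
  simp only [Finset.range_one, Finset.sum_singleton, pow_zero, deriv_const, sub_zero] at h4
  have e : (fun n => _root_.deriv (fun z => (c (n + 1) : ℂ) * z ^ (n + 1)) z)
      = fun n => (((n + 1) * c (n + 1) : ℝ) : ℂ) * z ^ n := by
    funext n
    rw [deriv_const_mul_field, deriv_pow_field]
    push_cast
    ring
  rw [e] at h4
  exact h4

/-- Used for F_x and F_yy at (x₀, y₀), where nonvanishing upgrades it to positivity; the decay of
the Laplace integrals rests on this. -/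
theorem HasNonnegCoeff.nonneg {f : ℂ → ℂ} {R x : ℝ} (h : HasNonnegCoeff f R) (hx : 0 ≤ x)
    (hxR : x < R) : ∃ v : ℝ, 0 ≤ v ∧ f x = v := by
  obtain ⟨c, hc, hf⟩ := h
  have h1 := hf x (by rwa [Complex.norm_real, Real.norm_of_nonneg hx])
  have h2 : HasSum (fun n => ((c n * x ^ n : ℝ) : ℂ)) (f x) := by push_cast; exact h1
  have h3 := Complex.hasSum_re h2
  simp only [Complex.ofReal_re] at h3
  refine ⟨(f x).re, h3.nonneg fun n => mul_nonneg (hc n) (by positivity), ?_⟩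
  exact h2.unique (Complex.hasSum_ofReal.2 h3)

end NonnegCoeff

/-! ### Aperiodicity and uniqueness of the solution. -/

section Aperiodic

theorem iteratedDeriv_comp_mul_left (f : ℂ → ℂ) (ξ : ℂ) (n : ℕ) :
    iteratedDeriv n (fun x => f (ξ * x)) = fun x => ξ ^ n * iteratedDeriv n f (ξ * x) := by
  induction n with
  | zero => simp
  | succ n ih =>
    rw [iteratedDeriv_succ, ih, iteratedDeriv_succ]
    funext x
    rw [deriv_const_mul_field, deriv_comp_mul_left, smul_eq_mul]
    ring

theorem coeffAt_comp_mul_left (f : ℂ → ℂ) (ξ : ℂ) (n : ℕ) :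
    coeffAt n (fun x => f (ξ * x)) = ξ ^ n * coeffAt n f := by
  rw [coeffAt, iteratedDeriv_comp_mul_left]
  simp [coeffAt, mul_div_assoc]

theorem coeffAt_const_mul (f : ℂ → ℂ) (c : ℂ) (n : ℕ) :
    coeffAt n (fun x => c * f x) = c * coeffAt n f := by
  have h : iteratedDeriv n (fun x => c * f x) = fun x => c * iteratedDeriv n f x := by
    induction n with
    | zero => simp
    | succ n ih =>
      rw [iteratedDeriv_succ, ih, iteratedDeriv_succ]
      funext x
      rw [deriv_const_mul_field]
  rw [coeffAt, h, coeffAt, mul_div_assoc]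

theorem coeffAt_congr {f g : ℂ → ℂ} (h : f =ᶠ[𝓝 0] g) (n : ℕ) : coeffAt n f = coeffAt n g := by
  rw [coeffAt, coeffAt, h.iteratedDeriv_eq]

/-- All exponents in the support are congruent modulo the order of ξ, so aperiodicity makes that
order 1. Since c 0 = 0, the support contains a positive exponent, which excludes ξ = 0. -/
theorem IsAperiodic.eq_one {c : ℕ → ℂ} (h : IsAperiodic c) (h0 : c 0 = 0) {ξ ζ : ℂ} (hζ : ζ ≠ 0)
    (hc : ∀ n, c n ≠ 0 → ξ ^ n = ζ) : ξ = 1 ∧ ζ = 1 := by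
  obtain ⟨n₀, hn₀⟩ : ∃ n, c n ≠ 0 := by
    by_contra hcon
    push Not at hcon
    exact absurd (h 2 0 (by norm_num) fun n _ => hcon n) (by norm_num)
  have hn₀' : n₀ ≠ 0 := fun h1 => hn₀ (h1 ▸ h0)
  have hξ : ξ ≠ 0 := fun h1 => hζ (by rw [← hc n₀ hn₀, h1, zero_pow hn₀'])
  set u : ℂˣ := Units.mk0 ξ hξ with hu
  have hmod : ∀ n, c n ≠ 0 → n ≡ n₀ [MOD orderOf u] := fun n hn => by
    rw [← pow_eq_pow_iff_modEq, Units.ext_iff]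
    simp [hu, hc n hn, hc n₀ hn₀]
  have hord : orderOf u = 1 := by
    rcases Nat.eq_zero_or_pos (orderOf u) with h1 | h1
    -- Infinite order, encoded as 0: the support is then the single exponent n₀ and lies in one
    -- class modulo 2.
    · rw [h1] at hmod
      refine absurd (h 2 n₀ (by norm_num) fun n hn => ?_) (by norm_num)
      by_contra hcn
      exact hn (by rw [Nat.modEq_zero_iff.1 (hmod n hcn)])
    · exact h _ n₀ h1 fun n hn => by
        by_contra hcn
        exact hn (hmod n hcn)
  rw [orderOf_eq_one_iff, Units.ext_iff] at hord
  have h1 : ξ = 1 := by simpa [hu] using hord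
  exact ⟨h1, by rw [← hc n₀ hn₀, h1, one_pow]⟩

/-- Uniqueness of the analytic solution of `y = G(x, y)`. -/
theorem eventuallyEq_of_isSolution {G : ℂ × ℂ → ℂ} {R S y₀ : ℝ}
    (hG : AnalyticOnNhd ℂ G (bidisc R S)) (hR : 0 < R) (hy₀ : 0 < y₀) (hS : y₀ < S)
    (hG0 : ∀ w, ‖w‖ < S → G (0, w) = 0) {f g : ℂ → ℂ} (hf : ContinuousAt f 0) (hf0 : f 0 = 0)
    (hfe : ∀ᶠ x in 𝓝 (0 : ℂ), f x = G (x, f x)) (hg : ContinuousAt g 0) (hg0 : g 0 = 0)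
    (hge : ∀ᶠ x in 𝓝 (0 : ℂ), g x = G (x, g x)) : f =ᶠ[𝓝 0] g := by
  have hlt : ∀ {f : ℂ → ℂ}, ContinuousAt f 0 → f 0 = 0 → ∀ᶠ x in 𝓝 (0 : ℂ), ‖f x‖ < y₀ := by
    intro f hf hf0
    refine hf.norm.eventually_lt continuousAt_const ?_
    rw [hf0, norm_zero]; exact hy₀
  filter_upwards [hfe, hge, hlt hf hf0, hlt hg hg0, Metric.ball_mem_nhds (0 : ℂ) hR,
    eventually_small_zero_left hG hR hS hG0 (by norm_num : (0 : ℝ) < 1 / 2)] with x h1 h2 h3 h4 hx h5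
  have hlip : ‖G (x, f x) - G (x, g x)‖ ≤ 1 / 2 * ‖f x - g x‖ := by
    refine (convex_closedBall (0 : ℂ) y₀).norm_image_sub_le_of_norm_hasDerivWithin_le
      (f := fun w => G (x, w)) (f' := fun w => dy G (x, w)) (fun u hu => ?_) (fun u hu => ?_)
      (by simpa using h4.le) (by simpa using h3.le)
    · have hu' : ‖u‖ < S := lt_of_le_of_lt (by simpa using hu) hS
      exact (hasDerivAt_dy (p := (x, u)) (hG _ (mem_bidisc.2
        ⟨by simpa using hx, hu'⟩)).differentiableAt).hasDerivWithinAt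
    · exact (h5 u (by simpa using hu)).2.le
  rw [← h1, ← h2] at hlip
  have h6 : ‖f x - g x‖ = 0 := by linarith [norm_nonneg (f x - g x)]
  exact sub_eq_zero.1 (norm_eq_zero.1 h6)

theorem eq_ofReal_of_norm_le_of_re {z : ℂ} {r : ℝ} (h1 : ‖z‖ ≤ r) (h2 : z.re = r) : z = r := by
  have h3 := Complex.sq_norm z
  rw [Complex.normSq_apply, h2] at h3
  have h4 : ‖z‖ ^ 2 ≤ r ^ 2 := pow_le_pow_left₀ (norm_nonneg _) h1 2
  have h5 : z.im = 0 := by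
    have : z.im * z.im ≤ 0 := by nlinarith
    nlinarith [mul_self_nonneg z.im, mul_self_eq_zero.1 (le_antisymm this (mul_self_nonneg _))]
  exact Complex.ext (by simpa using h2) (by simpa using h5)

/-- Equality in the triangle inequality. -/
theorem eq_of_hasSum_of_norm_le {ι : Type*} {f : ι → ℂ} {g : ι → ℝ} {s : ℝ} (hf : HasSum f (s : ℂ))
    (hg : HasSum g s) (h : ∀ i, ‖f i‖ ≤ g i) (i : ι) : f i = g i := by
  have h1 : HasSum (fun i => g i - (f i).re) (s - s) :=
    hg.sub (by simpa using Complex.hasSum_re hf)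
  rw [sub_self, hasSum_zero_iff_of_nonneg fun i =>
    sub_nonneg.2 ((Complex.re_le_norm _).trans (h i))] at h1
  exact eq_ofReal_of_norm_le_of_re (h i) (sub_eq_zero.1 (congrFun h1 i)).symm

end Aperiodic

/-! ### Taylor's formula in the real parameter. -/

section Taylor

theorem norm_le_mul_of_hasDerivAt {g g' : ℝ → ℂ} {T B : ℝ} (h0 : g 0 = 0)
    (hd : ∀ s, |s| ≤ T → HasDerivAt g (g' s) s) (hb : ∀ s, |s| ≤ T → ‖g' s‖ ≤ B) {t : ℝ}
    (ht : |t| ≤ T) : ‖g t‖ ≤ B * |t| := by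
  have h := (convex_Icc (-T) T).norm_image_sub_le_of_norm_hasDerivWithin_le (f := g) (f' := g')
    (fun s hs => (hd s (abs_le.2 hs)).hasDerivWithinAt) (fun s hs => hb s (abs_le.2 hs))
    (x := 0) (y := t) (abs_le.1 (by simpa using (abs_nonneg t).trans ht)) (abs_le.1 ht)
  simpa [h0] using h

/-- The mean value inequality, applied three times to the bound on the third derivative; the factor
1/6 is given away. -/
theorem norm_sub_taylor_two_le {f : ℝ → ℂ} (hf : ContDiff ℝ 3 f) {C t : ℝ}
    (hC : ∀ s, |s| ≤ |t| → ‖iteratedDeriv 3 f s‖ ≤ C) :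
    ‖f t - (f 0 + t * iteratedDeriv 1 f 0 + t ^ 2 / 2 * iteratedDeriv 2 f 0)‖ ≤ C * |t| ^ 3 := by
  have hd : ∀ k : ℕ, k < 3 → ∀ s, HasDerivAt (iteratedDeriv k f) (iteratedDeriv (k + 1) f s) s :=
    fun k hk s => by
      rw [iteratedDeriv_succ]
      exact (hf.differentiable_iteratedDeriv k (by exact_mod_cast hk) s).hasDerivAt
  have hid : ∀ s : ℝ, HasDerivAt (fun s : ℝ => (s : ℂ)) 1 s := fun s =>
    Complex.ofRealCLM.hasDerivAt
  have h2 : ∀ s, |s| ≤ |t| → ‖iteratedDeriv 2 f s - iteratedDeriv 2 f 0‖ ≤ C * |t| := fun s hs => by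
    have hC0 : 0 ≤ C := (norm_nonneg _).trans (hC s hs)
    refine (norm_le_mul_of_hasDerivAt (g := fun s => iteratedDeriv 2 f s - iteratedDeriv 2 f 0)
      (by simp) (fun s _ => (hd 2 (by norm_num) s).sub_const _) hC hs).trans ?_
    gcongr
  have h1 : ∀ s, |s| ≤ |t| →
      ‖iteratedDeriv 1 f s - iteratedDeriv 1 f 0 - s * iteratedDeriv 2 f 0‖ ≤ C * |t| * |t| :=
    fun s hs => by
      have hC0 : 0 ≤ C := (norm_nonneg _).trans (hC s hs)
      refine (norm_le_mul_of_hasDerivAt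
        (g := fun s => iteratedDeriv 1 f s - iteratedDeriv 1 f 0 - s * iteratedDeriv 2 f 0)
        (by simp) (fun s _ => ((hd 1 (by norm_num) s).sub_const _).sub ((hid s).mul_const _))
        (B := C * |t|) (fun s hs => by simpa using h2 s hs) hs).trans ?_
      gcongr
  have h0 := norm_le_mul_of_hasDerivAt
        (g := fun s => f s - f 0 - s * iteratedDeriv 1 f 0 - s ^ 2 / 2 * iteratedDeriv 2 f 0)
        (g' := fun s => iteratedDeriv 1 f s - iteratedDeriv 1 f 0 - s * iteratedDeriv 2 f 0)
        (by simp) (fun s _ => by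
          have h3 := (((hd 0 (by norm_num) s).sub_const (f 0)).sub
            ((hid s).mul_const (iteratedDeriv 1 f 0))).sub
            ((((hid s).pow 2).div_const 2).mul_const (iteratedDeriv 2 f 0))
          simp only [iteratedDeriv_zero] at h3
          refine h3.congr_deriv ?_
          push_cast
          ring) (B := C * |t| * |t|) h1 le_rfl
  calc _ = ‖f t - f 0 - t * iteratedDeriv 1 f 0 - t ^ 2 / 2 * iteratedDeriv 2 f 0‖ := by
        congr 1; ring
    _ ≤ _ := h0
    _ = _ := by ring

end Taylor

end SingleEquation

namespace SingleEquation

/-! ### The equation at u = 1: positivity and dominance. -/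

section PositiveEquation

variable {a : ℕ → ℕ → Circle → ℂ} {R S x₀ y₀ : ℝ}

/-- The function `(x, y) ↦ F(x, y, u)`. -/
noncomputable def atParam (a : ℕ → ℕ → Circle → ℂ) (u : Circle) (p : ℂ × ℂ) : ℂ :=
  seriesF a p.1 p.2 u

theorem IsPositiveEquation.coeff_eq (hF : IsPositiveEquation a R S) (n m : ℕ) :
    a n m 1 = ((a n m 1).re : ℂ) := Complex.ext (by simp) (by simp [hF.coeff_real n m])

theorem IsPositiveEquation.hasSum_one (hF : IsPositiveEquation a R S) {x y : ℂ}
    (hp : (x, y) ∈ bidisc R S) :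
    HasSum (fun q : ℕ × ℕ => a q.1 q.2 1 * x ^ q.1 * y ^ q.2) (atParam a 1 (x, y)) :=
  (hF.summable _ hp).hasSum

theorem IsPositiveEquation.hasSum_ofReal (hF : IsPositiveEquation a R S) {r s : ℝ} (hr : 0 ≤ r)
    (hrR : r < R) (hs : 0 ≤ s) (hsS : s < S) :
    HasSum (fun q : ℕ × ℕ => (a q.1 q.2 1).re * r ^ q.1 * s ^ q.2) (atParam a 1 (r, s)).re ∧
      atParam a 1 (r, s) = ((atParam a 1 (r, s)).re : ℂ) := by
  have h1 := hF.hasSum_one (x := r) (y := s) (mem_bidisc.2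
    ⟨by rwa [Complex.norm_real, Real.norm_of_nonneg hr],
      by rwa [Complex.norm_real, Real.norm_of_nonneg hs]⟩)
  have e : (fun q : ℕ × ℕ => a q.1 q.2 1 * (r : ℂ) ^ q.1 * (s : ℂ) ^ q.2)
      = fun q : ℕ × ℕ => (((a q.1 q.2 1).re * r ^ q.1 * s ^ q.2 : ℝ) : ℂ) := by
    funext q
    rw [hF.coeff_eq]
    push_cast
    rfl
  rw [e] at h1
  have h2 := Complex.hasSum_re h1
  simp only [Complex.ofReal_re] at h2
  exact ⟨h2, h1.unique (Complex.hasSum_ofReal.2 h2)⟩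

theorem IsPositiveEquation.atParam_zero_left (hF : IsPositiveEquation a R S) (u : Circle) (w : ℂ)
    (hw : ‖w‖ < S) : atParam a u (0, w) = 0 := hF.zero_left w (by simpa using hw) u

theorem IsPositiveEquation.analyticOnNhd_atParam (hF : IsPositiveEquation a R S) (t : ℝ) :
    AnalyticOnNhd ℂ (atParam a (Circle.exp t)) (bidisc R S) := by
  have h := hF.analytic_tDeriv 0 (by norm_num) t
  simp only [tDeriv, iteratedDeriv_zero] at h
  exact h

theorem IsPositiveEquation.analyticOnNhd_atParam_one (hF : IsPositiveEquation a R S) :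
    AnalyticOnNhd ℂ (atParam a 1) (bidisc R S) := by
  simpa using hF.analyticOnNhd_atParam 0

theorem IsPositiveEquation.hasNonnegCoeff_fst (hF : IsPositiveEquation a R S) (hy : 0 ≤ y₀)
    (hyS : y₀ < S) : HasNonnegCoeff (fun x => atParam a 1 (x, y₀)) R := by
  refine ⟨fun n => ∑' m, (a n m 1).re * y₀ ^ m, fun n => tsum_nonneg fun m =>
    mul_nonneg (hF.coeff_nonneg n m) (by positivity), fun x hx => ?_⟩
  have h1 := hF.hasSum_one (x := x) (y := y₀) (mem_bidisc.2
    ⟨hx, by rwa [Complex.norm_real, Real.norm_of_nonneg hy]⟩)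
  have h2 := h1.prod_fiberwise fun n => (h1.summable.prod_factor n).hasSum
  have e : (fun n => ∑' m, a n m 1 * x ^ n * (y₀ : ℂ) ^ m)
      = fun n => ((∑' m, (a n m 1).re * y₀ ^ m : ℝ) : ℂ) * x ^ n := by
    funext n
    rw [Complex.ofReal_tsum, ← tsum_mul_right]
    refine tsum_congr fun m => ?_
    rw [hF.coeff_eq]
    push_cast
    simp only [Complex.ofReal_re]
    ring
  rw [← e]
  exact h2

theorem IsPositiveEquation.hasNonnegCoeff_snd (hF : IsPositiveEquation a R S) (hx : 0 ≤ x₀)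
    (hxR : x₀ < R) : HasNonnegCoeff (fun y => atParam a 1 (x₀, y)) S := by
  refine ⟨fun m => ∑' n, (a n m 1).re * x₀ ^ n, fun m => tsum_nonneg fun n =>
    mul_nonneg (hF.coeff_nonneg n m) (by positivity), fun y hy => ?_⟩
  have h1 := (Equiv.prodComm ℕ ℕ).hasSum_iff.2 (hF.hasSum_one (x := x₀) (y := y) (mem_bidisc.2
    ⟨by rwa [Complex.norm_real, Real.norm_of_nonneg hx], hy⟩))
  have h2 := h1.prod_fiberwise fun n => (h1.summable.prod_factor n).hasSum
  have e : (fun m => ∑' n, a n m 1 * (x₀ : ℂ) ^ n * y ^ m)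
      = fun m => ((∑' n, (a n m 1).re * x₀ ^ n : ℝ) : ℂ) * y ^ m := by
    funext m
    rw [Complex.ofReal_tsum, ← tsum_mul_right]
    refine tsum_congr fun n => ?_
    rw [hF.coeff_eq]
    push_cast
    simp only [Complex.ofReal_re]
  rw [← e]
  exact h2

/-- At x₀ = 0 the identity F(0, ·) ≡ 0 would make F_y vanish instead of being 1. -/
theorem IsPositiveEquation.x_pos (hF : IsPositiveEquation a R S)
    (hchar : IsCharacteristicPoint (seriesF a) x₀ y₀) (hy₀ : y₀ < S) : 0 < x₀ := by
  refine lt_of_le_of_ne hchar.x_nonneg fun h => ?_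
  have h1 := hchar.eq_deriv
  rw [← h] at h1
  have h2 := dy_zero_left (G := atParam a 1) (fun w hw => hF.atParam_zero_left 1 w hw) (w := y₀)
    (by rwa [Complex.norm_real, Real.norm_of_nonneg hchar.y_nonneg])
  have h3 : Dy (seriesF a) ((0 : ℝ) : ℂ) y₀ 1 = dy (atParam a 1) (0, (y₀ : ℂ)) := by
    rw [Complex.ofReal_zero]; rfl
  rw [h3, h2] at h1
  exact one_ne_zero h1

/-- As F(x, 0, u) ≢ 0, some F_{n,0}(1) is positive, and y₀ = F(x₀, y₀, 1) is at least the single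
term F_{n,0}(1)x₀ⁿ. -/
theorem IsPositiveEquation.y_pos (hF : IsPositiveEquation a R S)
    (hchar : IsCharacteristicPoint (seriesF a) x₀ y₀) (hx₀ : x₀ < R) (hy₀ : y₀ < S) : 0 < y₀ := by
  obtain ⟨x, hx, u, hu⟩ := hF.not_zero_right
  obtain ⟨q, hq⟩ : ∃ q : ℕ × ℕ, a q.1 q.2 u * x ^ q.1 * 0 ^ q.2 ≠ 0 := by
    by_contra hcon
    push Not at hcon
    exact hu (by rw [seriesF, tsum_congr hcon, tsum_zero])
  have hq2 : q.2 = 0 := by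
    by_contra h
    exact hq (by rw [zero_pow h, mul_zero])
  have hqa : a q.1 q.2 u ≠ 0 := fun h => hq (by rw [h, zero_mul, zero_mul])
  have hqre : 0 < (a q.1 q.2 1).re := (norm_pos_iff.2 hqa).trans_le (hF.norm_le _ _ _)
  have hx := hF.x_pos hchar hy₀
  have h1 := (hF.hasSum_ofReal hx.le hx₀ hchar.y_nonneg hy₀).1
  have h2 : (atParam a 1 (x₀, y₀)).re = y₀ := by
    have := hchar.eq
    rw [show atParam a 1 (x₀, y₀) = seriesF a x₀ y₀ 1 from rfl, ← this, Complex.ofReal_re]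
  rw [h2] at h1
  have h3 := le_hasSum h1 q fun r _ => mul_nonneg (mul_nonneg (hF.coeff_nonneg _ _)
    (pow_nonneg hx.le _)) (pow_nonneg hchar.y_nonneg _)
  refine lt_of_lt_of_le ?_ h3
  rw [hq2, pow_zero, mul_one, ← hq2]
  positivity

theorem IsPositiveEquation.exists_dx_eq (hF : IsPositiveEquation a R S)
    (hchar : IsCharacteristicPoint (seriesF a) x₀ y₀) (hx₀ : x₀ < R) (hy₀ : y₀ < S) :
    ∃ v : ℝ, 0 < v ∧ dx (atParam a 1) (x₀, y₀) = v := by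
  obtain ⟨v, hv, hv'⟩ := (hF.hasNonnegCoeff_fst hchar.y_nonneg hy₀).deriv.nonneg hchar.x_nonneg hx₀
  refine ⟨v, lt_of_le_of_ne hv fun h => hchar.Dx_ne_zero ?_, hv'⟩
  rw [← h, Complex.ofReal_zero] at hv'
  exact hv'

theorem IsPositiveEquation.exists_dyy_eq (hF : IsPositiveEquation a R S)
    (hchar : IsCharacteristicPoint (seriesF a) x₀ y₀) (hx₀ : x₀ < R) (hy₀ : y₀ < S) :
    ∃ v : ℝ, 0 < v ∧ dy (dy (atParam a 1)) (x₀, y₀) = v := by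
  obtain ⟨v, hv, hv'⟩ :=
    (hF.hasNonnegCoeff_snd hchar.x_nonneg hx₀).deriv.deriv.nonneg hchar.y_nonneg hy₀
  refine ⟨v, lt_of_le_of_ne hv fun h => hchar.Dyy_ne_zero ?_, hv'⟩
  rw [← h, Complex.ofReal_zero] at hv'
  exact hv'

/-- At another solution (x, w), equality in the triangle inequality aligns all terms of the series,
so F(ξX, ζY) = ζF(X, Y) with ξ = x/x₀ and ζ = w/y₀. Then ζ⁻¹y(ξx) solves the same equation as y(x),
and uniqueness forces ξⁿ = ζ whenever yₙ ≠ 0; aperiodicity concludes. -/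
theorem IsPositiveEquation.isDominantPoint (hF : IsPositiveEquation a R S)
    (hchar : IsCharacteristicPoint (seriesF a) x₀ y₀) (hx₀ : x₀ < R) (hy₀ : y₀ < S)
    {y : ℂ → Circle → ℂ} (hy : IsSolution (seriesF a) y)
    (haper : IsAperiodic fun n => coeffAt n fun x => y x 1) :
    IsDominantPoint (atParam a 1) R S x₀ y₀ := by
  have hxpos := hF.x_pos hchar hy₀
  have hypos := hF.y_pos hchar hx₀ hy₀
  refine ⟨hF.analyticOnNhd_atParam_one, hxpos, hx₀, hypos, hy₀, hchar.eq.symm, hchar.Dx_ne_zero, ?_⟩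
  intro x w hx hw hxw
  set ζ : ℂ := w / y₀ with hζ
  set ξ : ℂ := x / x₀ with hξ
  have hx₀c : (x₀ : ℂ) ≠ 0 := Complex.ofReal_ne_zero.2 hxpos.ne'
  have hy₀c : (y₀ : ℂ) ≠ 0 := Complex.ofReal_ne_zero.2 hypos.ne'
  have hζn : ‖ζ‖ = 1 := by
    rw [hζ, norm_div, hw, Complex.norm_real, Real.norm_of_nonneg hypos.le, div_self hypos.ne']
  have hζ0 : ζ ≠ 0 := norm_pos_iff.1 (by rw [hζn]; exact one_pos)
  have hxe : x = ξ * x₀ := by rw [hξ]; field_simp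
  have hwe : w = ζ * y₀ := by rw [hζ]; field_simp
  -- Divided by ζ, the series at (x, w) sums to y₀, which is also the sum of its termwise majorants;
  -- hence each term equals its majorant. Only |ξ| ≤ 1 is used.
  have hterm : ∀ q : ℕ × ℕ, a q.1 q.2 1 * (ξ ^ q.1 * ζ ^ q.2) = a q.1 q.2 1 * ζ := by
    have h1 := (hF.hasSum_one (x := x) (y := w) (mem_bidisc.2 ⟨hx.trans_lt hx₀, hw ▸ hy₀⟩)).mul_left ζ⁻¹
    have e1 : ζ⁻¹ * atParam a 1 (x, w) = (y₀ : ℂ) := by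
      rw [hxw, hwe]; field_simp
    rw [e1] at h1
    have h2 := (hF.hasSum_ofReal hxpos.le hx₀ hypos.le hy₀).1
    have e2 : (atParam a 1 (x₀, y₀)).re = y₀ := by
      have := hchar.eq
      rw [show atParam a 1 (x₀, y₀) = seriesF a x₀ y₀ 1 from rfl, ← this, Complex.ofReal_re]
    rw [e2] at h2
    intro q
    have h3 := eq_of_hasSum_of_norm_le h1 h2 (fun q => by
      rw [norm_mul, norm_inv, hζn, inv_one, one_mul, norm_mul, norm_mul, norm_pow, norm_pow, hw]
      refine mul_le_mul_of_nonneg_right (mul_le_mul (hF.norm_le _ _ _) ?_ (by positivity)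
        (hF.coeff_nonneg _ _)) (by positivity)
      exact pow_le_pow_left₀ (norm_nonneg _) hx _) q
    have hx₀q : (x₀ : ℂ) ^ q.1 ≠ 0 := pow_ne_zero _ hx₀c
    have hy₀q : (y₀ : ℂ) ^ q.2 ≠ 0 := pow_ne_zero _ hy₀c
    push_cast at h3
    rw [← hF.coeff_eq, hxe, hwe, mul_pow, mul_pow, inv_mul_eq_iff_eq_mul₀ hζ0] at h3
    have h4 : (a q.1 q.2 1 * (ξ ^ q.1 * ζ ^ q.2)) * ((x₀ : ℂ) ^ q.1 * (y₀ : ℂ) ^ q.2)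
        = (a q.1 q.2 1 * ζ) * ((x₀ : ℂ) ^ q.1 * (y₀ : ℂ) ^ q.2) := by linear_combination h3
    exact mul_right_cancel₀ (mul_ne_zero hx₀q hy₀q) h4
  have hhom : ∀ X Y : ℂ, atParam a 1 (ξ * X, ζ * Y) = ζ * atParam a 1 (X, Y) := fun X Y => by
    simp only [atParam, seriesF]
    rw [← tsum_mul_left]
    refine tsum_congr fun q => ?_
    rw [mul_pow, mul_pow]
    linear_combination X ^ q.1 * Y ^ q.2 * hterm q
  have hy1 := hy.analyticAt 1
  have hlin : Tendsto (fun x : ℂ => ξ * x) (𝓝 0) (𝓝 0) := by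
    have : Continuous fun x : ℂ => ξ * x := by fun_prop
    simpa using this.tendsto 0
  have hcy : ContinuousAt (fun x => ζ⁻¹ * y (ξ * x) 1) 0 := by
    have h1 : ContinuousAt (fun x => y (ξ * x) 1) 0 :=
      ContinuousAt.comp (g := fun x => y x 1) (f := fun x => ξ * x)
        (by simpa using hy1.continuousAt) (by fun_prop)
    exact continuousAt_const.mul h1
  have huniq := eventuallyEq_of_isSolution (f := fun x => y x 1) (g := fun x => ζ⁻¹ * y (ξ * x) 1)
    hF.analyticOnNhd_atParam_one (hxpos.trans hx₀) hypos hy₀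
    (fun w hw => hF.atParam_zero_left 1 w hw) hy1.continuousAt (hy.map_zero 1) (hy.eq 1)
    hcy (by simp [hy.map_zero 1]) (by
      filter_upwards [hlin.eventually (hy.eq 1)] with x hx
      have h1 : atParam a 1 (ξ * x, ζ * (ζ⁻¹ * y (ξ * x) 1)) = y (ξ * x) 1 := by
        rw [mul_inv_cancel_left₀ hζ0]
        exact hx.symm
      rw [hhom] at h1
      change ζ⁻¹ * y (ξ * x) 1 = atParam a 1 (x, ζ⁻¹ * y (ξ * x) 1)
      rw [inv_mul_eq_iff_eq_mul₀ hζ0, h1])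
  have hco : ∀ n, coeffAt n (fun x => y x 1) ≠ 0 → ξ ^ n = ζ := fun n hn => by
    have h1 := coeffAt_congr huniq n
    rw [coeffAt_const_mul, coeffAt_comp_mul_left (fun x => y x 1)] at h1
    have h2 : ζ * coeffAt n (fun x => y x 1) = ξ ^ n * coeffAt n (fun x => y x 1) := by
      conv_lhs => rw [h1]
      rw [mul_inv_cancel_left₀ hζ0]
    exact (mul_right_cancel₀ hn h2).symm
  obtain ⟨h1, h2⟩ := haper.eq_one (by simp [coeffAt, hy.map_zero 1]) hζ0 hco
  exact ⟨by rw [hxe, h1, one_mul], by rw [hwe, h2, one_mul]⟩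

end PositiveEquation

end SingleEquation

namespace SingleEquation

/-! ### Differentiation under the integral sign. -/

section ParametricIntegral

/-- A bounded integrand that depends holomorphically on a parameter can be differentiated under the
integral sign. -/
theorem hasDerivAt_intervalIntegral_of_bounded {K : ℝ → ℂ → ℂ} {a b d M : ℝ}
    (hc : ∀ s ∈ Metric.ball (0 : ℂ) d, ContinuousOn (fun β => K β s) (Set.uIcc a b))
    (hb : ∀ β ∈ Set.uIcc a b, ∀ s ∈ Metric.ball (0 : ℂ) d, ‖K β s‖ ≤ M)
    (hd : ∀ β ∈ Set.uIcc a b, DifferentiableOn ℂ (K β) (Metric.ball 0 d)) {s : ℂ}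
    (hs : s ∈ Metric.ball (0 : ℂ) d) :
    HasDerivAt (fun s => ∫ β in a..b, K β s) (∫ β in a..b, deriv (K β) s) s := by
  obtain ⟨e, he, hball⟩ := Metric.isOpen_iff.1 Metric.isOpen_ball s hs
  have hsub : ∀ z ∈ Metric.ball s (e / 2), Metric.closedBall z (e / 4) ⊆ Metric.ball (0 : ℂ) d :=
    fun z hz u hu => hball (by
      rw [Metric.mem_ball] at hz ⊢
      rw [Metric.mem_closedBall] at hu
      linarith [dist_triangle u z s])
  have hderiv : ∀ β ∈ Set.uIcc a b, ∀ z ∈ Metric.ball (0 : ℂ) d, HasDerivAt (K β) (deriv (K β) z) z :=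
    fun β hβ z hz => ((hd β hβ).differentiableAt (Metric.isOpen_ball.mem_nhds hz)).hasDerivAt
  have hmem : ∀ z ∈ Metric.ball s (e / 2), z ∈ Metric.ball (0 : ℂ) d := fun z hz =>
    hsub z hz (Metric.mem_closedBall_self (by positivity))
  have hmeas : ∀ z ∈ Metric.ball (0 : ℂ) d,
      AEStronglyMeasurable (fun β => K β z) (volume.restrict (Set.uIoc a b)) := fun z hz =>
    ((hc z hz).mono Set.uIoc_subset_uIcc).aestronglyMeasurable measurableSet_uIoc
  refine (intervalIntegral.hasDerivAt_integral_of_dominated_loc_of_deriv_le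
    (F := fun s β => K β s) (F' := fun s β => deriv (K β) s) (bound := fun _ => M / (e / 4))
    (Metric.ball_mem_nhds s (half_pos he)) ?_ ?_ ?_ ?_ ?_ ?_).2
  · filter_upwards [Metric.isOpen_ball.mem_nhds hs] with z hz
    exact hmeas z hz
  · exact (hc s hs).intervalIntegrable
  -- The s-derivative is measurable in β as the pointwise limit of difference quotients along a
  -- sequence.
  · set σ : ℕ → ℂ := fun k => ((e / 2 / (k + 1) / 2 : ℝ) : ℂ) with hσ
    have hσpos : ∀ k : ℕ, 0 < e / 2 / (k + 1) / 2 := fun k => by positivity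
    have hσn : ∀ k, s + σ k ∈ Metric.ball s (e / 2) := fun k => by
      rw [Metric.mem_ball, dist_eq_norm, add_sub_cancel_left, Complex.norm_real,
        Real.norm_of_nonneg (hσpos k).le]
      have : e / 2 / ((k : ℝ) + 1) ≤ e / 2 := div_le_self (by positivity) (by linarith [k.cast_nonneg (α := ℝ)])
      linarith
    have hσ0 : Tendsto σ atTop (𝓝[≠] 0) := by
      refine tendsto_nhdsWithin_iff.2 ⟨?_, Eventually.of_forall fun k => ?_⟩
      · have h1 : Tendsto (fun k : ℕ => e / 2 / ((k : ℝ) + 1) / 2) atTop (𝓝 (0 / 2)) :=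
          ((tendsto_const_nhds (x := e / 2)).div_atTop
            (tendsto_natCast_atTop_atTop.atTop_add tendsto_const_nhds)).div_const 2
        rw [zero_div] at h1
        have := (Complex.continuous_ofReal.tendsto 0).comp h1
        rw [Complex.ofReal_zero] at this
        exact this
      · exact Complex.ofReal_ne_zero.2 (hσpos k).ne'
    refine aestronglyMeasurable_of_tendsto_ae atTop
      (f := fun k β => (σ k)⁻¹ • (K β (s + σ k) - K β s)) (fun k => ?_) ?_
    · have h1 : AEStronglyMeasurable (fun β => K β (s + σ k) - K β s)
          (volume.restrict (Set.uIoc a b)) := (hmeas _ (hmem _ (hσn k))).sub (hmeas s hs)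
      exact h1.const_smul (σ k)⁻¹
    · filter_upwards [ae_restrict_mem measurableSet_uIoc] with β hβ
      exact (hasDerivAt_iff_tendsto_slope_zero.1
        (hderiv β (Set.uIoc_subset_uIcc hβ) s hs)).comp hσ0
  -- Cauchy's estimate on discs of radius e/4 turns the bound on K into one on its derivative.
  · refine Eventually.of_forall fun β hβ z hz => ?_
    refine Complex.norm_deriv_le_of_forall_mem_sphere_norm_le (by positivity) ?_ fun u hu =>
      hb β (Set.uIoc_subset_uIcc hβ) u (hsub z hz (Metric.sphere_subset_closedBall hu))
    refine DifferentiableOn.diffContOnCl ((hd β (Set.uIoc_subset_uIcc hβ)).mono ?_)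
    rw [closure_ball z (by positivity)]
    exact hsub z hz
  · exact intervalIntegrable_const
  · exact Eventually.of_forall fun β hβ z hz => hderiv β (Set.uIoc_subset_uIcc hβ) z (hmem z hz)

theorem differentiableOn_intervalIntegral_of_bounded {K : ℝ → ℂ → ℂ} {a b d M : ℝ}
    (hc : ∀ s ∈ Metric.ball (0 : ℂ) d, ContinuousOn (fun β => K β s) (Set.uIcc a b))
    (hb : ∀ β ∈ Set.uIcc a b, ∀ s ∈ Metric.ball (0 : ℂ) d, ‖K β s‖ ≤ M)
    (hd : ∀ β ∈ Set.uIcc a b, DifferentiableOn ℂ (K β) (Metric.ball 0 d)) :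
    DifferentiableOn ℂ (fun s => ∫ β in a..b, K β s) (Metric.ball 0 d) := fun _ hs =>
  (hasDerivAt_intervalIntegral_of_bounded hc hb hd hs).differentiableAt.differentiableWithinAt

end ParametricIntegral

/-! ### Dependence of the double integral on G. -/

section DoubleCoeff

variable {F G G' : ℂ × ℂ → ℂ} {R S x₀ y₀ ε δ₀ η₀ κ : ℝ}

theorem HasRootFunction.sub_ne_zero (hrf : HasRootFunction F R S x₀ y₀ ε δ₀ η₀ κ)
    (hG : IsNear F G R S η₀) {x w : ℂ} (hx : ‖x‖ ≤ x₀ - ε) (hw : ‖w‖ = y₀) : w - G (x, w) ≠ 0 := by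
  obtain ⟨c, hc, h⟩ := hrf.zero_free
  exact norm_pos_iff.1 (hc.trans_le (h G hG x w hx hw))

theorem HasRootFunction.continuous_innerCoeff (hrf : HasRootFunction F R S x₀ y₀ ε δ₀ η₀ κ)
    (hF : IsDominantPoint F R S x₀ y₀) (hG : IsNear F G R S η₀) {r : ℝ} (hr : 0 < r)
    (hrε : r < x₀ - ε) (n : ℕ) : Continuous fun β : ℝ => innerCoeff G n r (circleMap 0 y₀ β) :=
  SingleEquation.continuous_innerCoeff hG.analytic hF.y_pos.le hF.y_lt hr
    (by linarith [hrf.ε_pos, hF.x_lt])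
    (fun x w hx hw => hrf.sub_ne_zero hG (by linarith) hw) n

theorem norm_circleMap_zero {y : ℝ} (hy : 0 ≤ y) (β : ℝ) : ‖circleMap 0 y β‖ = y := by
  simp [abs_of_nonneg hy]

/-- Both contours are fixed, and `zero_free` bounds the denominator below on them, so holomorphy in
s passes from the kernel through both integrals. -/
theorem differentiableOn_doubleCoeff (hrf : HasRootFunction F R S x₀ y₀ ε δ₀ η₀ κ)
    (hF : IsDominantPoint F R S x₀ y₀) {T : ℂ → ℂ × ℂ → ℂ} {d : ℝ}
    (hT : ∀ s ∈ Metric.ball (0 : ℂ) d, IsNear F (T s) R S η₀)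
    (hd : ∀ p ∈ bidisc R S, DifferentiableOn ℂ (fun s => T s p) (Metric.ball 0 d))
    (hdx : ∀ p ∈ bidisc R S, DifferentiableOn ℂ (fun s => dx (T s) p) (Metric.ball 0 d))
    {r : ℝ} (hr : 0 < r) (hrε : r < x₀ - ε) (n : ℕ) :
    DifferentiableOn ℂ (fun s => doubleCoeff (T s) y₀ n r) (Metric.ball 0 d) := by
  have hrR : r < R := by linarith [hrf.ε_pos, hF.x_lt]
  have hy := hF.y_pos
  obtain ⟨c, hc, hzf⟩ := hrf.zero_free
  obtain ⟨M, hM, hdxM⟩ := IsNear.exists_norm_dx_le hF.analytic hF.y_lt hrR η₀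
  have hkern : ∀ s ∈ Metric.ball (0 : ℂ) d, ∀ x w : ℂ, ‖x‖ = r → ‖w‖ = y₀ →
      ‖kern (T s) x w‖ ≤ M / c := fun s hs x w hx hw =>
    norm_kern_le (hdxM _ (hT s hs) x w hx.le hw.le) hc (hzf _ (hT s hs) x w (by linarith) hw)
  have hinner : ∀ β : ℝ, DifferentiableOn ℂ (fun s => innerCoeff (T s) n r (circleMap 0 y₀ β))
      (Metric.ball 0 d) := by
    intro β
    set w := circleMap 0 y₀ β with hw
    have hwn : ‖w‖ = y₀ := norm_circleMap_zero hy.le β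
    simp only [innerCoeff, circleIntegral, deriv_circleMap, smul_eq_mul]
    refine DifferentiableOn.const_mul ?_ _
    refine differentiableOn_intervalIntegral_of_bounded (M := r * ((r ^ n)⁻¹ * (M / c))) ?_ ?_ ?_
    · intro s hs
      have hk := continuousOn_kern (A := Metric.sphere 0 r ×ˢ {w}) (hT s hs).analytic (by
        rintro ⟨x, w'⟩ ⟨hx, rfl⟩
        exact mem_bidisc.2 ⟨by rwa [show ‖x‖ = r by simpa using hx], hwn ▸ hF.y_lt⟩) (by
        rintro ⟨x, w'⟩ ⟨hx, rfl⟩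
        exact hrf.sub_ne_zero (hT s hs) (by rw [show ‖x‖ = r by simpa using hx]; exact hrε.le) hwn)
      have hk' : Continuous fun θ : ℝ => kern (T s) (circleMap 0 r θ) w :=
        hk.comp_continuous (f := fun θ : ℝ => (circleMap 0 r θ, w)) (by fun_prop)
          fun θ => ⟨circleMap_mem_sphere _ hr.le _, rfl⟩
      have hp : Continuous fun θ : ℝ => (circleMap 0 r θ ^ n)⁻¹ :=
        Continuous.inv₀ (by fun_prop) fun q => pow_ne_zero n (circleMap_ne_center hr.ne')
      have hd : Continuous fun θ : ℝ => circleMap 0 r θ * Complex.I := by fun_prop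
      exact (hd.mul (hp.mul hk')).continuousOn
    · intro θ _ s hs
      have hxn := norm_circleMap_zero hr.le θ
      rw [norm_mul, norm_mul, norm_mul, norm_inv, norm_pow, hxn, Complex.norm_I, mul_one]
      gcongr
      exact hkern s hs _ _ hxn hwn
    · intro θ _
      have hxn := norm_circleMap_zero hr.le θ
      have hm : (circleMap 0 r θ, w) ∈ bidisc R S := mem_bidisc.2
        ⟨by rwa [hxn], by rw [hwn]; exact hF.y_lt⟩
      refine DifferentiableOn.const_mul (DifferentiableOn.const_mul ?_ _) _
      exact (hdx _ hm).div ((differentiableOn_const w).sub (hd _ hm)) fun s hs =>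
        hrf.sub_ne_zero (hT s hs) (by linarith) hwn
  simp only [doubleCoeff_eq_integral]
  refine DifferentiableOn.const_mul ?_ _
  refine differentiableOn_intervalIntegral_of_bounded
    (M := y₀ * (r * (M / c) * (r⁻¹) ^ n)) ?_ ?_ fun β _ => (hinner β).const_mul _
  · intro s hs
    exact ((continuous_circleMap 0 y₀).mul
      (hrf.continuous_innerCoeff hF (hT s hs) hr hrε n)).continuousOn
  · intro β _ s hs
    have hwn := norm_circleMap_zero hy.le β
    rw [norm_mul, hwn]
    exact mul_le_mul_of_nonneg_left (norm_innerCoeff_le hr (fun x hx => hkern s hs x _ hx hwn) n) hy.le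

/-- The constant may depend on n, since the estimate only serves to identify Taylor polynomials at
fixed n. -/
theorem exists_norm_doubleCoeff_sub_le (hrf : HasRootFunction F R S x₀ y₀ ε δ₀ η₀ κ)
    (hF : IsDominantPoint F R S x₀ y₀) {r : ℝ} (hr : 0 < r) (hrε : r < x₀ - ε) (n : ℕ) :
    ∃ C, ∀ G G', IsNear F G R S η₀ → IsNear F G' R S η₀ → ∀ η,
      (∀ p ∈ bidisc R S, ‖G p - G' p‖ ≤ η) →
      ‖doubleCoeff G y₀ n r - doubleCoeff G' y₀ n r‖ ≤ C * η := by
  have hrR : r < R := by linarith [hrf.ε_pos, hF.x_lt]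
  have hRr : 0 < R - r := by linarith
  have hy := hF.y_pos
  obtain ⟨c, hc, hzf⟩ := hrf.zero_free
  obtain ⟨M, hM, hdxM⟩ := IsNear.exists_norm_dx_le hF.analytic hF.y_lt hrR η₀
  set D := 1 / (R - r) / c + M / c ^ 2 with hD
  refine ⟨y₀ * (r * ((r⁻¹) ^ n * D)), fun G G' hG hG' η hη => ?_⟩
  have hη0 : 0 ≤ η := (norm_nonneg _).trans (hη (x₀, y₀) (mem_bidisc.2
    ⟨by rw [Complex.norm_real, Real.norm_of_nonneg hF.x_pos.le]; exact hF.x_lt,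
      by rw [Complex.norm_real, Real.norm_of_nonneg hy.le]; exact hF.y_lt⟩))
  have hkern : ∀ x w : ℂ, ‖x‖ = r → ‖w‖ = y₀ → ‖kern G x w - kern G' x w‖ ≤ D * η := by
    intro x w hx hw
    have hm : (x, w) ∈ bidisc R S := mem_bidisc.2 ⟨hx ▸ hrR, hw ▸ hF.y_lt⟩
    have h1 := hzf G hG x w (by linarith) hw
    have h2 := hzf G' hG' x w (by linarith) hw
    have h1' : w - G (x, w) ≠ 0 := norm_pos_iff.1 (hc.trans_le h1)
    have h2' : w - G' (x, w) ≠ 0 := norm_pos_iff.1 (hc.trans_le h2)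
    have h3 : ‖dx G (x, w) - dx G' (x, w)‖ ≤ η / (R - r) :=
      IsNear.norm_dx_sub_le ⟨hG.analytic, hη⟩ hG'.analytic hrR hx.le (hw ▸ hF.y_lt)
    have e : kern G x w - kern G' x w = (dx G (x, w) - dx G' (x, w)) / (w - G (x, w))
        + dx G' (x, w) * (G (x, w) - G' (x, w)) / ((w - G (x, w)) * (w - G' (x, w))) := by
      rw [kern, kern]; field_simp; ring
    rw [e]
    refine (norm_add_le _ _).trans ?_
    rw [norm_div, norm_div, norm_mul, norm_mul]
    calc _ ≤ η / (R - r) / c + M * η / (c * c) := by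
          refine add_le_add (div_le_div₀ (by positivity) h3 hc h1)
            (div_le_div₀ (by positivity) (mul_le_mul (hdxM G' hG' x w hx.le hw.le) (hη _ hm)
              (norm_nonneg _) hM.le) (by positivity) (mul_le_mul h1 h2 hc.le (norm_nonneg _)))
      _ = D * η := by rw [hD]; field_simp
  have hcirc : ∀ {G}, IsNear F G R S η₀ → ∀ β : ℝ, CircleIntegrable
      (fun x => (x ^ n)⁻¹ * kern G x (circleMap 0 y₀ β)) 0 r := by
    intro G hG β
    refine ContinuousOn.circleIntegrable hr.le fun x hx => ?_
    have hx' : ‖x‖ = r := by simpa using hx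
    refine ContinuousAt.continuousWithinAt (ContinuousAt.mul ?_ ?_)
    · exact (continuousAt_id.pow n).inv₀ (pow_ne_zero n (norm_pos_iff.1 (hx' ▸ hr)))
    · exact (differentiableAt_kern hG.analytic (hx' ▸ hrR)
        (by rw [norm_circleMap_zero hy.le]; exact hF.y_lt)
        (hrf.sub_ne_zero hG (by linarith) (norm_circleMap_zero hy.le β))).continuousAt
  have hin : ∀ β : ℝ, ‖innerCoeff G n r (circleMap 0 y₀ β) - innerCoeff G' n r (circleMap 0 y₀ β)‖
      ≤ r * ((r⁻¹) ^ n * (D * η)) := by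
    intro β
    rw [innerCoeff, innerCoeff, ← mul_sub, ← circleIntegral.integral_sub (hcirc hG β) (hcirc hG' β)]
    refine circleIntegral.norm_two_pi_i_inv_smul_integral_le_of_norm_le_const hr.le fun x hx => ?_
    have hx' : ‖x‖ = r := by simpa using hx
    rw [← mul_sub, norm_mul, norm_inv, norm_pow, hx', inv_pow]
    exact mul_le_mul_of_nonneg_left (hkern x _ hx' (norm_circleMap_zero hy.le β)) (by positivity)
  have hi : ∀ {G}, IsNear F G R S η₀ → IntervalIntegrable
      (fun β => circleMap 0 y₀ β * innerCoeff G n r (circleMap 0 y₀ β)) volume (-Real.pi) Real.pi :=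
    fun hG => ((continuous_circleMap 0 y₀).mul
      (hrf.continuous_innerCoeff hF hG hr hrε n)).intervalIntegrable _ _
  rw [doubleCoeff_eq_integral, doubleCoeff_eq_integral, ← mul_sub,
    ← intervalIntegral.integral_sub (hi hG) (hi hG'), norm_mul]
  have h := intervalIntegral.norm_integral_le_of_norm_le_const (a := -Real.pi) (b := Real.pi)
    (C := y₀ * (r * ((r⁻¹) ^ n * (D * η))))
    (f := fun β => circleMap 0 y₀ β * innerCoeff G n r (circleMap 0 y₀ β)
      - circleMap 0 y₀ β * innerCoeff G' n r (circleMap 0 y₀ β)) fun β _ => by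
      rw [← mul_sub, norm_mul, norm_circleMap_zero hy.le]
      exact mul_le_mul_of_nonneg_left (hin β) hy.le
  have hpi := Real.pi_pos
  rw [show |Real.pi - -Real.pi| = 2 * Real.pi by rw [abs_of_nonneg] <;> linarith] at h
  have hnpi : ‖(2 * Real.pi : ℂ)⁻¹‖ = (2 * Real.pi)⁻¹ := by
    rw [norm_inv, norm_mul, Complex.norm_real, Real.norm_of_nonneg Real.pi_pos.le]; simp
  rw [hnpi]
  calc _ ≤ _ := mul_le_mul_of_nonneg_left h (by positivity)
    _ = _ := by field_simp

end DoubleCoeff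

end SingleEquation

namespace SingleEquation

/-! ### The analytic root, its logarithm, and their derivatives. -/

section Exponent

variable {F F₁ F₂ : ℂ × ℂ → ℂ} {R S x₀ y₀ : ℝ}

/-- The quadratic Taylor polynomial `F + s F₁ + s² F₂ / 2`. -/
noncomputable def taylorPoly (F F₁ F₂ : ℂ × ℂ → ℂ) (s : ℂ) (p : ℂ × ℂ) : ℂ :=
  F p + s * F₁ p + s ^ 2 / 2 * F₂ p

theorem taylorPoly_zero (F F₁ F₂ : ℂ × ℂ → ℂ) : taylorPoly F F₁ F₂ 0 = F := by
  funext p; simp [taylorPoly]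

theorem analyticOnNhd_taylorPoly {U : Set (ℂ × ℂ)} (hF : AnalyticOnNhd ℂ F U)
    (h₁ : AnalyticOnNhd ℂ F₁ U) (h₂ : AnalyticOnNhd ℂ F₂ U) (s : ℂ) :
    AnalyticOnNhd ℂ (taylorPoly F F₁ F₂ s) U :=
  (hF.add (analyticOnNhd_const.mul h₁)).add (analyticOnNhd_const.mul h₂)

theorem dx_taylorPoly {p : ℂ × ℂ} (hF : AnalyticAt ℂ F p) (h₁ : AnalyticAt ℂ F₁ p)
    (h₂ : AnalyticAt ℂ F₂ p) (s : ℂ) :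
    dx (taylorPoly F F₁ F₂ s) p = taylorPoly (dx F) (dx F₁) (dx F₂) s p :=
  (((hasDerivAt_dx hF.differentiableAt).add ((hasDerivAt_dx h₁.differentiableAt).const_mul s)).add
    ((hasDerivAt_dx h₂.differentiableAt).const_mul (s ^ 2 / 2))).deriv

theorem dx_dy_comm {G : ℂ × ℂ → ℂ} {p : ℂ × ℂ} (h : AnalyticAt ℂ G p) :
    dx (dy G) p = dy (dx G) p := by
  have hsymm : IsSymmSndFDerivAt ℂ G p := (h.contDiffAt (n := ⊤)).isSymmSndFDerivAt (by simp)
  have hd : DifferentiableAt ℂ (fderiv ℂ G) p := h.fderiv.differentiableAt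
  have e1 : dy G =ᶠ[𝓝 p] fun q => fderiv ℂ G q (0, 1) := by
    filter_upwards [h.eventually_analyticAt] with q hq
    exact dy_eq_fderiv hq.differentiableAt
  have e2 : dx G =ᶠ[𝓝 p] fun q => fderiv ℂ G q (1, 0) := by
    filter_upwards [h.eventually_analyticAt] with q hq
    exact dx_eq_fderiv hq.differentiableAt
  rw [dx_eq_fderiv (analyticAt_dy h).differentiableAt, dy_eq_fderiv (analyticAt_dx h).differentiableAt,
    e1.fderiv_eq, e2.fderiv_eq, fderiv_clm_apply hd (differentiableAt_const _),
    fderiv_clm_apply hd (differentiableAt_const _)]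
  simpa using hsymm (1, 0) (0, 1)

/-- The exponent `L` with `x₀ e^{L(b, s)}` the root of `w = F + s F₁ + s² F₂ / 2`,
`w = y₀ e^{i b}`. -/
structure IsExponent (F F₁ F₂ : ℂ × ℂ → ℂ) (x₀ y₀ : ℝ) (L : ℂ × ℂ → ℂ) : Prop where
  analyticAt : AnalyticAt ℂ L (0, 0)
  map_zero : L (0, 0) = 0
  eq : ∀ᶠ q in 𝓝 ((0, 0) : ℂ × ℂ), taylorPoly F F₁ F₂ q.2
    (x₀ * Complex.exp (L q), y₀ * Complex.exp (q.1 * Complex.I)) = y₀ * Complex.exp (q.1 * Complex.I)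

theorem isInvertible_of_apply_one {A : ℂ →L[ℂ] ℂ} (h : A 1 ≠ 0) : A.IsInvertible := by
  refine ⟨ContinuousLinearEquiv.unitsEquivAut ℂ (Units.mk0 (A 1) h), ?_⟩
  ext
  simp

/-- The implicit function theorem in the variable x, where F_x ≠ 0. Solving for y instead breaks
down at the characteristic point, because 1 − F_y = 0. -/
theorem exists_analytic_root (hF : AnalyticAt ℂ F ((x₀ : ℂ), (y₀ : ℂ)))
    (h₁ : AnalyticAt ℂ F₁ ((x₀ : ℂ), (y₀ : ℂ))) (h₂ : AnalyticAt ℂ F₂ ((x₀ : ℂ), (y₀ : ℂ)))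
    (hfix : F (x₀, y₀) = y₀) (hdx : dx F (x₀, y₀) ≠ 0) :
    ∃ φ : ℂ × ℂ → ℂ, AnalyticAt ℂ φ ((y₀ : ℂ), 0) ∧ φ (y₀, 0) = x₀ ∧
      ∀ᶠ q in 𝓝 ((y₀ : ℂ), (0 : ℂ)), taylorPoly F F₁ F₂ q.2 (φ q, q.1) = q.1 := by
  set f : (ℂ × ℂ) × ℂ → ℂ := fun v => taylorPoly F F₁ F₂ v.1.2 (v.2, v.1.1) - v.1.1 with hf
  set u : (ℂ × ℂ) × ℂ := (((y₀ : ℂ), 0), (x₀ : ℂ)) with hu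
  have hlin : AnalyticAt ℂ (fun v : (ℂ × ℂ) × ℂ => (v.2, v.1.1)) u :=
    analyticAt_snd.prod (analyticAt_fst.comp analyticAt_fst)
  have hw : AnalyticAt ℂ (fun v : (ℂ × ℂ) × ℂ => v.1.1) u := analyticAt_fst.comp analyticAt_fst
  have hs : AnalyticAt ℂ (fun v : (ℂ × ℂ) × ℂ => v.1.2) u := analyticAt_snd.comp analyticAt_fst
  have hfa : AnalyticAt ℂ f u := by
    have g0 : AnalyticAt ℂ (fun v : (ℂ × ℂ) × ℂ => F (v.2, v.1.1)) u :=
      AnalyticAt.comp (g := F) (f := fun v : (ℂ × ℂ) × ℂ => (v.2, v.1.1)) hF hlin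
    have g1 : AnalyticAt ℂ (fun v : (ℂ × ℂ) × ℂ => F₁ (v.2, v.1.1)) u :=
      AnalyticAt.comp (g := F₁) (f := fun v : (ℂ × ℂ) × ℂ => (v.2, v.1.1)) h₁ hlin
    have g2 : AnalyticAt ℂ (fun v : (ℂ × ℂ) × ℂ => F₂ (v.2, v.1.1)) u :=
      AnalyticAt.comp (g := F₂) (f := fun v : (ℂ × ℂ) × ℂ => (v.2, v.1.1)) h₂ hlin
    exact ((g0.add (hs.mul g1)).add (((hs.pow 2).div analyticAt_const two_ne_zero).mul g2)).sub hw
  have hfu : f u = 0 := by simp [hf, hu, taylorPoly_zero, hfix]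
  have hinv : (fderiv ℂ f u ∘SL ContinuousLinearMap.inr ℂ (ℂ × ℂ) ℂ).IsInvertible := by
    refine isInvertible_of_apply_one ?_
    have h3 : HasDerivAt (fun z : ℂ => f (((y₀ : ℂ), 0), z)) (fderiv ℂ f u (0, 1)) (x₀ : ℂ) :=
      HasFDerivAt.comp_hasDerivAt (l := f) (f := fun z : ℂ => ((((y₀ : ℂ), (0 : ℂ)), z))) (x₀ : ℂ)
        hfa.differentiableAt.hasFDerivAt ((hasDerivAt_const _ _).prodMk (hasDerivAt_id _))
    have h4 : HasDerivAt (fun z : ℂ => f (((y₀ : ℂ), 0), z)) (dx F (x₀, y₀)) (x₀ : ℂ) := by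
      simp only [hf, taylorPoly_zero]
      exact (hasDerivAt_dx (p := ((x₀ : ℂ), (y₀ : ℂ))) hF.differentiableAt).sub_const _
    have h5 := h3.unique h4
    simpa [h5] using hdx
  have hcd : ContDiffAt ℂ ⊤ f u := hfa.contDiffAt
  refine ⟨hcd.implicitFunction (by simp) hinv,
    (hcd.contDiffAt_implicitFunction (by simp) hinv).analyticAt,
    hcd.implicitFunction_apply_self (by simp) hinv, ?_⟩
  filter_upwards [hcd.eventually_apply_implicitFunction (by simp) hinv] with q hq
  rw [hfu] at hq
  exact sub_eq_zero.1 hq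

theorem exists_isExponent (hF : AnalyticAt ℂ F ((x₀ : ℂ), (y₀ : ℂ)))
    (h₁ : AnalyticAt ℂ F₁ ((x₀ : ℂ), (y₀ : ℂ))) (h₂ : AnalyticAt ℂ F₂ ((x₀ : ℂ), (y₀ : ℂ)))
    (hfix : F (x₀, y₀) = y₀) (hdx : dx F (x₀, y₀) ≠ 0) (hx₀ : 0 < x₀) :
    ∃ L, IsExponent F F₁ F₂ x₀ y₀ L := by
  obtain ⟨φ, hφ, hφ0, hφe⟩ := exists_analytic_root hF h₁ h₂ hfix hdx
  have hx₀c : (x₀ : ℂ) ≠ 0 := Complex.ofReal_ne_zero.2 hx₀.ne'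
  set γ : ℂ × ℂ → ℂ × ℂ := fun q => (y₀ * Complex.exp (q.1 * Complex.I), q.2) with hγ
  have hγ0 : γ (0, 0) = ((y₀ : ℂ), 0) := by simp [hγ]
  have hγa : AnalyticAt ℂ γ (0, 0) :=
    (analyticAt_const.mul ((analyticAt_fst.mul analyticAt_const).cexp)).prod analyticAt_snd
  have hc : AnalyticAt ℂ (fun q => φ (γ q)) (0, 0) :=
    AnalyticAt.comp (g := φ) (f := γ) (by rwa [hγ0]) hγa
  have hval : φ (γ (0, 0)) / x₀ = 1 := by rw [hγ0, hφ0, div_self hx₀c]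
  have hda : AnalyticAt ℂ (fun q => φ (γ q) / x₀) (0, 0) := hc.div analyticAt_const hx₀c
  refine ⟨fun q => Complex.log (φ (γ q) / x₀), hda.clog (by rw [hval]; simp), by simp [hval], ?_⟩
  have hne : ∀ᶠ q in 𝓝 ((0, 0) : ℂ × ℂ), φ (γ q) / x₀ ≠ 0 :=
    hda.continuousAt.eventually_ne (by rw [hval]; exact one_ne_zero)
  have hev : ∀ᶠ q in 𝓝 ((0, 0) : ℂ × ℂ), taylorPoly F F₁ F₂ (γ q).2 (φ (γ q), (γ q).1) = (γ q).1 := by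
    have h3 := hγa.continuousAt.tendsto
    rw [hγ0] at h3
    exact h3.eventually hφe
  filter_upwards [hne, hev] with q hq1 hq2
  rw [Complex.exp_log hq1, mul_div_cancel₀ _ hx₀c]
  exact hq2

variable {L : ℂ × ℂ → ℂ}

/-- The linear and quadratic coefficients of the exponent. -/
theorem IsExponent.dx_eq_and_dxx_eq (hL : IsExponent F F₁ F₂ x₀ y₀ L)
    (hF : AnalyticAt ℂ F ((x₀ : ℂ), (y₀ : ℂ))) (hdy : dy F (x₀, y₀) = 1)
    (hdx : dx F (x₀, y₀) ≠ 0) (hx₀ : 0 < x₀) :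
    dx L (0, 0) = 0 ∧
      dx (dx L) (0, 0) = y₀ ^ 2 * dy (dy F) (x₀, y₀) / (x₀ * dx F (x₀, y₀)) := by
  have hx₀c : (x₀ : ℂ) ≠ 0 := Complex.ofReal_ne_zero.2 hx₀.ne'
  set X : ℂ → ℂ := fun b => x₀ * Complex.exp (L (b, 0)) with hX
  set W : ℂ → ℂ := fun b => y₀ * Complex.exp (b * Complex.I) with hW
  have hX0 : X 0 = x₀ := by simp [hX, hL.map_zero]
  have hW0 : W 0 = y₀ := by simp [hW]
  have hincl : Tendsto (fun b : ℂ => (b, (0 : ℂ))) (𝓝 0) (𝓝 (0, 0)) :=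
    (by fun_prop : Continuous fun b : ℂ => (b, (0 : ℂ))).tendsto 0
  have hLa := hincl.eventually hL.analyticAt.eventually_analyticAt
  have hX' : ∀ᶠ b in 𝓝 (0 : ℂ), HasDerivAt X (X b * dx L (b, 0)) b := by
    filter_upwards [hLa] with b hb
    have h1 := (hasDerivAt_dx (p := (b, (0 : ℂ))) hb.differentiableAt).cexp.const_mul (x₀ : ℂ)
    exact h1.congr_deriv (by simp only [hX]; ring)
  have hW' : ∀ b, HasDerivAt W (W b * Complex.I) b := fun b => by
    have h1 := (((hasDerivAt_id b).mul_const Complex.I).cexp).const_mul (y₀ : ℂ)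
    exact h1.congr_deriv (by simp only [hW, id]; ring)
  have hXc : ContinuousAt X 0 := hX'.self_of_nhds.continuousAt
  have hXW : Tendsto (fun b => (X b, W b)) (𝓝 0) (𝓝 ((x₀ : ℂ), (y₀ : ℂ))) := by
    have := hXc.prodMk (hW' 0).continuousAt
    rw [ContinuousAt, hX0, hW0] at this
    exact this
  have hFa := hXW.eventually hF.eventually_analyticAt
  have hid : ∀ᶠ b in 𝓝 (0 : ℂ), F (X b, W b) = W b := by
    filter_upwards [hincl.eventually hL.eq] with b hb
    simpa [taylorPoly_zero] using hb
  -- The equation F(X, W) = W differentiated in b. At b = 0 the terms with W' cancel because F_y =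
  -- 1, which shows that L is critical there.
  have hE : ∀ᶠ b in 𝓝 (0 : ℂ), dx F (X b, W b) * (X b * dx L (b, 0))
      + dy F (X b, W b) * (W b * Complex.I) = W b * Complex.I := by
    filter_upwards [hX', hFa, hid.eventually_nhds] with b h1 h2 h3
    have h4 := hasDerivAt_comp_curve h2.differentiableAt h1 (hW' b)
    exact h4.unique ((hW' b).congr_of_eventuallyEq h3)
  have hE0 := hE.self_of_nhds
  rw [hX0, hW0, hdy, one_mul, add_eq_right] at hE0
  have hL1 : dx L (0, 0) = 0 := by
    rcases mul_eq_zero.1 hE0 with h | h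
    · exact absurd h hdx
    · exact (mul_eq_zero.1 h).resolve_left hx₀c
  refine ⟨hL1, ?_⟩
  have hX0' := hX'.self_of_nhds
  rw [hL1, mul_zero] at hX0'
  have hxw : (X 0, W 0) = ((x₀ : ℂ), (y₀ : ℂ)) := by rw [hX0, hW0]
  have k1 := hasDerivAt_comp_curve (G := dx F) (a := X) (b := W) (z := 0)
    (by rw [hxw]; exact (analyticAt_dx hF).differentiableAt) hX0' (hW' 0)
  have k2 := hasDerivAt_comp_curve (G := dy F) (a := X) (b := W) (z := 0)
    (by rw [hxw]; exact (analyticAt_dy hF).differentiableAt) hX0' (hW' 0)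
  have k3 : HasDerivAt (fun b => dx L (b, 0)) (dx (dx L) (0, 0)) 0 :=
    hasDerivAt_dx (p := ((0 : ℂ), (0 : ℂ))) (analyticAt_dx hL.analyticAt).differentiableAt
  have k4 := (hW' 0).mul_const Complex.I
  -- The second derivative at b = 0. As X' = 0 and F_y = 1, it reduces to F_x x₀ L_bb + F_yy W'² =
  -- 0, where W'² = −y₀².
  have k5 := ((k1.mul (hX0'.mul k3)).add (k2.mul k4)).unique (k4.congr_of_eventuallyEq hE)
  simp only [Pi.mul_apply, hX0, hW0, hL1, hdy] at k5
  rw [eq_div_iff (mul_ne_zero hx₀c hdx)]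
  have hI := Complex.I_sq
  linear_combination k5 - (y₀ : ℂ) ^ 2 * dy (dy F) (x₀, y₀) * hI

/-- The defining equation differentiated in s, with w held constant. It is stated on a neighbourhood
so that it can be differentiated again, in b and in s. -/
theorem IsExponent.eventually_dy_eq (hL : IsExponent F F₁ F₂ x₀ y₀ L)
    (hF : AnalyticAt ℂ F ((x₀ : ℂ), (y₀ : ℂ))) (h₁ : AnalyticAt ℂ F₁ ((x₀ : ℂ), (y₀ : ℂ)))
    (h₂ : AnalyticAt ℂ F₂ ((x₀ : ℂ), (y₀ : ℂ))) : ∀ᶠ q in 𝓝 ((0, 0) : ℂ × ℂ),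
      taylorPoly (dx F) (dx F₁) (dx F₂) q.2
        (x₀ * Complex.exp (L q), y₀ * Complex.exp (q.1 * Complex.I))
          * (x₀ * Complex.exp (L q) * dy L q)
        + F₁ (x₀ * Complex.exp (L q), y₀ * Complex.exp (q.1 * Complex.I))
        + q.2 * F₂ (x₀ * Complex.exp (L q), y₀ * Complex.exp (q.1 * Complex.I)) = 0 := by
  have hc : Tendsto (fun q : ℂ × ℂ => ((x₀ * Complex.exp (L q), y₀ * Complex.exp (q.1 * Complex.I)) : ℂ × ℂ))
      (𝓝 (0, 0)) (𝓝 ((x₀ : ℂ), (y₀ : ℂ))) := by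
    have h1 : ContinuousAt (fun q : ℂ × ℂ => (x₀ : ℂ) * Complex.exp (L q)) (0, 0) :=
      continuousAt_const.mul hL.analyticAt.continuousAt.cexp
    have h2 : ContinuousAt (fun q : ℂ × ℂ => (y₀ : ℂ) * Complex.exp (q.1 * Complex.I)) (0, 0) := by
      fun_prop
    have := h1.prodMk h2
    rw [ContinuousAt] at this
    simpa [hL.map_zero] using this
  filter_upwards [hL.analyticAt.eventually_analyticAt, hc.eventually hF.eventually_analyticAt,
    hc.eventually h₁.eventually_analyticAt, hc.eventually h₂.eventually_analyticAt,
    hL.eq.eventually_nhds] with q hLq hFq h1q h2q hq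
  obtain ⟨b, s⟩ := q
  set W : ℂ := y₀ * Complex.exp (b * Complex.I) with hW
  set X : ℂ → ℂ := fun s => x₀ * Complex.exp (L (b, s)) with hX
  have hX' : HasDerivAt X (X s * dy L (b, s)) s := by
    have h1 := (hasDerivAt_dy (p := (b, s)) hLq.differentiableAt).cexp.const_mul (x₀ : ℂ)
    exact h1.congr_deriv (by simp only [hX]; ring)
  have hWc : HasDerivAt (fun _ : ℂ => W) 0 s := hasDerivAt_const _ _
  have k0 := hasDerivAt_comp_curve (G := F) (a := X) (b := fun _ => W) hFq.differentiableAt hX' hWc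
  have k1 := hasDerivAt_comp_curve (G := F₁) (a := X) (b := fun _ => W) h1q.differentiableAt hX' hWc
  have k2 := hasDerivAt_comp_curve (G := F₂) (a := X) (b := fun _ => W) h2q.differentiableAt hX' hWc
  have k3 := (k0.add ((hasDerivAt_id s).mul k1)).add ((((hasDerivAt_id s).pow 2).div_const 2).mul k2)
  have hcs : Tendsto (fun s' : ℂ => (b, s')) (𝓝 s) (𝓝 (b, s)) :=
    (by fun_prop : Continuous fun s' : ℂ => (b, s')).tendsto s
  have k4 := k3.unique (hWc.congr_of_eventuallyEq (hcs.eventually hq))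
  simp only [id, Pi.pow_apply, mul_zero, add_zero] at k4
  change taylorPoly (dx F) (dx F₁) (dx F₂) s (X s, W) * (X s * dy L (b, s)) + F₁ (X s, W)
    + s * F₂ (X s, W) = 0
  simp only [taylorPoly]
  linear_combination k4

/-- The mixed coefficients of the exponent. -/
theorem IsExponent.dy_eq_and_dxy_eq_and_dyy_eq (hL : IsExponent F F₁ F₂ x₀ y₀ L)
    (hF : AnalyticAt ℂ F ((x₀ : ℂ), (y₀ : ℂ))) (h₁ : AnalyticAt ℂ F₁ ((x₀ : ℂ), (y₀ : ℂ)))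
    (h₂ : AnalyticAt ℂ F₂ ((x₀ : ℂ), (y₀ : ℂ))) (hdx : dx F (x₀, y₀) ≠ 0) (hx₀ : 0 < x₀)
    (hL1 : dx L (0, 0) = 0) :
    dy L (0, 0) = -F₁ (x₀, y₀) / (x₀ * dx F (x₀, y₀)) ∧
    dx (dy L) (0, 0) = -(Complex.I * y₀ * (dx (dy F) (x₀, y₀) * (x₀ * dy L (0, 0)) + dy F₁ (x₀, y₀)))
      / (x₀ * dx F (x₀, y₀)) ∧
    dy (dy L) (0, 0) = -(dx (dx F) (x₀, y₀) * (x₀ * dy L (0, 0)) ^ 2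
      + 2 * dx F₁ (x₀, y₀) * (x₀ * dy L (0, 0)) + dx F (x₀, y₀) * x₀ * dy L (0, 0) ^ 2
      + F₂ (x₀, y₀)) / (x₀ * dx F (x₀, y₀)) := by
  have hx₀c : (x₀ : ℂ) ≠ 0 := Complex.ofReal_ne_zero.2 hx₀.ne'
  have hne := mul_ne_zero hx₀c hdx
  have hE := hL.eventually_dy_eq hF h₁ h₂
  have hE0 := hE.self_of_nhds
  simp only [hL.map_zero, Complex.exp_zero, mul_one, zero_mul, add_zero, taylorPoly_zero] at hE0
  have hLd := hL.analyticAt.differentiableAt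
  have hL1d := (analyticAt_dy hL.analyticAt).differentiableAt
  refine ⟨by rw [eq_div_iff hne]; linear_combination hE0, ?_, ?_⟩
  · set X : ℂ → ℂ := fun b => x₀ * Complex.exp (L (b, 0)) with hX
    set W : ℂ → ℂ := fun b => y₀ * Complex.exp (b * Complex.I) with hW
    have hX0 : X 0 = x₀ := by simp [hX, hL.map_zero]
    have hW0 : W 0 = y₀ := by simp [hW]
    have hxw : (X 0, W 0) = ((x₀ : ℂ), (y₀ : ℂ)) := by rw [hX0, hW0]
    have hX' : HasDerivAt X 0 0 := by
      have h1 := (hasDerivAt_dx (p := ((0 : ℂ), (0 : ℂ))) hLd).cexp.const_mul (x₀ : ℂ)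
      exact h1.congr_deriv (by rw [hL1]; ring)
    have hW' : HasDerivAt W (y₀ * Complex.I) 0 := by
      have h1 := (((hasDerivAt_id (0 : ℂ)).mul_const Complex.I).cexp).const_mul (y₀ : ℂ)
      exact h1.congr_deriv (by simp)
    have hincl : Tendsto (fun b : ℂ => (b, (0 : ℂ))) (𝓝 0) (𝓝 (0, 0)) :=
      (by fun_prop : Continuous fun b : ℂ => (b, (0 : ℂ))).tendsto 0
    have hEb : (fun b => dx F (X b, W b) * (X b * dy L (b, 0)) + F₁ (X b, W b)) =ᶠ[𝓝 0]
        fun _ => (0 : ℂ) := by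
      filter_upwards [hincl.eventually hE] with b hb
      simpa [taylorPoly_zero] using hb
    have k1 := hasDerivAt_comp_curve (G := dx F) (a := X) (b := W) (z := 0)
      (by rw [hxw]; exact (analyticAt_dx hF).differentiableAt) hX' hW'
    have k2 := hasDerivAt_comp_curve (G := F₁) (a := X) (b := W) (z := 0)
      (by rw [hxw]; exact h₁.differentiableAt) hX' hW'
    have k3 : HasDerivAt (fun b => dy L (b, 0)) (dx (dy L) (0, 0)) 0 :=
      hasDerivAt_dx (p := ((0 : ℂ), (0 : ℂ))) hL1d
    have k5 := ((k1.mul (hX'.mul k3)).add k2).unique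
      ((hasDerivAt_const (0 : ℂ) (0 : ℂ)).congr_of_eventuallyEq hEb)
    simp only [Pi.mul_apply, hX0, hW0] at k5
    rw [eq_div_iff hne, dx_dy_comm hF]
    linear_combination k5
  · set X : ℂ → ℂ := fun s => x₀ * Complex.exp (L (0, s)) with hX
    set ℓ := dy L (0, 0) with hℓ
    have hX0 : X 0 = x₀ := by simp [hX, hL.map_zero]
    have hX' : HasDerivAt X (x₀ * ℓ) 0 := by
      have h1 := (hasDerivAt_dy (p := ((0 : ℂ), (0 : ℂ))) hLd).cexp.const_mul (x₀ : ℂ)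
      exact h1.congr_deriv (by simp [hL.map_zero, hℓ])
    have hWc : HasDerivAt (fun _ : ℂ => (y₀ : ℂ)) 0 0 := hasDerivAt_const _ _
    have hincl : Tendsto (fun s : ℂ => ((0 : ℂ), s)) (𝓝 0) (𝓝 (0, 0)) :=
      (by fun_prop : Continuous fun s : ℂ => ((0 : ℂ), s)).tendsto 0
    have hEs : (fun s => (dx F (X s, y₀) + s * dx F₁ (X s, y₀) + s ^ 2 / 2 * dx F₂ (X s, y₀))
        * (X s * dy L (0, s)) + F₁ (X s, y₀) + s * F₂ (X s, y₀)) =ᶠ[𝓝 0] fun _ => (0 : ℂ) := by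
      filter_upwards [hincl.eventually hE] with b hb
      simpa [taylorPoly] using hb
    have c1 : ∀ {G : ℂ × ℂ → ℂ}, AnalyticAt ℂ G ((x₀ : ℂ), (y₀ : ℂ)) →
        HasDerivAt (fun s => G (X s, y₀)) (dx G (x₀, y₀) * (x₀ * ℓ)) 0 := fun {G} hG => by
      have := hasDerivAt_comp_curve (G := G) (a := X) (b := fun _ => (y₀ : ℂ)) (z := 0)
        (by rw [hX0]; exact hG.differentiableAt) hX' hWc
      exact this.congr_deriv (by rw [hX0]; ring)
    have k3 : HasDerivAt (fun s => dy L (0, s)) (dy (dy L) (0, 0)) 0 :=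
      hasDerivAt_dy (p := ((0 : ℂ), (0 : ℂ))) hL1d
    have ks := hasDerivAt_id (0 : ℂ)
    have k5 := ((((((c1 (analyticAt_dx hF)).add (ks.mul (c1 (analyticAt_dx h₁)))).add
      (((ks.pow 2).div_const 2).mul (c1 (analyticAt_dx h₂)))).mul (hX'.mul k3)).add
        (c1 h₁)).add (ks.mul (c1 h₂))).unique
      ((hasDerivAt_const (0 : ℂ) (0 : ℂ)).congr_of_eventuallyEq hEs)
    simp [hX0] at k5
    rw [eq_div_iff hne]
    linear_combination k5

end Exponent

end SingleEquation

namespace SingleEquation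

/-! ### Families with a quadratic expansion in the parameter. -/

section SmoothFamily

variable {F F₁ F₂ G : ℂ × ℂ → ℂ} {Ft : ℝ → ℂ × ℂ → ℂ} {R S x₀ y₀ B C : ℝ}

/-- A family `F_t = F + t F₁ + t² F₂ / 2 + O(t³)` of perturbations of `F` with a square root
singularity at `(x₀, y₀)`. -/
structure IsSmoothFamily (F F₁ F₂ : ℂ × ℂ → ℂ) (Ft : ℝ → ℂ × ℂ → ℂ) (R S x₀ y₀ B C : ℝ) :
    Prop where
  dominant : IsDominantPoint F R S x₀ y₀
  analytic₁ : AnalyticOnNhd ℂ F₁ (bidisc R S)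
  analytic₂ : AnalyticOnNhd ℂ F₂ (bidisc R S)
  bound₁ : ∀ p ∈ bidisc R S, ‖F₁ p‖ ≤ B
  bound₂ : ∀ p ∈ bidisc R S, ‖F₂ p‖ ≤ B
  analytic : ∀ t, AnalyticOnNhd ℂ (Ft t) (bidisc R S)
  taylor : ∀ t, |t| ≤ 1 → ∀ p ∈ bidisc R S, ‖Ft t p - taylorPoly F F₁ F₂ t p‖ ≤ C * |t| ^ 3
  zero : Ft 0 = F
  dy_eq : dy F (x₀, y₀) = 1
  dx_pos : ∃ v : ℝ, 0 < v ∧ dx F (x₀, y₀) = v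
  dyy_pos : ∃ v : ℝ, 0 < v ∧ dy (dy F) (x₀, y₀) = v

theorem IsDominantPoint.mem (h : IsDominantPoint F R S x₀ y₀) :
    ((x₀ : ℂ), (y₀ : ℂ)) ∈ bidisc R S := mem_bidisc.2
  ⟨by rw [Complex.norm_real, Real.norm_of_nonneg h.x_pos.le]; exact h.x_lt,
    by rw [Complex.norm_real, Real.norm_of_nonneg h.y_pos.le]; exact h.y_lt⟩

theorem IsDominantPoint.mono (h : IsDominantPoint F R S x₀ y₀) {R' S' : ℝ} (hR : R' ≤ R)
    (hS : S' ≤ S) (hx : x₀ < R') (hy : y₀ < S') : IsDominantPoint F R' S' x₀ y₀ :=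
  ⟨h.analytic.mono (Set.prod_mono (Metric.ball_subset_ball hR) (Metric.ball_subset_ball hS)),
    h.x_pos, hx, h.y_pos, hy, h.fix, h.dx_ne, h.unique⟩

theorem IsSmoothFamily.B_nonneg (h : IsSmoothFamily F F₁ F₂ Ft R S x₀ y₀ B C) : 0 ≤ B :=
  (norm_nonneg _).trans (h.bound₁ _ h.dominant.mem)

theorem IsSmoothFamily.C_nonneg (h : IsSmoothFamily F F₁ F₂ Ft R S x₀ y₀ B C) : 0 ≤ C := by
  have := (norm_nonneg _).trans (h.taylor 1 (by simp) _ h.dominant.mem)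
  simpa using this

theorem IsSmoothFamily.norm_taylorPoly_sub_le (h : IsSmoothFamily F F₁ F₂ Ft R S x₀ y₀ B C) {s : ℂ}
    (hs : ‖s‖ ≤ 1) {p : ℂ × ℂ} (hp : p ∈ bidisc R S) :
    ‖taylorPoly F F₁ F₂ s p - F p‖ ≤ 2 * B * ‖s‖ := by
  have e : taylorPoly F F₁ F₂ s p - F p = s * F₁ p + s ^ 2 / 2 * F₂ p := by
    rw [taylorPoly]; ring
  have hB := h.B_nonneg
  have h1 : ‖s‖ * ‖F₁ p‖ ≤ ‖s‖ * B := mul_le_mul_of_nonneg_left (h.bound₁ p hp) (norm_nonneg _)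
  have h2 : ‖s‖ ^ 2 / 2 * ‖F₂ p‖ ≤ ‖s‖ / 2 * B :=
    mul_le_mul (by nlinarith [norm_nonneg s]) (h.bound₂ p hp) (norm_nonneg _) (by positivity)
  rw [e]
  refine (norm_add_le _ _).trans ?_
  rw [norm_mul, norm_mul, norm_div, norm_pow, Complex.norm_ofNat]
  nlinarith [norm_nonneg s, mul_nonneg (norm_nonneg s) hB]

theorem IsSmoothFamily.exists_isNear_taylorPoly (h : IsSmoothFamily F F₁ F₂ Ft R S x₀ y₀ B C)
    {η : ℝ} (hη : 0 < η) :
    ∃ d > 0, ∀ s : ℂ, ‖s‖ ≤ d → IsNear F (taylorPoly F F₁ F₂ s) R S η := by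
  have hB := h.B_nonneg
  refine ⟨min 1 (η / (2 * B + 1)), by positivity, fun s hs =>
    ⟨analyticOnNhd_taylorPoly h.dominant.analytic h.analytic₁ h.analytic₂ s, fun p hp => ?_⟩⟩
  refine (h.norm_taylorPoly_sub_le (hs.trans (min_le_left _ _)) hp).trans ?_
  have h1 := hs.trans (min_le_right _ _)
  rw [le_div_iff₀ (by positivity)] at h1
  linarith [norm_nonneg s]

theorem IsSmoothFamily.exists_isNear (h : IsSmoothFamily F F₁ F₂ Ft R S x₀ y₀ B C)
    {η : ℝ} (hη : 0 < η) :
    ∃ d > 0, ∀ t : ℝ, |t| ≤ d → IsNear F (Ft t) R S η := by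
  obtain ⟨d, hd, hnear⟩ := h.exists_isNear_taylorPoly (half_pos hη)
  have hC := h.C_nonneg
  refine ⟨min d (min 1 (η / (2 * C + 1))), by positivity, fun t ht => ⟨h.analytic t, fun p hp => ?_⟩⟩
  have ht1 : |t| ≤ 1 := ht.trans ((min_le_right _ _).trans (min_le_left _ _))
  have ht2 := ht.trans ((min_le_right _ _).trans (min_le_right _ _))
  rw [le_div_iff₀ (by positivity)] at ht2
  have h1 := h.taylor t ht1 p hp
  have h2 := (hnear t (by rw [Complex.norm_real]; exact ht.trans (min_le_left _ _))).le p hp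
  have h3 : |t| ^ 3 ≤ |t| := pow_le_of_le_one (abs_nonneg t) ht1 (by norm_num)
  have h4 : C * |t| ^ 3 ≤ C * |t| := mul_le_mul_of_nonneg_left h3 hC
  calc ‖Ft t p - F p‖ = ‖(Ft t p - taylorPoly F F₁ F₂ t p) + (taylorPoly F F₁ F₂ t p - F p)‖ := by
        congr 1; ring
    _ ≤ _ := norm_add_le _ _
    _ ≤ η := by linarith [abs_nonneg t]

theorem IsSmoothFamily.exists_isExponent (h : IsSmoothFamily F F₁ F₂ Ft R S x₀ y₀ B C) :
    ∃ L, IsExponent F F₁ F₂ x₀ y₀ L :=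
  SingleEquation.exists_isExponent (h.dominant.analytic _ h.dominant.mem)
    (h.analytic₁ _ h.dominant.mem) (h.analytic₂ _ h.dominant.mem) h.dominant.fix h.dominant.dx_ne
    h.dominant.x_pos

theorem hasDerivAt_of_norm_sub_le {g : ℝ → ℂ} {α β γ : ℂ} {K : ℝ}
    (hg : ∀ t : ℝ, |t| ≤ 1 → ‖g t - (α + t * β + t ^ 2 / 2 * γ)‖ ≤ K * |t| ^ 3) :
    HasDerivAt g β 0 := by
  have h0 : g 0 = α := by
    have := hg 0 (by simp)
    simp at this
    exact sub_eq_zero.1 this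
  have h1 : HasDerivAt (fun t : ℝ => α + t * β + (t : ℂ) ^ 2 / 2 * γ) β 0 := by
    have hid : HasDerivAt (fun s : ℝ => (s : ℂ)) 1 0 := Complex.ofRealCLM.hasDerivAt
    have := (((hid.mul_const β).const_add α)).add (((hid.pow 2).div_const 2).mul_const γ)
    exact this.congr_deriv (by simp)
  have h2 : HasDerivAt (fun t : ℝ => g t - (α + t * β + (t : ℂ) ^ 2 / 2 * γ)) 0 0 := by
    rw [hasDerivAt_iff_isLittleO_nhds_zero]
    have hO : (fun t : ℝ => g t - (α + t * β + (t : ℂ) ^ 2 / 2 * γ)) =O[𝓝 0] fun t : ℝ => t ^ 3 := by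
      refine IsBigO.of_bound K ?_
      filter_upwards [Metric.closedBall_mem_nhds (0 : ℝ) one_pos] with t ht
      simpa using hg t (by simpa using ht)
    have hO2 : (fun t : ℝ => t ^ 3) =o[𝓝 0] fun t : ℝ => t := by
      simpa using isLittleO_pow_pow (𝕜 := ℝ) (show 1 < 3 by norm_num)
    simpa [h0] using hO.trans_isLittleO hO2
  have h3 := h2.add h1
  rw [zero_add] at h3
  refine h3.congr_of_eventuallyEq (Eventually.of_forall fun t => ?_)
  simp

theorem IsNear.norm_dy_sub_le {η S' : ℝ} (h : IsNear F G R S η)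
    (hF : AnalyticOnNhd ℂ F (bidisc R S)) (hS' : S' < S) {x w : ℂ} (hx : ‖x‖ < R)
    (hw : ‖w‖ ≤ S') : ‖dy G (x, w) - dy F (x, w)‖ ≤ η / (S - S') := by
  have hsw : ∀ {G : ℂ × ℂ → ℂ}, AnalyticOnNhd ℂ G (bidisc R S) →
      AnalyticOnNhd ℂ (fun p : ℂ × ℂ => G (p.2, p.1)) (bidisc S R) := fun {G} hG p hp =>
    AnalyticAt.comp (g := G) (f := fun p : ℂ × ℂ => (p.2, p.1)) (hG _ ⟨hp.2, hp.1⟩)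
      (analyticAt_snd.prod analyticAt_fst)
  exact IsNear.norm_dx_sub_le (F := fun p => F (p.2, p.1)) (G := fun p => G (p.2, p.1))
    ⟨hsw h.analytic, fun p hp => h.le _ ⟨hp.2, hp.1⟩⟩ (hsw hF) hS' hw hx

/-- Cauchy's estimate carries the uniform O(t³) expansion over to x-derivatives, so the mixed
derivative exists and the order of differentiation is immaterial. -/
theorem IsSmoothFamily.hasDerivAt_dx (h : IsSmoothFamily F F₁ F₂ Ft R S x₀ y₀ B C) :
    HasDerivAt (fun t => dx (Ft t) (x₀, y₀)) (dx F₁ (x₀, y₀)) 0 := by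
  have hm := h.dominant.mem
  refine hasDerivAt_of_norm_sub_le (α := dx F (x₀, y₀)) (γ := dx F₂ (x₀, y₀)) (K := C / (R - x₀))
    fun t ht => ?_
  have h1 := IsNear.norm_dx_sub_le ⟨h.analytic t, h.taylor t ht⟩
    (analyticOnNhd_taylorPoly h.dominant.analytic h.analytic₁ h.analytic₂ t) h.dominant.x_lt
    (x := x₀) (w := y₀) (by rw [Complex.norm_real, Real.norm_of_nonneg h.dominant.x_pos.le])
    (mem_bidisc.1 hm).2
  rw [dx_taylorPoly (h.dominant.analytic _ hm) (h.analytic₁ _ hm) (h.analytic₂ _ hm)] at h1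
  refine h1.trans (le_of_eq ?_)
  ring

theorem dy_taylorPoly {p : ℂ × ℂ} (hF : AnalyticAt ℂ F p) (h₁ : AnalyticAt ℂ F₁ p)
    (h₂ : AnalyticAt ℂ F₂ p) (s : ℂ) :
    dy (taylorPoly F F₁ F₂ s) p = taylorPoly (dy F) (dy F₁) (dy F₂) s p :=
  (((hasDerivAt_dy hF.differentiableAt).add ((hasDerivAt_dy h₁.differentiableAt).const_mul s)).add
    ((hasDerivAt_dy h₂.differentiableAt).const_mul (s ^ 2 / 2))).deriv

theorem IsSmoothFamily.hasDerivAt_dy (h : IsSmoothFamily F F₁ F₂ Ft R S x₀ y₀ B C) :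
    HasDerivAt (fun t => dy (Ft t) (x₀, y₀)) (dy F₁ (x₀, y₀)) 0 := by
  have hm := h.dominant.mem
  refine hasDerivAt_of_norm_sub_le (α := dy F (x₀, y₀)) (γ := dy F₂ (x₀, y₀)) (K := C / (S - y₀))
    fun t ht => ?_
  have h1 := IsNear.norm_dy_sub_le ⟨h.analytic t, h.taylor t ht⟩
    (analyticOnNhd_taylorPoly h.dominant.analytic h.analytic₁ h.analytic₂ t) h.dominant.y_lt
    (x := x₀) (w := y₀) (mem_bidisc.1 hm).1
    (by rw [Complex.norm_real, Real.norm_of_nonneg h.dominant.y_pos.le])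
  rw [dy_taylorPoly (h.dominant.analytic _ hm) (h.analytic₁ _ hm) (h.analytic₂ _ hm)] at h1
  refine h1.trans (le_of_eq ?_)
  ring

end SmoothFamily

/-! ### The family F(x, y, e^{it}) and the constants μ and σ². -/

section PositiveFamily

variable {a : ℕ → ℕ → Circle → ℂ} {R S x₀ y₀ : ℝ}

/-- The `k`-th `t`-derivative of `F(x, y, e^{it})` at `t = 0`. -/
noncomputable def paramDeriv (a : ℕ → ℕ → Circle → ℂ) (k : ℕ) (p : ℂ × ℂ) : ℂ :=
  tDeriv (seriesF a) k p.1 p.2 0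

/-- The bidisc is shrunk to one with compact closure in the original, where continuity bounds F₁, F₂
and the third t-derivative and makes the Taylor remainder uniform. -/
theorem IsPositiveEquation.exists_isSmoothFamily (hF : IsPositiveEquation a R S)
    (hchar : IsCharacteristicPoint (seriesF a) x₀ y₀) (hx₀ : x₀ < R) (hy₀ : y₀ < S)
    {y : ℂ → Circle → ℂ} (hy : IsSolution (seriesF a) y)
    (haper : IsAperiodic fun n => coeffAt n fun x => y x 1) :
    ∃ R' S' B C, R' ≤ R ∧ S' ≤ S ∧ IsSmoothFamily (atParam a 1) (paramDeriv a 1) (paramDeriv a 2)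
      (fun t => atParam a (Circle.exp t)) R' S' x₀ y₀ B C := by
  have hdom := hF.isDominantPoint hchar hx₀ hy₀ hy haper
  set R' := (x₀ + R) / 2 with hR'
  set S' := (y₀ + S) / 2 with hS'
  have hR'R : R' < R := by rw [hR']; linarith
  have hS'S : S' < S := by rw [hS']; linarith
  set K : Set (ℂ × ℂ) := Metric.closedBall 0 R' ×ˢ Metric.closedBall 0 S' with hK
  have hKc : IsCompact K := (isCompact_closedBall _ _).prod (isCompact_closedBall _ _)
  have hKsub : K ⊆ bidisc R S :=
    Set.prod_mono (Metric.closedBall_subset_ball hR'R) (Metric.closedBall_subset_ball hS'S)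
  have hsubK : bidisc R' S' ⊆ K :=
    Set.prod_mono Metric.ball_subset_closedBall Metric.ball_subset_closedBall
  have hsub : bidisc R' S' ⊆ bidisc R S := hsubK.trans hKsub
  obtain ⟨B₁, hB₁⟩ := hKc.exists_bound_of_continuousOn
    ((hF.analytic_tDeriv 1 (by norm_num) 0).mono hKsub).continuousOn
  obtain ⟨B₂, hB₂⟩ := hKc.exists_bound_of_continuousOn
    ((hF.analytic_tDeriv 2 (by norm_num) 0).mono hKsub).continuousOn
  obtain ⟨C, hC⟩ := (hKc.prod (isCompact_Icc (a := (-1 : ℝ)) (b := 1))).exists_bound_of_continuousOn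
    ((hF.continuous_tDeriv 3 le_rfl).mono (Set.prod_mono hKsub (Set.subset_univ _)))
  refine ⟨R', S', max B₁ B₂, C, hR'R.le, hS'S.le,
    hdom.mono hR'R.le hS'S.le (by rw [hR']; linarith) (by rw [hS']; linarith),
    (hF.analytic_tDeriv 1 (by norm_num) 0).mono hsub, (hF.analytic_tDeriv 2 (by norm_num) 0).mono hsub,
    fun p hp => (hB₁ p (hsubK hp)).trans (le_max_left _ _),
    fun p hp => (hB₂ p (hsubK hp)).trans (le_max_right _ _),
    fun t => (hF.analyticOnNhd_atParam t).mono hsub, fun t ht p hp => ?_, by simp,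
    hchar.eq_deriv.symm, hF.exists_dx_eq hchar hx₀ hy₀, hF.exists_dyy_eq hchar hx₀ hy₀⟩
  have h1 := norm_sub_taylor_two_le (hF.contDiff p (hsub hp)) (C := C) (t := t) fun s hs =>
    hC (p, s) ⟨hsubK hp, abs_le.1 (hs.trans ht)⟩
  simpa [taylorPoly, atParam, paramDeriv, tDeriv] using h1

theorem Du_one_eq (a : ℕ → ℕ → Circle → ℂ) (x y : ℂ) :
    Du (seriesF a) x y 1 = paramDeriv a 1 (x, y) / Complex.I := by
  simp [Du, paramDeriv, tDeriv]

/-- The first-order term appears because the divisor iu = ie^{it} in `Du` itself varies with t. -/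
theorem IsPositiveEquation.Du_Du_one_eq (hF : IsPositiveEquation a R S) {x y : ℂ}
    (hp : (x, y) ∈ bidisc R S) :
    Du (Du (seriesF a)) x y 1 = -paramDeriv a 2 (x, y) + Complex.I * paramDeriv a 1 (x, y) := by
  set f : ℝ → ℂ := fun t => seriesF a x y (Circle.exp t) with hf
  have hfd := hF.contDiff _ hp
  have h1 : ∀ t : ℝ, Du (seriesF a) x y (Circle.exp t)
      = deriv f t * (Complex.exp (-(t * Complex.I)) / Complex.I) := fun t => by
    have e : (fun τ : ℝ => seriesF a x y (Circle.exp t * Circle.exp τ)) = fun τ => f (t + τ) := by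
      funext τ; simp only [hf, Circle.exp_add]
    rw [Du, e, deriv_comp_const_add, add_zero, Circle.coe_exp, Complex.exp_neg]
    field_simp
  have h2 : HasDerivAt (deriv f) (paramDeriv a 2 (x, y)) 0 := by
    have h3 := (hfd.differentiable_iteratedDeriv 1 (by norm_num) 0).hasDerivAt
    rw [← iteratedDeriv_succ, iteratedDeriv_one] at h3
    exact h3
  have h4 : HasDerivAt (fun t : ℝ => Complex.exp (-(t * Complex.I)) / Complex.I)
      (-Complex.I / Complex.I) 0 := by
    have hid : HasDerivAt (fun s : ℝ => (s : ℂ)) 1 0 := Complex.ofRealCLM.hasDerivAt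
    have := ((hid.mul_const Complex.I).neg.cexp).div_const Complex.I
    exact this.congr_deriv (by simp)
  have h5 : deriv f 0 = paramDeriv a 1 (x, y) := by
    rw [← iteratedDeriv_one]; rfl
  have h6 : (fun t : ℝ => Du (seriesF a) x y (1 * Circle.exp t)) = fun t : ℝ =>
      deriv f t * (Complex.exp (-(t * Complex.I)) / Complex.I) := by
    funext t; rw [one_mul, h1]
  have h7 : HasDerivAt (fun t : ℝ => deriv f t * (Complex.exp (-(t * Complex.I)) / Complex.I)) _ 0 :=
    h2.mul h4
  rw [Du, h6, h7.deriv, h5]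
  simp only [Complex.ofReal_zero, zero_mul, neg_zero, Complex.exp_zero, Circle.coe_one, mul_one]
  have hI := Complex.I_sq
  have hI0 := Complex.I_ne_zero
  field_simp
  linear_combination paramDeriv a 2 (x, y) * hI - paramDeriv a 1 (x, y) * Complex.I * hI

variable {L : ℂ × ℂ → ℂ} {R' S' B C : ℝ}

/-- The coefficients behave like e^{−nL}, so a mean μn corresponds to ∂L/∂s = −iμ. -/
theorem meanConst_eq (hfam : IsSmoothFamily (atParam a 1) (paramDeriv a 1) (paramDeriv a 2)
      (fun t => atParam a (Circle.exp t)) R' S' x₀ y₀ B C)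
    (hL : IsExponent (atParam a 1) (paramDeriv a 1) (paramDeriv a 2) x₀ y₀ L) :
    dy L (0, 0) = -Complex.I * meanConst (seriesF a) x₀ y₀ := by
  have hm := hfam.dominant.mem
  have h1 := hL.dx_eq_and_dxx_eq (hfam.dominant.analytic _ hm) hfam.dy_eq hfam.dominant.dx_ne
    hfam.dominant.x_pos
  have h2 := hL.dy_eq_and_dxy_eq_and_dyy_eq (hfam.dominant.analytic _ hm) (hfam.analytic₁ _ hm)
    (hfam.analytic₂ _ hm) hfam.dominant.dx_ne hfam.dominant.x_pos h1.1
  have hI0 := Complex.I_ne_zero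
  have hI := Complex.I_sq
  have e : Dx (seriesF a) x₀ y₀ 1 = dx (atParam a 1) (x₀, y₀) := rfl
  rw [h2.1, meanConst, Du_one_eq, e]
  field_simp

/-- Integrating out β from the quadratic part of L leaves this combination. The summand μ² of σ²
comes from passing from X to log X, the summand μ from the second derivative of u = e^{it}. -/
theorem varConst_eq (hF : IsPositiveEquation a R S) (hx₀ : x₀ < R) (hy₀ : y₀ < S)
    (hfam : IsSmoothFamily (atParam a 1) (paramDeriv a 1) (paramDeriv a 2)
      (fun t => atParam a (Circle.exp t)) R' S' x₀ y₀ B C)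
    (hL : IsExponent (atParam a 1) (paramDeriv a 1) (paramDeriv a 2) x₀ y₀ L) :
    varConst (seriesF a) x₀ y₀
      = dy (dy L) (0, 0) - dx (dy L) (0, 0) ^ 2 / dx (dx L) (0, 0) := by
  have hm := hfam.dominant.mem
  obtain ⟨-, hκ⟩ := hL.dx_eq_and_dxx_eq (hfam.dominant.analytic _ hm) hfam.dy_eq
    hfam.dominant.dx_ne hfam.dominant.x_pos
  have h1 := hL.dx_eq_and_dxx_eq (hfam.dominant.analytic _ hm) hfam.dy_eq hfam.dominant.dx_ne
    hfam.dominant.x_pos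
  obtain ⟨hℓ, hxy, hyy⟩ := hL.dy_eq_and_dxy_eq_and_dyy_eq (hfam.dominant.analytic _ hm)
    (hfam.analytic₁ _ hm) (hfam.analytic₂ _ hm) hfam.dominant.dx_ne hfam.dominant.x_pos h1.1
  have hmR : ((x₀ : ℂ), (y₀ : ℂ)) ∈ bidisc R S := mem_bidisc.2
    ⟨by rw [Complex.norm_real, Real.norm_of_nonneg hfam.dominant.x_pos.le]; exact hx₀,
      by rw [Complex.norm_real, Real.norm_of_nonneg hfam.dominant.y_pos.le]; exact hy₀⟩
  have hDux : Du (Dx (seriesF a)) x₀ y₀ 1 = dx (paramDeriv a 1) (x₀, y₀) / Complex.I := by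
    have : deriv (fun t : ℝ => Dx (seriesF a) x₀ y₀ (1 * Circle.exp t)) 0
        = dx (paramDeriv a 1) (x₀, y₀) := by
      simp only [one_mul]
      exact hfam.hasDerivAt_dx.deriv
    rw [Du, this]; simp
  have hDuy : Du (Dy (seriesF a)) x₀ y₀ 1 = dy (paramDeriv a 1) (x₀, y₀) / Complex.I := by
    have : deriv (fun t : ℝ => Dy (seriesF a) x₀ y₀ (1 * Circle.exp t)) 0
        = dy (paramDeriv a 1) (x₀, y₀) := by
      simp only [one_mul]
      exact hfam.hasDerivAt_dy.deriv
    rw [Du, this]; simp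
  obtain ⟨v, hv, hyyv⟩ := hfam.dyy_pos
  have hyy0 : dy (dy (atParam a 1)) (x₀, y₀) ≠ 0 := by
    rw [hyyv]; exact Complex.ofReal_ne_zero.2 hv.ne'
  have hdx0 := hfam.dominant.dx_ne
  have hx0 : (x₀ : ℂ) ≠ 0 := Complex.ofReal_ne_zero.2 hfam.dominant.x_pos.ne'
  have hy0 : (y₀ : ℂ) ≠ 0 := Complex.ofReal_ne_zero.2 hfam.dominant.y_pos.ne'
  have e1 : Dx (seriesF a) x₀ y₀ 1 = dx (atParam a 1) (x₀, y₀) := rfl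
  have e2 : Dx (Dx (seriesF a)) x₀ y₀ 1 = dx (dx (atParam a 1)) (x₀, y₀) := rfl
  have e3 : Dy (Dy (seriesF a)) x₀ y₀ 1 = dy (dy (atParam a 1)) (x₀, y₀) := rfl
  have e4 : Dx (Dy (seriesF a)) x₀ y₀ 1 = dx (dy (atParam a 1)) (x₀, y₀) := rfl
  simp only [varConst, meanConst, Du_one_eq, hF.Du_Du_one_eq hmR, hDux, hDuy, e1, e2, e3, e4]
  rw [hκ, hxy, hyy, hℓ]
  generalize dx (atParam a 1) (x₀, y₀) = A at *
  generalize dy (dy (atParam a 1)) (x₀, y₀) = D at *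
  have hI0 := Complex.I_ne_zero
  have hinv : ∀ z : ℂ, z / Complex.I = -(Complex.I * z) := fun z => by
    rw [Complex.div_I]; ring
  simp only [hinv]
  have hI := Complex.I_sq
  field_simp
  ring_nf
  simp only [hI]
  ring

end PositiveFamily

end SingleEquation

namespace SingleEquation

/-! ### Taylor's formula in a complex variable. -/

section ComplexTaylor

theorem norm_sub_taylor_zero_le {f f₁ : ℂ → ℂ} {d M : ℝ}
    (h₁ : ∀ z, ‖z‖ < d → HasDerivAt f (f₁ z) z) {z : ℂ} (hz : ‖z‖ < d)
    (hM : ∀ u, ‖u‖ ≤ ‖z‖ → ‖f₁ u‖ ≤ M) : ‖f z - f 0‖ ≤ M * ‖z‖ := by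
  have h := (convex_closedBall (0 : ℂ) ‖z‖).norm_image_sub_le_of_norm_hasDerivWithin_le
    (f := f) (f' := f₁) (C := M) (x := 0) (y := z)
    (fun u hu => (h₁ u (lt_of_le_of_lt (by simpa using hu) hz)).hasDerivWithinAt)
    (fun u hu => hM u (by simpa using hu)) (by simp) (by simp)
  simpa using h

theorem norm_sub_taylor_one_le {f f₁ f₂ : ℂ → ℂ} {d M : ℝ}
    (h₁ : ∀ z, ‖z‖ < d → HasDerivAt f (f₁ z) z) (h₂ : ∀ z, ‖z‖ < d → HasDerivAt f₁ (f₂ z) z)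
    {z : ℂ} (hz : ‖z‖ < d) (hM : ∀ u, ‖u‖ ≤ ‖z‖ → ‖f₂ u‖ ≤ M) :
    ‖f z - (f 0 + f₁ 0 * z)‖ ≤ M * ‖z‖ ^ 2 := by
  have hM0 : 0 ≤ M := (norm_nonneg _).trans (hM z le_rfl)
  have h := norm_sub_taylor_zero_le (f := fun z => f z - f₁ 0 * z) (f₁ := fun z => f₁ z - f₁ 0)
    (M := M * ‖z‖) (d := d) (fun u hu => by
      exact ((h₁ u hu).sub ((hasDerivAt_id u).const_mul (f₁ 0))).congr_deriv (by ring)) hz fun u hu =>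
      (norm_sub_taylor_zero_le h₂ (hu.trans_lt hz) fun v hv => hM v (hv.trans hu)).trans
        (mul_le_mul_of_nonneg_left hu hM0)
  calc _ = ‖f z - f₁ 0 * z - (f 0 - f₁ 0 * 0)‖ := by congr 1; ring
    _ ≤ _ := h
    _ = _ := by ring

theorem norm_sub_taylor_two_le' {f f₁ f₂ f₃ : ℂ → ℂ} {d M : ℝ}
    (h₁ : ∀ z, ‖z‖ < d → HasDerivAt f (f₁ z) z) (h₂ : ∀ z, ‖z‖ < d → HasDerivAt f₁ (f₂ z) z)
    (h₃ : ∀ z, ‖z‖ < d → HasDerivAt f₂ (f₃ z) z)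
    {z : ℂ} (hz : ‖z‖ < d) (hM : ∀ u, ‖u‖ ≤ ‖z‖ → ‖f₃ u‖ ≤ M) :
    ‖f z - (f 0 + f₁ 0 * z + f₂ 0 / 2 * z ^ 2)‖ ≤ M * ‖z‖ ^ 3 := by
  have hM0 : 0 ≤ M := (norm_nonneg _).trans (hM z le_rfl)
  have h := norm_sub_taylor_zero_le (f := fun z => f z - f₁ 0 * z - f₂ 0 / 2 * z ^ 2)
    (f₁ := fun z => f₁ z - (f₁ 0 + f₂ 0 * z))
    (M := M * ‖z‖ ^ 2) (d := d) (fun u hu => by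
      have := ((h₁ u hu).sub ((hasDerivAt_id u).const_mul (f₁ 0))).sub
        (((hasDerivAt_id u).pow 2).const_mul (f₂ 0 / 2))
      refine this.congr_deriv ?_
      simp only [id]
      push_cast
      ring) hz fun u hu =>
      (norm_sub_taylor_one_le h₂ h₃ (hu.trans_lt hz) fun v hv => hM v (hv.trans hu)).trans
        (mul_le_mul_of_nonneg_left (pow_le_pow_left₀ (norm_nonneg _) hu 2) hM0)
  calc _ = ‖f z - f₁ 0 * z - f₂ 0 / 2 * z ^ 2 - (f 0 - f₁ 0 * 0 - f₂ 0 / 2 * 0 ^ 2)‖ := by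
        congr 1; ring
    _ ≤ _ := h
    _ = _ := by ring

end ComplexTaylor

/-! ### Local expansions of the exponent. -/

section LocalExpansion

variable {L : ℂ × ℂ → ℂ}

/-- Expansions of an analytic function `L` with `L = 0` and `∂L/∂b = 0` at the origin. -/
structure HasLocalExpansion (L : ℂ × ℂ → ℂ) (d M : ℝ) : Prop where
  d_pos : 0 < d
  M_nonneg : 0 ≤ M
  analytic : AnalyticOnNhd ℂ L (bidisc d d)
  bound : ∀ q ∈ bidisc d d, ‖L q‖ ≤ M
  bound_dy : ∀ q ∈ bidisc d d, ‖dy L q‖ ≤ M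
  dx_expansion : ∃ c₁ : ℂ, ∀ b : ℂ, ‖b‖ < d →
    ‖dx L (b, 0) - (dx (dx L) (0, 0) * b + c₁ * b ^ 2)‖ ≤ M * ‖b‖ ^ 3
  dy_expansion : ∃ c₁ : ℂ, ∀ b : ℂ, ‖b‖ < d →
    ‖dy L (b, 0) - (dy L (0, 0) + dx (dy L) (0, 0) * b + c₁ * b ^ 2)‖ ≤ M * ‖b‖ ^ 3
  dyy_expansion : ∃ c₁ : ℂ, ∀ b : ℂ, ‖b‖ < d →
    ‖dy (dy L) (b, 0) - (dy (dy L) (0, 0) + c₁ * b)‖ ≤ M * ‖b‖ ^ 2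
  expansion : ∀ b s : ℂ, ‖b‖ < d → ‖s‖ < d →
    ‖L (b, s) - (dy L (0, 0) * s + (dx (dx L) (0, 0) * b ^ 2 + 2 * dx (dy L) (0, 0) * b * s
      + dy (dy L) (0, 0) * s ^ 2) / 2)‖ ≤ M * (‖b‖ + ‖s‖) ^ 3

theorem exists_forall_analyticAt_and_norm_le (l : List (ℂ × ℂ → ℂ))
    (hl : ∀ f ∈ l, AnalyticAt ℂ f (0, 0)) :
    ∃ d > 0, ∃ M ≥ 0, ∀ f ∈ l, ∀ q ∈ bidisc d d, AnalyticAt ℂ f q ∧ ‖f q‖ ≤ M := by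
  induction l with
  | nil => exact ⟨1, one_pos, 0, le_rfl, fun f hf => by simp at hf⟩
  | cons f l ih =>
    obtain ⟨d, hd, M, hM, h⟩ := ih fun g hg => hl g (List.mem_cons_of_mem _ hg)
    have hf := hl f List.mem_cons_self
    have hev := hf.eventually_analyticAt.and (hf.continuousAt.norm.eventually
      (gt_mem_nhds (lt_add_one _)))
    obtain ⟨e, he, hball⟩ := Metric.eventually_nhds_iff_ball.1 hev
    have hsub : ∀ {r r' : ℝ}, r ≤ r' → bidisc r r ⊆ bidisc r' r' := fun hr =>
      Set.prod_mono (Metric.ball_subset_ball hr) (Metric.ball_subset_ball hr)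
    refine ⟨min d e, lt_min hd he, max M (‖f (0, 0)‖ + 1), le_max_of_le_left hM, fun g hg q hq => ?_⟩
    rcases List.mem_cons.1 hg with rfl | hg
    · have h1 : q ∈ bidisc e e := hsub (min_le_right _ _) hq
      rw [bidisc, ball_prod_same] at h1
      have h2 := hball q h1
      exact ⟨h2.1, h2.2.le.trans (le_max_right _ _)⟩
    · have h2 := h g hg q (hsub (min_le_left _ _) hq)
      exact ⟨h2.1, h2.2.trans (le_max_left _ _)⟩

theorem exists_hasLocalExpansion (hL : AnalyticAt ℂ L (0, 0)) (h0 : L (0, 0) = 0)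
    (h1 : dx L (0, 0) = 0) : ∃ d M, HasLocalExpansion L d M := by
  have a_x := analyticAt_dx hL
  have a_y := analyticAt_dy hL
  have a_xx := analyticAt_dx a_x
  have a_xxx := analyticAt_dx a_xx
  have a_xxxx := analyticAt_dx a_xxx
  have a_yx := analyticAt_dx a_y
  have a_yxx := analyticAt_dx a_yx
  have a_yxxx := analyticAt_dx a_yxx
  have a_yy := analyticAt_dy a_y
  have a_yyx := analyticAt_dx a_yy
  have a_yyxx := analyticAt_dx a_yyx
  have a_yyy := analyticAt_dy a_yy
  obtain ⟨d, hd, M, hM, h⟩ := exists_forall_analyticAt_and_norm_le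
    [L, dx L, dy L, dx (dx L), dx (dx (dx L)), dx (dx (dx (dx L))), dx (dy L), dx (dx (dy L)),
      dx (dx (dx (dy L))), dy (dy L), dx (dy (dy L)), dx (dx (dy (dy L))), dy (dy (dy L))]
    (by simp [*])
  simp only [List.mem_cons, List.not_mem_nil, or_false, forall_eq_or_imp, forall_eq] at h
  obtain ⟨hL', hx, hy, hxx, hxxx, hxxxx, hyx, hyxx, hyxxx, hyy, hyyx, hyyxx, hyyy⟩ := h
  have hmem : ∀ {b s : ℂ}, ‖b‖ < d → ‖s‖ < d → (b, s) ∈ bidisc d d := fun hb hs =>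
    mem_bidisc.2 ⟨hb, hs⟩
  have hd0 : ‖(0 : ℂ)‖ < d := by simpa using hd
  have hdx : ∀ {f : ℂ × ℂ → ℂ}, (∀ q ∈ bidisc d d, AnalyticAt ℂ f q ∧ ‖f q‖ ≤ M) → ∀ b : ℂ, ‖b‖ < d →
      HasDerivAt (fun b => f (b, 0)) (dx f (b, 0)) b := fun {f} hf b hb =>
    hasDerivAt_dx (p := (b, (0 : ℂ))) (hf _ (hmem hb hd0)).1.differentiableAt
  have hdy : ∀ {f : ℂ × ℂ → ℂ}, (∀ q ∈ bidisc d d, AnalyticAt ℂ f q ∧ ‖f q‖ ≤ M) → ∀ {b : ℂ},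
      ‖b‖ < d → ∀ s : ℂ, ‖s‖ < d → HasDerivAt (fun s => f (b, s)) (dy f (b, s)) s :=
    fun {f} hf {b} hb s hs =>
      hasDerivAt_dy (p := (b, s)) (hf _ (hmem hb hs)).1.differentiableAt
  have hbd : ∀ {f : ℂ × ℂ → ℂ}, (∀ q ∈ bidisc d d, AnalyticAt ℂ f q ∧ ‖f q‖ ≤ M) → ∀ {b : ℂ},
      ‖b‖ < d → ∀ u : ℂ, ‖u‖ ≤ ‖b‖ → ‖f (u, 0)‖ ≤ M := fun {f} hf {b} hb u hu =>
    (hf _ (hmem (hu.trans_lt hb) hd0)).2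
  refine ⟨d, M, hd, hM, fun q hq => (hL' q hq).1, fun q hq => (hL' q hq).2, fun q hq => (hy q hq).2,
    ⟨dx (dx (dx L)) (0, 0) / 2, fun b hb => ?_⟩, ⟨dx (dx (dy L)) (0, 0) / 2, fun b hb => ?_⟩,
    ⟨dx (dy (dy L)) (0, 0), fun b hb => ?_⟩, fun b s hb hs => ?_⟩
  · have := norm_sub_taylor_two_le' (hdx hx) (hdx hxx) (hdx hxxx) hb (hbd hxxxx hb)
    rwa [h1, zero_add] at this
  · exact norm_sub_taylor_two_le' (hdx hy) (hdx hyx) (hdx hyxx) hb (hbd hyxxx hb)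
  · exact norm_sub_taylor_one_le (hdx hyy) (hdx hyyx) hb (hbd hyyxx hb)
  · have e1 := norm_sub_taylor_two_le' (hdy hL' hb) (hdy hy hb) (hdy hyy hb) hs
      fun u hu => (hyyy _ (hmem hb (hu.trans_lt hs))).2
    have e2 := norm_sub_taylor_two_le' (hdx hL') (hdx hx) (hdx hxx) hb (hbd hxxx hb)
    have e3 := norm_sub_taylor_one_le (hdx hy) (hdx hyx) hb (hbd hyxx hb)
    have e4 := norm_sub_taylor_zero_le (hdx hyy) hb (hbd hyyx hb)
    rw [h0, h1] at e2
    -- Expand in s at (b, 0) to order two, then the coefficients L, L_s, L_ss at (b, 0) in b to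
    -- orders two, one and zero.
    have e : L (b, s) - (dy L (0, 0) * s + (dx (dx L) (0, 0) * b ^ 2 + 2 * dx (dy L) (0, 0) * b * s
        + dy (dy L) (0, 0) * s ^ 2) / 2)
        = (L (b, s) - (L (b, 0) + dy L (b, 0) * s + dy (dy L) (b, 0) / 2 * s ^ 2))
        + (L (b, 0) - (0 + 0 * b + dx (dx L) (0, 0) / 2 * b ^ 2))
        + (dy L (b, 0) - (dy L (0, 0) + dx (dy L) (0, 0) * b)) * s
        + (dy (dy L) (b, 0) - dy (dy L) (0, 0)) * (s ^ 2 / 2) := by ring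
    rw [e]
    refine norm_add₄_le.trans ?_
    rw [norm_mul, norm_mul, norm_div, norm_pow, Complex.norm_ofNat]
    have g3 := mul_le_mul_of_nonneg_right e3 (norm_nonneg s)
    have g4 := mul_le_mul_of_nonneg_right e4 (show 0 ≤ ‖s‖ ^ 2 / 2 by positivity)
    have hb0 := norm_nonneg b
    have hs0 := norm_nonneg s
    have e5 : M * (‖b‖ + ‖s‖) ^ 3 = M * ‖s‖ ^ 3 + M * ‖b‖ ^ 3 + M * ‖b‖ ^ 2 * ‖s‖
        + M * ‖b‖ * (‖s‖ ^ 2 / 2) + (2 * (M * ‖b‖ ^ 2 * ‖s‖) + 5 / 2 * (M * ‖b‖ * ‖s‖ ^ 2)) := by ring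
    have e6 : 0 ≤ 2 * (M * ‖b‖ ^ 2 * ‖s‖) + 5 / 2 * (M * ‖b‖ * ‖s‖ ^ 2) := by positivity
    linarith

end LocalExpansion

end SingleEquation

namespace SingleEquation

/-! ### Roots in terms of the exponent; normalized coefficients. -/

section RootExponent

variable {F F₁ F₂ G : ℂ × ℂ → ℂ} {Ft : ℝ → ℂ × ℂ → ℂ} {R S x₀ y₀ B C ε δ₀ η₀ κ : ℝ}
  {L : ℂ × ℂ → ℂ}

/-- Both sides solve the same equation in a disc on which it has at most one solution, by expansion.
-/
theorem IsSmoothFamily.exists_root_eq (hfam : IsSmoothFamily F F₁ F₂ Ft R S x₀ y₀ B C)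
    (hrf : HasRootFunction F R S x₀ y₀ ε δ₀ η₀ κ) (hL : IsExponent F F₁ F₂ x₀ y₀ L) :
    ∃ e > 0, e ≤ δ₀ ∧ e ≤ 1 ∧ (∀ s : ℂ, ‖s‖ ≤ e → IsNear F (taylorPoly F F₁ F₂ s) R S η₀) ∧
      (∀ t : ℝ, |t| ≤ e → IsNear F (Ft t) R S η₀) ∧
      ∀ β : ℝ, |β| ≤ e → ∀ s : ℂ, ‖s‖ ≤ e →
        root (taylorPoly F F₁ F₂ s) x₀ ε (circleMap 0 y₀ β) = x₀ * Complex.exp (L (β, s)) := by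
  obtain ⟨e₁, he₁, hn₁⟩ := hfam.exists_isNear_taylorPoly hrf.η_pos
  obtain ⟨e₂, he₂, hn₂⟩ := hfam.exists_isNear hrf.η_pos
  have hc : Tendsto (fun q => (x₀ : ℂ) * Complex.exp (L q)) (𝓝 (0, 0)) (𝓝 (x₀ : ℂ)) := by
    have h1 : ContinuousAt (fun q => (x₀ : ℂ) * Complex.exp (L q)) (0, 0) :=
      continuousAt_const.mul hL.analyticAt.continuousAt.cexp
    rw [ContinuousAt] at h1
    simpa [hL.map_zero] using h1
  have hev := (hc.eventually (Metric.closedBall_mem_nhds _ hrf.ε_pos)).and hL.eq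
  obtain ⟨e₃, he₃, hball⟩ := Metric.eventually_nhds_iff_ball.1 hev
  refine ⟨min (min e₁ e₂) (min (min δ₀ 1) (e₃ / 2)), by have := hrf.δ_pos; positivity, ?_, ?_,
    fun s hs => hn₁ s (hs.trans ((min_le_left _ _).trans (min_le_left _ _))),
    fun t ht => hn₂ t (ht.trans ((min_le_left _ _).trans (min_le_right _ _))),
    fun β hβ s hs => ?_⟩
  · exact (min_le_right _ _).trans ((min_le_left _ _).trans (min_le_left _ _))
  · exact (min_le_right _ _).trans ((min_le_left _ _).trans (min_le_right _ _))
  have hnear := hn₁ s (hs.trans ((min_le_left _ _).trans (min_le_left _ _)))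
  have hβδ : |β| ≤ δ₀ := hβ.trans ((min_le_right _ _).trans ((min_le_left _ _).trans (min_le_left _ _)))
  have he : ∀ {z : ℝ}, z ≤ min (min e₁ e₂) (min (min δ₀ 1) (e₃ / 2)) → z < e₃ := fun hz =>
    (hz.trans ((min_le_right _ _).trans (min_le_right _ _))).trans_lt (half_lt_self he₃)
  obtain ⟨h1, h2⟩ := hball ((β : ℂ), s) (by
    rw [← ball_prod_same]
    refine ⟨?_, ?_⟩
    · simpa using he hβ
    · simpa using he hs)
  have hw : circleMap 0 y₀ β = y₀ * Complex.exp (β * Complex.I) := by simp [circleMap]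
  have h3 := hrf.expand _ hnear β hβδ _ (hrf.root_mem _ hnear β hβδ) _ h1
  rw [hrf.root_eq _ hnear β hβδ, hw, h2, sub_self, norm_zero] at h3
  have h4 := le_antisymm (nonpos_of_mul_nonpos_right h3 hrf.κ_pos) (norm_nonneg _)
  rw [hw]
  exact sub_eq_zero.1 (norm_eq_zero.1 h4)

/-- The two equations differ by the Taylor remainder, and expansion divides this by κ. -/
theorem IsSmoothFamily.norm_root_sub_le (hfam : IsSmoothFamily F F₁ F₂ Ft R S x₀ y₀ B C)
    (hrf : HasRootFunction F R S x₀ y₀ ε δ₀ η₀ κ) {t β : ℝ} (ht : |t| ≤ 1) (hβ : |β| ≤ δ₀)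
    (h1 : IsNear F (Ft t) R S η₀) (h2 : IsNear F (taylorPoly F F₁ F₂ t) R S η₀) :
    ‖root (Ft t) x₀ ε (circleMap 0 y₀ β) - root (taylorPoly F F₁ F₂ t) x₀ ε (circleMap 0 y₀ β)‖
      ≤ C / κ * |t| ^ 3 := by
  have h3 := hrf.norm_root_sub_le h1 h2 hβ hβ
  have h4 := hrf.root_eq _ h2 β hβ
  set X := root (taylorPoly F F₁ F₂ t) x₀ ε (circleMap 0 y₀ β) with hX
  have hm : (X, circleMap 0 y₀ β) ∈ bidisc R S := mem_bidisc.2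
    ⟨norm_lt_of_mem_closedBall hfam.dominant.x_pos hrf.ε_lt' (hrf.root_mem _ h2 β hβ),
      by rw [norm_circleMap_zero hfam.dominant.y_pos.le]; exact hfam.dominant.y_lt⟩
  have h5 := hfam.taylor t ht _ hm
  rw [h4, norm_sub_rev] at h5
  rw [div_mul_eq_mul_div, le_div_iff₀' hrf.κ_pos]
  exact h3.trans h5

theorem IsSmoothFamily.exists_dxx_eq (hfam : IsSmoothFamily F F₁ F₂ Ft R S x₀ y₀ B C)
    (hL : IsExponent F F₁ F₂ x₀ y₀ L) : ∃ v : ℝ, 0 < v ∧ dx (dx L) (0, 0) = v := by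
  obtain ⟨u, hu, hu'⟩ := hfam.dx_pos
  obtain ⟨w, hw, hw'⟩ := hfam.dyy_pos
  have h := (hL.dx_eq_and_dxx_eq (hfam.dominant.analytic _ hfam.dominant.mem) hfam.dy_eq
    hfam.dominant.dx_ne hfam.dominant.x_pos).2
  have hy := hfam.dominant.y_pos
  have hx := hfam.dominant.x_pos
  refine ⟨y₀ ^ 2 * w / (x₀ * u), by positivity, ?_⟩
  rw [h, hu', hw']
  push_cast
  rfl

theorem IsSmoothFamily.exists_hasLocalExpansion
    (hfam : IsSmoothFamily F F₁ F₂ Ft R S x₀ y₀ B C) (hL : IsExponent F F₁ F₂ x₀ y₀ L) :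
    ∃ d M, HasLocalExpansion L d M :=
  SingleEquation.exists_hasLocalExpansion hL.analyticAt hL.map_zero
    (hL.dx_eq_and_dxx_eq (hfam.dominant.analytic _ hfam.dominant.mem) hfam.dy_eq
      hfam.dominant.dx_ne hfam.dominant.x_pos).1

/-- The normalization `2π x₀ⁿ / y₀` of the coefficients. -/
noncomputable def scale (x₀ y₀ : ℝ) (n : ℕ) : ℂ := 2 * Real.pi / y₀ * x₀ ^ n

theorem scale_ne_zero (hx₀ : 0 < x₀) (hy₀ : 0 < y₀) (n : ℕ) : scale x₀ y₀ n ≠ 0 := by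
  have h1 : (x₀ : ℂ) ≠ 0 := Complex.ofReal_ne_zero.2 hx₀.ne'
  have h2 : (y₀ : ℂ) ≠ 0 := Complex.ofReal_ne_zero.2 hy₀.ne'
  have h3 : (Real.pi : ℂ) ≠ 0 := Complex.ofReal_ne_zero.2 Real.pi_pos.ne'
  exact mul_ne_zero (div_ne_zero (mul_ne_zero two_ne_zero h3) h2) (pow_ne_zero _ h1)

theorem norm_scale (hx₀ : 0 < x₀) (hy₀ : 0 < y₀) (n : ℕ) :
    ‖scale x₀ y₀ n‖ = 2 * Real.pi / y₀ * x₀ ^ n := by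
  rw [scale, norm_mul, norm_div, norm_mul, norm_pow, Complex.norm_real, Complex.norm_real,
    Complex.norm_real, Real.norm_of_nonneg Real.pi_pos.le, Real.norm_of_nonneg hx₀.le,
    Real.norm_of_nonneg hy₀.le, Complex.norm_ofNat]

/-- The factor w = y₀e^{iβ} from the contour element is the origin of the e^{iβ} carried by all the
Laplace integrals. -/
theorem scale_mul_mainPart (hx₀ : 0 < x₀) (hy₀ : 0 < y₀) {δ : ℝ} (hδ : 0 ≤ δ) {Λ : ℝ → ℂ}
    (h : ∀ β : ℝ, |β| ≤ δ → root G x₀ ε (circleMap 0 y₀ β) = x₀ * Complex.exp (Λ β)) (n : ℕ) :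
    scale x₀ y₀ n * mainPart G x₀ y₀ ε δ n
      = ∫ β in (-δ)..δ, Complex.exp (β * Complex.I) * Complex.exp (-(n * Λ β)) := by
  have h1 : (x₀ : ℂ) ≠ 0 := Complex.ofReal_ne_zero.2 hx₀.ne'
  have h2 : (y₀ : ℂ) ≠ 0 := Complex.ofReal_ne_zero.2 hy₀.ne'
  have h3 : (Real.pi : ℂ) ≠ 0 := Complex.ofReal_ne_zero.2 Real.pi_pos.ne'
  rw [mainPart, ← mul_assoc, ← intervalIntegral.integral_const_mul]
  refine intervalIntegral.integral_congr fun β hβ => ?_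
  rw [Set.uIcc_of_le (by linarith)] at hβ
  rw [h β (abs_le.2 hβ), scale, circleMap, zero_add, mul_pow, mul_inv, ← Complex.exp_nat_mul,
    Complex.exp_neg]
  field_simp

/-- Localization, normalized. -/
theorem HasLocalization.exists_norm_scale_mul_sub_le (hloc : HasLocalization F R S x₀ y₀ ε δ₀ η₀ κ)
    (hx₀ : 0 < x₀) (hy₀ : 0 < y₀) {δ : ℝ} (hδ : 0 < δ) (hδ₀ : δ ≤ δ₀) :
    ∃ q, 0 ≤ q ∧ q < 1 ∧ ∃ η > 0, η ≤ η₀ ∧ ∃ K, ∀ G, IsNear F G R S η → ∀ r, 0 < r → r < x₀ - ε →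
      ∀ n, ‖scale x₀ y₀ n * doubleCoeff G y₀ n r - scale x₀ y₀ n * mainPart G x₀ y₀ ε δ n‖
        ≤ K * q ^ n := by
  obtain ⟨ρ, hρ, η, hη, hηη₀, K, hK⟩ := hloc.approx δ hδ hδ₀
  have hρ0 : 0 < ρ := hx₀.trans hρ
  refine ⟨x₀ / ρ, by positivity, (div_lt_one hρ0).2 hρ, η, hη, hηη₀, 2 * Real.pi / y₀ * K,
    fun G hG r hr hrε n => ?_⟩
  rw [← mul_sub, norm_mul, norm_scale hx₀ hy₀]
  calc _ ≤ 2 * Real.pi / y₀ * x₀ ^ n * (K * (ρ⁻¹) ^ n) :=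
        mul_le_mul_of_nonneg_left (hK G hG r hr hrε n) (by positivity)
    _ = _ := by rw [div_pow, inv_pow]; ring

/-- Cauchy's estimates on the disc of half the radius. This is the benefit of a complex s: uniform
errors pass to derivatives. -/
theorem norm_deriv_sub_deriv_le {f g : ℂ → ℂ} {d K : ℝ} (hd : 0 < d)
    (hf : DifferentiableOn ℂ f (Metric.ball 0 d)) (hg : DifferentiableOn ℂ g (Metric.ball 0 d))
    (h : ∀ s ∈ Metric.ball (0 : ℂ) d, ‖f s - g s‖ ≤ K) :
    ‖deriv f 0 - deriv g 0‖ ≤ K * (2 / d) ∧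
      ‖deriv (deriv f) 0 - deriv (deriv g) 0‖ ≤ K * (2 * (2 / d) ^ 2) := by
  have hball : Metric.ball (0 : ℂ) d ∈ 𝓝 0 := Metric.ball_mem_nhds _ hd
  have hsub : (f - g) = fun s => f s - g s := rfl
  have hcl : DiffContOnCl ℂ (f - g) (Metric.ball 0 (d / 2)) := by
    refine DifferentiableOn.diffContOnCl ((hf.sub hg).mono ?_)
    rw [closure_ball _ (by positivity)]
    exact Metric.closedBall_subset_ball (half_lt_self hd)
  have hb : ∀ z ∈ Metric.sphere (0 : ℂ) (d / 2), ‖(f - g) z‖ ≤ K := fun z hz =>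
    h z (Metric.sphere_subset_ball (half_lt_self hd) hz)
  have h1 := Complex.norm_iteratedDeriv_le_of_forall_mem_sphere_norm_le 1 (half_pos hd) hcl hb
  have h2 := Complex.norm_iteratedDeriv_le_of_forall_mem_sphere_norm_le 2 (half_pos hd) hcl hb
  have e1 : deriv (f - g) =ᶠ[𝓝 0] fun s => deriv f s - deriv g s := by
    filter_upwards [hball] with s hs
    have hs' := Metric.isOpen_ball.mem_nhds hs
    exact deriv_sub (hf.differentiableAt hs') (hg.differentiableAt hs')
  rw [iteratedDeriv_one, e1.self_of_nhds] at h1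
  have hf' := (hf.deriv Metric.isOpen_ball).differentiableAt hball
  have hg' := (hg.deriv Metric.isOpen_ball).differentiableAt hball
  rw [show iteratedDeriv 2 (f - g) = deriv (deriv (f - g)) by
    rw [iteratedDeriv_succ, iteratedDeriv_one], e1.deriv_eq] at h2
  have e2 : deriv (fun s => deriv f s - deriv g s) 0 = deriv (deriv f) 0 - deriv (deriv g) 0 :=
    deriv_sub hf' hg'
  rw [e2] at h2
  refine ⟨h1.trans (le_of_eq ?_), h2.trans (le_of_eq ?_)⟩
  · simp; field_simp
  · simp [Nat.factorial]; field_simp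

end RootExponent

end SingleEquation

namespace SingleEquation

/-! ### Laplace integrals depending on the parameter. -/

section LaplaceOfExpansion

variable {L : ℂ × ℂ → ℂ} {d M δ κ : ℝ}

/-- The Laplace integral of `e^{-n L(β, s)}`. -/
noncomputable def expIntegral (L : ℂ × ℂ → ℂ) (δ : ℝ) (n : ℕ) (s : ℂ) : ℂ :=
  ∫ β in (-δ)..δ, Complex.exp ((β : ℂ) * Complex.I) * Complex.exp (-(n * L ((β : ℂ), s)))

theorem ofReal_mem_bidisc (hδd : δ < d) {β : ℝ} (hβ : β ∈ Set.Icc (-δ) δ) {s : ℂ}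
    (hs : s ∈ Metric.ball (0 : ℂ) d) : ((β : ℂ), s) ∈ bidisc d d :=
  mem_bidisc.2 ⟨by rw [Complex.norm_real]; exact (abs_le.2 hβ).trans_lt hδd, by simpa using hs⟩

theorem continuousOn_slice {f : ℂ × ℂ → ℂ} (hf : ∀ q ∈ bidisc d d, AnalyticAt ℂ f q) (hδd : δ < d)
    {s : ℂ} (hs : s ∈ Metric.ball (0 : ℂ) d) :
    ContinuousOn (fun β : ℝ => f ((β : ℂ), s)) (Set.Icc (-δ) δ) := fun β hβ =>
  (ContinuousAt.comp (g := f) (f := fun β : ℝ => ((β : ℂ), s))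
    (hf _ (ofReal_mem_bidisc hδd hβ hs)).continuousAt (by fun_prop)).continuousWithinAt

theorem HasLocalExpansion.norm_exp_le (h : HasLocalExpansion L d M) (n : ℕ) (β : ℝ) {q : ℂ × ℂ}
    (hq : q ∈ bidisc d d) :
    ‖Complex.exp ((β : ℂ) * Complex.I) * Complex.exp (-(n * L q))‖ ≤ Real.exp (n * M) := by
  rw [norm_mul, Complex.norm_exp_ofReal_mul_I, one_mul]
  refine (Complex.norm_exp_le_exp_norm _).trans (Real.exp_le_exp.2 ?_)
  rw [norm_neg, norm_mul, Complex.norm_natCast]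
  exact mul_le_mul_of_nonneg_left (h.bound q hq) (Nat.cast_nonneg n)

theorem HasLocalExpansion.hasDerivAt_expIntegral (h : HasLocalExpansion L d M) (hδ : 0 < δ)
    (hδd : δ < d) (n : ℕ) {s : ℂ} (hs : s ∈ Metric.ball (0 : ℂ) d) :
    HasDerivAt (expIntegral L δ n) (∫ β in (-δ)..δ, Complex.exp ((β : ℂ) * Complex.I)
      * Complex.exp (-(n * L ((β : ℂ), s))) * (-(n * dy L ((β : ℂ), s)))) s := by
  have hu : Set.uIcc (-δ) δ = Set.Icc (-δ) δ := Set.uIcc_of_le (by linarith)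
  have hder : ∀ β ∈ Set.Icc (-δ) δ, ∀ s ∈ Metric.ball (0 : ℂ) d,
      HasDerivAt (fun s => Complex.exp ((β : ℂ) * Complex.I) * Complex.exp (-(n * L ((β : ℂ), s))))
        (Complex.exp ((β : ℂ) * Complex.I) * Complex.exp (-(n * L ((β : ℂ), s)))
          * (-(n * dy L ((β : ℂ), s)))) s := fun β hβ s hs => by
    have h1 := hasDerivAt_dy (h.analytic _ (ofReal_mem_bidisc hδd hβ hs)).differentiableAt
    exact (((h1.const_mul (n : ℂ)).neg.cexp).const_mul _).congr_deriv (by simp only [Pi.neg_apply]; ring)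
  have := hasDerivAt_intervalIntegral_of_bounded
    (K := fun β s => Complex.exp ((β : ℂ) * Complex.I) * Complex.exp (-(n * L ((β : ℂ), s))))
    (a := -δ) (b := δ) (d := d) (M := Real.exp (n * M)) (fun s hs => by
      rw [hu]
      exact ContinuousOn.mul (Continuous.continuousOn (by fun_prop))
        ((continuousOn_slice h.analytic hδd hs).const_mul _).neg.cexp)
    (fun β hβ s hs => h.norm_exp_le n β (ofReal_mem_bidisc hδd (hu ▸ hβ) hs))
    (fun β hβ s hs => (hder β (hu ▸ hβ) s hs).differentiableAt.differentiableWithinAt) hs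
  refine this.congr_deriv (intervalIntegral.integral_congr fun β hβ => ?_)
  exact (hder β (hu ▸ hβ) s hs).deriv

theorem HasLocalExpansion.deriv_expIntegral (h : HasLocalExpansion L d M) (hδ : 0 < δ)
    (hδd : δ < d) (n : ℕ) :
    deriv (expIntegral L δ n) 0 = -(n * laplaceIntegral (fun β => L ((β : ℂ), 0)) δ
      (fun β => dy L ((β : ℂ), 0)) n) := by
  rw [(h.hasDerivAt_expIntegral hδ hδd n (Metric.mem_ball_self h.d_pos)).deriv, laplaceIntegral,
    ← intervalIntegral.integral_const_mul, ← intervalIntegral.integral_neg]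
  congr 1
  ext β
  ring

theorem HasLocalExpansion.deriv_deriv_expIntegral (h : HasLocalExpansion L d M) (hδ : 0 < δ)
    (hδd : δ < d) (n : ℕ) :
    deriv (deriv (expIntegral L δ n)) 0
      = n ^ 2 * laplaceIntegral (fun β => L ((β : ℂ), 0)) δ (fun β => dy L ((β : ℂ), 0) ^ 2) n
      - n * laplaceIntegral (fun β => L ((β : ℂ), 0)) δ (fun β => dy (dy L) ((β : ℂ), 0)) n := by
  have hu : Set.uIcc (-δ) δ = Set.Icc (-δ) δ := Set.uIcc_of_le (by linarith)
  have h0 : (0 : ℂ) ∈ Metric.ball (0 : ℂ) d := Metric.mem_ball_self h.d_pos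
  have hev : deriv (expIntegral L δ n) =ᶠ[𝓝 0] fun s => ∫ β in (-δ)..δ,
      Complex.exp ((β : ℂ) * Complex.I) * Complex.exp (-(n * L ((β : ℂ), s)))
        * (-(n * dy L ((β : ℂ), s))) := by
    filter_upwards [Metric.isOpen_ball.mem_nhds h0] with s hs
    exact (h.hasDerivAt_expIntegral hδ hδd n hs).deriv
  have hdy : ∀ q ∈ bidisc d d, AnalyticAt ℂ (dy L) q := fun q hq => analyticAt_dy (h.analytic q hq)
  have hder : ∀ β ∈ Set.Icc (-δ) δ, ∀ s ∈ Metric.ball (0 : ℂ) d,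
      HasDerivAt (fun s => Complex.exp ((β : ℂ) * Complex.I) * Complex.exp (-(n * L ((β : ℂ), s)))
        * (-(n * dy L ((β : ℂ), s))))
        (Complex.exp ((β : ℂ) * Complex.I) * Complex.exp (-(n * L ((β : ℂ), s)))
          * ((n * dy L ((β : ℂ), s)) ^ 2 - n * dy (dy L) ((β : ℂ), s))) s := fun β hβ s hs => by
    have hm := ofReal_mem_bidisc hδd hβ hs
    have h1 := hasDerivAt_dy (h.analytic _ hm).differentiableAt
    have h2 := hasDerivAt_dy (hdy _ hm).differentiableAt
    exact ((((h1.const_mul (n : ℂ)).neg.cexp).const_mul _).mul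
      (h2.const_mul (n : ℂ)).neg).congr_deriv (by simp only [Pi.neg_apply]; ring)
  have := hasDerivAt_intervalIntegral_of_bounded
    (K := fun β s => Complex.exp ((β : ℂ) * Complex.I) * Complex.exp (-(n * L ((β : ℂ), s)))
      * (-(n * dy L ((β : ℂ), s))))
    (a := -δ) (b := δ) (d := d) (M := Real.exp (n * M) * (n * M)) (fun s hs => by
      rw [hu]
      exact ContinuousOn.mul (ContinuousOn.mul (Continuous.continuousOn (by fun_prop))
        ((continuousOn_slice h.analytic hδd hs).const_mul _).neg.cexp)
        ((continuousOn_slice hdy hδd hs).const_mul _).neg)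
    (fun β hβ s hs => by
      have hm := ofReal_mem_bidisc hδd (hu ▸ hβ) hs
      rw [norm_mul]
      refine mul_le_mul (h.norm_exp_le n β hm) ?_ (norm_nonneg _) (Real.exp_pos _).le
      rw [norm_neg, norm_mul, Complex.norm_natCast]
      exact mul_le_mul_of_nonneg_left (h.bound_dy _ hm) (Nat.cast_nonneg n))
    (fun β hβ s hs => (hder β (hu ▸ hβ) s hs).differentiableAt.differentiableWithinAt) h0
  rw [hev.deriv_eq, this.deriv, laplaceIntegral, laplaceIntegral,
    ← intervalIntegral.integral_const_mul, ← intervalIntegral.integral_const_mul,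
    ← intervalIntegral.integral_sub]
  · refine intervalIntegral.integral_congr fun β hβ => ?_
    refine (hder β (hu ▸ hβ) 0 h0).deriv.trans ?_
    ring
  · exact (intervalIntegrable_laplace (g := fun β : ℝ => dy L ((β : ℂ), 0) ^ 2) hδ
      (continuousOn_slice h.analytic hδd h0) ((continuousOn_slice hdy hδd h0).pow 2) n).const_mul _
  · exact (intervalIntegrable_laplace (g := fun β : ℝ => dy (dy L) ((β : ℂ), 0)) hδ
      (continuousOn_slice h.analytic hδd h0)
      (continuousOn_slice (fun q hq => analyticAt_dy (hdy q hq)) hδd h0) n).const_mul _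

theorem HasLocalExpansion.expIntegral_zero (n : ℕ) :
    expIntegral L δ n 0 = laplaceIntegral (fun β => L ((β : ℂ), 0)) δ (fun _ => 1) n := by
  simp [expIntegral, laplaceIntegral]

/-- The quadratic form contributes κβ²/2, and the cubic error takes away at most κβ²/32. -/
theorem HasLocalExpansion.le_re (h : HasLocalExpansion L d M) (hκ : dx (dx L) (0, 0) = κ)
    (hκ0 : 0 < κ) (hδd : δ < d) (hMδ : 32 * M * δ ≤ κ) {β : ℝ} (hβ : β ∈ Set.Icc (-δ) δ) :
    κ / 4 * β ^ 2 ≤ (L ((β : ℂ), 0)).re := by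
  have hβ' : |β| ≤ δ := abs_le.2 hβ
  have h1 := h.expansion β 0 (by rw [Complex.norm_real]; exact hβ'.trans_lt hδd)
    (by rw [norm_zero]; exact h.d_pos)
  rw [hκ, norm_zero, add_zero, Complex.norm_real] at h1
  have h2 := (Complex.abs_re_le_norm _).trans h1
  have e : (L ((β : ℂ), 0) - (dy L (0, 0) * 0 + (κ * (β : ℂ) ^ 2 + 2 * dx (dy L) (0, 0) * β * 0
      + dy (dy L) (0, 0) * 0 ^ 2) / 2)).re = (L ((β : ℂ), 0)).re - κ * β ^ 2 / 2 := by
    rw [Complex.sub_re]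
    congr 1
    rw [show dy L (0, 0) * 0 + (κ * (β : ℂ) ^ 2 + 2 * dx (dy L) (0, 0) * β * 0
      + dy (dy L) (0, 0) * 0 ^ 2) / 2 = ((κ * β ^ 2 / 2 : ℝ) : ℂ) by push_cast; ring,
      Complex.ofReal_re]
  rw [e, Real.norm_eq_abs] at h2
  have h3 := (abs_le.1 h2).1
  have h4 : M * |β| ^ 3 ≤ κ / 32 * β ^ 2 := by
    have h5 : M * |β| ≤ κ / 32 := by
      have := mul_le_mul_of_nonneg_left hβ' h.M_nonneg
      linarith
    calc M * |β| ^ 3 = M * |β| * |β| ^ 2 := by ring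
      _ ≤ κ / 32 * |β| ^ 2 := mul_le_mul_of_nonneg_right h5 (by positivity)
      _ = _ := by rw [sq_abs]
  nlinarith [sq_nonneg β]

/-- Laplace's method at t = 0 shows that √n times the integral has a nonzero limit; this lower bound
permits division by the zeroth moment. -/
theorem HasLocalExpansion.invSqrt_isBigO (h : HasLocalExpansion L d M) (hκ : dx (dx L) (0, 0) = κ)
    (hκ0 : 0 < κ) (hδ : 0 < δ) (hδd : δ < d) (hMδ : 32 * M * δ ≤ κ) :
    invSqrt =O[atTop] laplaceIntegral (fun β => L ((β : ℂ), 0)) δ (fun _ => 1) := by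
  have h0 : (0 : ℂ) ∈ Metric.ball (0 : ℂ) d := Metric.mem_ball_self h.d_pos
  have ht := tendsto_sqrt_mul_integral_exp (m := dx (dy L) (0, 0)) (p := dy (dy L) (0, 0)) (τ := 0)
    hκ0 hδ h.M_nonneg hMδ
    (Λ := fun _ β => L ((β : ℂ), 0)) (t := fun _ => 0) (a := fun β : ℝ => Complex.exp (β * Complex.I))
    (by fun_prop) (by simp) (Eventually.of_forall fun _ => continuousOn_slice h.analytic hδd h0)
    (Eventually.of_forall fun _ β hβ => by
      have h1 := h.expansion β 0 (by rw [Complex.norm_real]; exact (abs_le.2 hβ).trans_lt hδd)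
        (by rw [norm_zero]; exact h.d_pos)
      rw [hκ] at h1
      simpa using h1)
  have hne : (Complex.exp (((0 : ℝ) : ℂ) * Complex.I) * ((2 * Real.pi / κ : ℂ) ^ (1 / 2 : ℂ)
      * Complex.exp ((dx (dy L) (0, 0) ^ 2 / κ - dy (dy L) (0, 0)) * ((0 : ℝ) : ℂ) ^ 2 / 2))) ≠ 0 := by
    refine mul_ne_zero (Complex.exp_ne_zero _) (mul_ne_zero ?_ (Complex.exp_ne_zero _))
    refine Complex.cpow_ne_zero_iff.2 (Or.inl ?_)
    exact div_ne_zero (mul_ne_zero two_ne_zero (Complex.ofReal_ne_zero.2 Real.pi_pos.ne'))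
      (Complex.ofReal_ne_zero.2 hκ0.ne')
  have h1 := ht.norm.eventually (lt_mem_nhds (half_lt_self (norm_pos_iff.2 hne)))
  set c := ‖Complex.exp (((0 : ℝ) : ℂ) * Complex.I) * ((2 * Real.pi / κ : ℂ) ^ (1 / 2 : ℂ)
      * Complex.exp ((dx (dy L) (0, 0) ^ 2 / κ - dy (dy L) (0, 0)) * ((0 : ℝ) : ℂ) ^ 2 / 2))‖ / 2
    with hc
  have hc0 : 0 < c := half_pos (norm_pos_iff.2 hne)
  refine IsBigO.of_bound c⁻¹ ?_
  filter_upwards [h1, eventually_ge_atTop 1] with n hn hn1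
  have hs : 0 < Real.sqrt n := Real.sqrt_pos.2 (by exact_mod_cast hn1)
  have e : laplaceIntegral (fun β => L ((β : ℂ), 0)) δ (fun _ => 1) n
      = ∫ β in (-δ)..δ, Complex.exp (β * Complex.I) * Complex.exp (-(n * L ((β : ℂ), 0))) := by
    simp [laplaceIntegral]
  rw [norm_mul, Complex.norm_real, Real.norm_of_nonneg hs.le, ← e] at hn
  rw [Real.norm_of_nonneg (invSqrt_pos hn1).le, invSqrt, inv_mul_eq_div, le_div_iff₀ hc0,
    inv_mul_eq_div, div_le_iff₀ hs]
  linarith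

end LaplaceOfExpansion

end SingleEquation

namespace SingleEquation

/-! ### Logarithmic derivatives of the coefficients. -/

section CoefficientMoments

variable {F F₁ F₂ G : ℂ × ℂ → ℂ} {Ft : ℝ → ℂ × ℂ → ℂ} {R S x₀ y₀ B C ε δ₀ η₀ κ v r : ℝ}
  {L : ℂ × ℂ → ℂ}

theorem IsSmoothFamily.differentiableOn_doubleCoeff
    (hfam : IsSmoothFamily F F₁ F₂ Ft R S x₀ y₀ B C)
    (hrf : HasRootFunction F R S x₀ y₀ ε δ₀ η₀ κ) {d : ℝ}
    (hn : ∀ s ∈ Metric.ball (0 : ℂ) d, IsNear F (taylorPoly F F₁ F₂ s) R S η₀) (hr : 0 < r)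
    (hrε : r < x₀ - ε) (n : ℕ) :
    DifferentiableOn ℂ (fun s => doubleCoeff (taylorPoly F F₁ F₂ s) y₀ n r) (Metric.ball 0 d) := by
  refine SingleEquation.differentiableOn_doubleCoeff hrf hfam.dominant hn (fun p _ => ?_)
    (fun p hp => ?_) hr hrε n
  · simp only [taylorPoly]
    fun_prop
  · simp only [dx_taylorPoly (hfam.dominant.analytic p hp) (hfam.analytic₁ p hp)
      (hfam.analytic₂ p hp), taylorPoly]
    fun_prop

/-- Logarithmic derivatives of the coefficients along the Taylor polynomial. -/
theorem IsSmoothFamily.cumulants (hfam : IsSmoothFamily F F₁ F₂ Ft R S x₀ y₀ B C)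
    (hloc : HasLocalization F R S x₀ y₀ ε δ₀ η₀ κ) (hL : IsExponent F F₁ F₂ x₀ y₀ L)
    (hr : 0 < r) (hrε : r < x₀ - ε) :
    (∀ᶠ n in atTop, doubleCoeff F y₀ n r ≠ 0) ∧
    ((fun n : ℕ => deriv (fun s => doubleCoeff (taylorPoly F F₁ F₂ s) y₀ n r) 0 / doubleCoeff F y₀ n r
      + n * dy L (0, 0)) =O[atTop] fun _ => (1 : ℝ)) ∧
    ((fun n : ℕ => deriv (deriv (fun s => doubleCoeff (taylorPoly F F₁ F₂ s) y₀ n r)) 0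
        / doubleCoeff F y₀ n r
      - (deriv (fun s => doubleCoeff (taylorPoly F F₁ F₂ s) y₀ n r) 0 / doubleCoeff F y₀ n r) ^ 2
      - n * (dx (dy L) (0, 0) ^ 2 / dx (dx L) (0, 0) - dy (dy L) (0, 0)))
      =O[atTop] fun _ => (1 : ℝ)) := by
  have hx₀ := hfam.dominant.x_pos
  have hy₀ := hfam.dominant.y_pos
  have hrf := hloc.toHasRootFunction
  obtain ⟨e, he, heδ, -, hnT, -, hroot⟩ := hfam.exists_root_eq hrf hL
  obtain ⟨v, hv, hvL⟩ := hfam.exists_dxx_eq hL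
  obtain ⟨d, M, hexp⟩ := hfam.exists_hasLocalExpansion hL
  have hM := hexp.M_nonneg
  have hd := hexp.d_pos
  obtain ⟨δ, hδ, hδe, hδd, hMδ⟩ : ∃ δ > 0, δ ≤ e ∧ δ < d ∧ 32 * M * δ ≤ v := by
    refine ⟨min e (min (d / 2) (v / (32 * (M + 1)))), by positivity, min_le_left _ _,
      ((min_le_right _ _).trans (min_le_left _ _)).trans_lt (half_lt_self hd), ?_⟩
    have h1 : min e (min (d / 2) (v / (32 * (M + 1)))) ≤ v / (32 * (M + 1)) :=
      (min_le_right _ _).trans (min_le_right _ _)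
    rw [le_div_iff₀ (by positivity)] at h1
    have h2 : 0 < min e (min (d / 2) (v / (32 * (M + 1)))) := by positivity
    nlinarith
  obtain ⟨q, hq0, hq1, η, hη, hηη₀, K, hK⟩ :=
    hloc.exists_norm_scale_mul_sub_le hx₀ hy₀ hδ (hδe.trans heδ)
  obtain ⟨d', hd', hnη⟩ := hfam.exists_isNear_taylorPoly hη
  set ρ := min (min d d') e with hρ
  have hρ0 : 0 < ρ := by positivity
  have hball : ∀ s ∈ Metric.ball (0 : ℂ) ρ, ‖s‖ < d ∧ ‖s‖ ≤ d' ∧ ‖s‖ ≤ e := fun s hs => by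
    have hs' : ‖s‖ < ρ := by simpa using hs
    exact ⟨hs'.trans_le ((min_le_left _ _).trans (min_le_left _ _)),
      hs'.le.trans ((min_le_left _ _).trans (min_le_right _ _)), hs'.le.trans (min_le_right _ _)⟩
  set D : ℕ → ℂ → ℂ := fun n s => doubleCoeff (taylorPoly F F₁ F₂ s) y₀ n r with hD
  have hDd : ∀ n, DifferentiableOn ℂ (D n) (Metric.ball 0 ρ) := fun n =>
    hfam.differentiableOn_doubleCoeff hrf (fun s hs => hnT s (hball s hs).2.2) hr hrε n
  have hId : ∀ n, DifferentiableOn ℂ (expIntegral L δ n) (Metric.ball 0 ρ) := fun n s hs =>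
    (hexp.hasDerivAt_expIntegral hδ hδd n (by simpa using (hball s hs).1)).differentiableAt
      |>.differentiableWithinAt
  -- K and q do not depend on s, so Cauchy's estimates apply on a disc of fixed radius ρ for every
  -- n.
  have happ : ∀ n, ∀ s ∈ Metric.ball (0 : ℂ) ρ,
      ‖scale x₀ y₀ n * D n s - expIntegral L δ n s‖ ≤ K * q ^ n := fun n s hs => by
    have h1 := hK _ (hnη s (hball s hs).2.1) r hr hrε n
    rwa [scale_mul_mainPart hx₀ hy₀ hδ.le (Λ := fun β => L ((β : ℂ), s))
      fun β hβ => hroot β (hβ.trans hδe) s (hball s hs).2.2] at h1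
  have hcauchy := fun n => norm_deriv_sub_deriv_le hρ0 ((hDd n).const_mul (scale x₀ y₀ n)) (hId n)
    (happ n)
  have hmem0 : (0 : ℂ) ∈ Metric.ball (0 : ℂ) ρ := Metric.mem_ball_self hρ0
  have hder : ∀ n, deriv (fun s => scale x₀ y₀ n * D n s) = fun s => scale x₀ y₀ n * deriv (D n) s :=
    fun n => by ext s; exact deriv_const_mul_field _
  have hder2 : ∀ n, deriv (fun s => scale x₀ y₀ n * deriv (D n) s) 0
      = scale x₀ y₀ n * deriv (deriv (D n)) 0 := fun n => deriv_const_mul_field _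
  simp only [hder, hder2] at hcauchy
  have hO : ∀ {f : ℕ → ℂ} (c : ℝ), (∀ n, ‖f n‖ ≤ K * q ^ n * c) →
      f =O[atTop] fun n => invSqrt n ^ 9 := fun {f} c hf => by
    refine IsBigO.trans (IsBigO.of_bound (K * c) (Eventually.of_forall fun n => ?_))
      (geometric_isBigO_invSqrt_pow hq0 hq1 9)
    rw [Real.norm_of_nonneg (pow_nonneg hq0 n)]
    exact (hf n).trans (le_of_eq (by ring))
  obtain ⟨c₁, hx⟩ := hexp.dx_expansion
  obtain ⟨c₂, hy⟩ := hexp.dy_expansion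
  obtain ⟨c₃, hyy⟩ := hexp.dyy_expansion
  have h0d : (0 : ℂ) ∈ Metric.ball (0 : ℂ) d := Metric.mem_ball_self hd
  have hβd : ∀ β ∈ Set.Icc (-δ) δ, ‖(β : ℂ)‖ < d := fun β hβ => by
    rw [Complex.norm_real]; exact (abs_le.2 hβ).trans_lt hδd
  have hZ := hexp.invSqrt_isBigO hvL hv hδ hδd hMδ
  have h₀ : (fun n => scale x₀ y₀ n * D n 0 - laplaceIntegral (fun β => L ((β : ℂ), 0)) δ
      (fun _ => 1) n) =O[atTop] fun n => invSqrt n ^ 9 := hO 1 fun n => by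
    rw [← HasLocalExpansion.expIntegral_zero, mul_one]
    exact happ n 0 hmem0
  have hD0 : ∀ n, D n 0 = doubleCoeff F y₀ n r := fun n => by simp only [hD, taylorPoly_zero]
  have key := cumulants_isBigO_one (κ := v / 4) hδ (by positivity)
    (fun β hβ => hexp.le_re hvL hv hδd hMδ hβ)
    (Λ' := fun β : ℝ => dx L ((β : ℂ), 0)) (fun β hβ =>
      HasDerivAt.comp_ofReal (e := fun z => L (z, 0)) (SingleEquation.hasDerivAt_dx (p := ((β : ℂ), (0 : ℂ)))
        (hexp.analytic _ (ofReal_mem_bidisc hδd hβ h0d)).differentiableAt))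
    (continuousOn_slice (fun q hq => analyticAt_dx (hexp.analytic q hq)) hδd h0d)
    (c₀ := dx (dx L) (0, 0)) (by rw [hvL]; exact Complex.ofReal_ne_zero.2 hv.ne')
    (fun β hβ => by simpa using hx β (hβd β hβ))
    (L₁ := fun β : ℝ => dy L ((β : ℂ), 0)) (L₂ := fun β : ℝ => dy (dy L) ((β : ℂ), 0))
    (continuousOn_slice (fun q hq => analyticAt_dy (hexp.analytic q hq)) hδd h0d)
    (continuousOn_slice (fun q hq => analyticAt_dy (analyticAt_dy (hexp.analytic q hq))) hδd h0d)
    (fun β hβ => by simpa using hy β (hβd β hβ)) (fun β hβ => by simpa using hyy β (hβd β hβ))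
    hZ (q₀ := fun n => scale x₀ y₀ n * D n 0) (q₁ := fun n => scale x₀ y₀ n * deriv (D n) 0)
    (q₂ := fun n => scale x₀ y₀ n * deriv (deriv (D n)) 0) h₀
    (hO (2 / ρ) fun n => by
      have := (hcauchy n).1
      rwa [hexp.deriv_expIntegral hδ hδd, sub_neg_eq_add] at this)
    (hO (2 * (2 / ρ) ^ 2) fun n => by
      have := (hcauchy n).2
      rwa [hexp.deriv_deriv_expIntegral hδ hδd] at this)
  have hne : ∀ n, scale x₀ y₀ n ≠ 0 := scale_ne_zero hx₀ hy₀
  simp only [mul_div_mul_left _ _ (hne _), hD0] at key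
  refine ⟨?_, key⟩
  -- The Laplace integral is at least of order n^{-1/2} and dominates the localization error, so the
  -- coefficients are eventually nonzero.
  have hlit : (fun n => scale x₀ y₀ n * D n 0 - laplaceIntegral (fun β => L ((β : ℂ), 0)) δ
      (fun _ => 1) n) =o[atTop] laplaceIntegral (fun β => L ((β : ℂ), 0)) δ (fun _ => 1) := by
    refine (h₀.trans_isLittleO ?_).trans_isBigO hZ
    have : (fun x : ℝ => x ^ 9) =o[𝓝 0] fun x : ℝ => x ^ 1 := isLittleO_pow_pow (by norm_num)
    exact (this.comp_tendsto tendsto_invSqrt).congr_right fun n => by simp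
  have hZ' := hZ.trans hlit.right_isBigO_add
  filter_upwards [hZ'.eq_zero_imp, eventually_ge_atTop 1] with n hn hn1 h0
  refine (invSqrt_pos hn1).ne' (hn ?_)
  simp only [hD0, h0, mul_zero]
  ring

end CoefficientMoments

end SingleEquation

namespace SingleEquation

/-! ### The coefficients on the scale t ~ n^{-1/2}. -/

section CentralLimit

variable {F F₁ F₂ G : ℂ × ℂ → ℂ} {Ft : ℝ → ℂ × ℂ → ℂ} {R S x₀ y₀ B C ε δ₀ η₀ κ v r : ℝ}
  {L : ℂ × ℂ → ℂ}

theorem tendsto_zero_of_tendsto_mul_sqrt {t : ℕ → ℝ} {τ : ℝ}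
    (ht : Tendsto (fun n : ℕ => t n * Real.sqrt n) atTop (𝓝 τ)) : Tendsto t atTop (𝓝 0) := by
  have h := ht.mul tendsto_invSqrt
  rw [mul_zero] at h
  refine h.congr' ?_
  filter_upwards [eventually_ge_atTop 1] with n hn
  have hs : 0 < Real.sqrt n := Real.sqrt_pos.2 (by exact_mod_cast hn)
  rw [invSqrt, mul_assoc, mul_inv_cancel₀ hs.ne', mul_one]

theorem tendsto_sqrt_mul_geometric {q : ℝ} (hq0 : 0 ≤ q) (hq : q < 1) (K : ℝ) :
    Tendsto (fun n : ℕ => Real.sqrt n * (K * q ^ n)) atTop (𝓝 0) := by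
  have h1 : (fun n : ℕ => Real.sqrt n * (K * q ^ n)) =O[atTop]
      fun n : ℕ => Real.sqrt n * invSqrt n ^ 2 :=
    (isBigO_refl _ _).mul ((geometric_isBigO_invSqrt_pow hq0 hq 2).const_mul_left K)
  refine h1.trans_tendsto (tendsto_invSqrt.congr' ?_)
  filter_upwards [eventually_ge_atTop 1] with n hn
  have hs : 0 < Real.sqrt n := Real.sqrt_pos.2 (by exact_mod_cast hn)
  rw [invSqrt]
  field_simp

/-- The exponent of the true family is that of the Taylor polynomial plus log(X/Y) = O(t³), X and Y
being the two roots; this fits into the cubic error that Laplace's method tolerates. The linear term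
ℓt is split off first; being imaginary, it contributes a factor of modulus 1 and leaves all error
bounds intact. -/
theorem IsSmoothFamily.tendsto_sqrt_mul_doubleCoeff
    (hfam : IsSmoothFamily F F₁ F₂ Ft R S x₀ y₀ B C)
    (hloc : HasLocalization F R S x₀ y₀ ε δ₀ η₀ κ) (hL : IsExponent F F₁ F₂ x₀ y₀ L)
    (hr : 0 < r) (hrε : r < x₀ - ε) (hre : (dy L (0, 0)).re = 0) {t : ℕ → ℝ} {τ : ℝ}
    (ht : Tendsto (fun n : ℕ => t n * Real.sqrt n) atTop (𝓝 τ)) :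
    Tendsto (fun n : ℕ => (Real.sqrt n : ℂ) * (Complex.exp (n * (dy L (0, 0) * t n))
      * (scale x₀ y₀ n * doubleCoeff (Ft (t n)) y₀ n r))) atTop
      (𝓝 ((2 * Real.pi / dx (dx L) (0, 0)) ^ (1 / 2 : ℂ) * Complex.exp
        ((dx (dy L) (0, 0) ^ 2 / dx (dx L) (0, 0) - dy (dy L) (0, 0)) * τ ^ 2 / 2))) := by
  have hx₀ := hfam.dominant.x_pos
  have hy₀ := hfam.dominant.y_pos
  have hrf := hloc.toHasRootFunction
  have hκ := hrf.κ_pos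
  have hC := hfam.C_nonneg
  obtain ⟨e, he, heδ, he1, hnT, hnF, hroot⟩ := hfam.exists_root_eq hrf hL
  obtain ⟨v, hv, hvL⟩ := hfam.exists_dxx_eq hL
  obtain ⟨d, M, hexp⟩ := hfam.exists_hasLocalExpansion hL
  have hM := hexp.M_nonneg
  have hd := hexp.d_pos
  have hxε : 0 < x₀ - ε := sub_pos.2 hrf.ε_lt
  set K' := C / κ / (x₀ - ε) with hK'
  have hK'0 : 0 ≤ K' := by positivity
  -- M bounds the cubic error of L, and 2K' that of log(X/Y), since |log(1 + z)| ≤ 3|z|/2 for |z| ≤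
  -- 1/2.
  obtain ⟨δ, hδ, hδe, hδd, hMδ⟩ : ∃ δ > 0, δ ≤ e ∧ δ < d ∧ 32 * (M + 2 * K') * δ ≤ v := by
    refine ⟨min e (min (d / 2) (v / (32 * (M + 2 * K' + 1)))), by positivity, min_le_left _ _,
      ((min_le_right _ _).trans (min_le_left _ _)).trans_lt (half_lt_self hd), ?_⟩
    have h1 : min e (min (d / 2) (v / (32 * (M + 2 * K' + 1)))) ≤ v / (32 * (M + 2 * K' + 1)) :=
      (min_le_right _ _).trans (min_le_right _ _)
    rw [le_div_iff₀ (by positivity)] at h1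
    have h2 : 0 < min e (min (d / 2) (v / (32 * (M + 2 * K' + 1)))) := by positivity
    nlinarith
  obtain ⟨q, hq0, hq1, η, hη, hηη₀, K, hK⟩ :=
    hloc.exists_norm_scale_mul_sub_le hx₀ hy₀ hδ (hδe.trans heδ)
  obtain ⟨d', hd', hnη⟩ := hfam.exists_isNear hη
  have ht0 := tendsto_zero_of_tendsto_mul_sqrt ht
  have hsmall : Tendsto (fun n => K' * |t n| ^ 3) atTop (𝓝 0) := by
    simpa using (ht0.abs.pow 3).const_mul K'
  have hev : ∀ᶠ n in atTop, |t n| < min (min d d') e ∧ K' * |t n| ^ 3 ≤ 1 / 2 := by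
    refine Eventually.and ?_ (hsmall.eventually (ge_mem_nhds (by norm_num)))
    have h1 : Tendsto (fun n => |t n|) atTop (𝓝 0) := by simpa using ht0.abs
    exact h1.eventually (gt_mem_nhds (by positivity))
  set X : ℕ → ℝ → ℂ := fun n β => root (Ft (t n)) x₀ ε (circleMap 0 y₀ β) with hX
  set Y : ℕ → ℝ → ℂ := fun n β => x₀ * Complex.exp (L ((β : ℂ), (t n : ℂ))) with hY
  have hYne : ∀ n β, Y n β ≠ 0 := fun n β =>
    mul_ne_zero (Complex.ofReal_ne_zero.2 hx₀.ne') (Complex.exp_ne_zero _)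
  set Λ : ℕ → ℝ → ℂ := fun n β => L ((β : ℂ), (t n : ℂ)) - dy L (0, 0) * t n
    + Complex.log (X n β / Y n β) with hΛ
  have hloglt : ∀ n, |t n| < min (min d d') e → K' * |t n| ^ 3 ≤ 1 / 2 → ∀ β ∈ Set.Icc (-δ) δ,
      ‖X n β / Y n β - 1‖ ≤ K' * |t n| ^ 3 := fun n h1 h2 β hβ => by
    have hte : |t n| ≤ e := h1.le.trans (min_le_right _ _)
    have hβe : |β| ≤ e := (abs_le.2 hβ).trans hδe
    have hte' : ‖(t n : ℂ)‖ ≤ e := by rwa [Complex.norm_real]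
    have hr1 := hfam.norm_root_sub_le hrf (hte.trans he1) (hβe.trans heδ) (hnF _ hte) (hnT _ hte')
    have hr2 := hrf.root_mem _ (hnT _ hte') β (hβe.trans heδ)
    rw [hroot β hβe _ hte'] at hr1 hr2
    have hYn : x₀ - ε ≤ ‖Y n β‖ := by
      rw [mem_closedBall_iff_norm'] at hr2
      have := norm_sub_norm_le (x₀ : ℂ) (Y n β)
      rw [Complex.norm_real, Real.norm_of_nonneg hx₀.le] at this
      linarith
    rw [div_sub_one (hYne n β), norm_div, div_le_iff₀ (norm_pos_iff.2 (hYne n β))]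
    refine hr1.trans ?_
    have e1 : C / κ * |t n| ^ 3 = K' * |t n| ^ 3 * (x₀ - ε) := by rw [hK']; field_simp
    rw [e1]
    exact mul_le_mul_of_nonneg_left hYn (by positivity)
  have key := tendsto_sqrt_mul_integral_exp (δ := δ) (κ := v) (C := M + 2 * K') (τ := τ)
    (m := dx (dy L) (0, 0)) (p := dy (dy L) (0, 0)) hv hδ (by positivity) hMδ (Λ := Λ) (t := t)
    (a := fun β : ℝ => Complex.exp (β * Complex.I)) (by fun_prop) ht
    (by
      filter_upwards [hev] with n ⟨h1, h2⟩
      have htd : (t n : ℂ) ∈ Metric.ball (0 : ℂ) d := by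
        simpa using h1.trans_le ((min_le_left _ _).trans (min_le_left _ _))
      have hLc := continuousOn_slice hexp.analytic hδd htd
      refine (hLc.sub continuousOn_const).add (ContinuousOn.clog ?_ fun β hβ => ?_)
      · refine ContinuousOn.div ?_ (continuousOn_const.mul hLc.cexp) fun β _ => hYne n β
        refine (hrf.continuousOn_root hx₀ hy₀.le hfam.dominant.y_lt
          (hnF _ (h1.le.trans (min_le_right _ _)))).mono ?_
        exact Set.Icc_subset_Icc (neg_le_neg (hδe.trans heδ)) (hδe.trans heδ)
      · have h3 := (hloglt n h1 h2 β hβ).trans h2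
        have := Complex.mem_slitPlane_of_norm_lt_one (h3.trans_lt (by norm_num))
        rwa [add_sub_cancel] at this)
    (by
      filter_upwards [hev] with n ⟨h1, h2⟩ β hβ
      have h3 := hloglt n h1 h2 β hβ
      have h4 := Complex.norm_log_one_add_half_le_self (h3.trans h2)
      rw [add_sub_cancel] at h4
      have h5 := hexp.expansion β (t n) (by rw [Complex.norm_real]; exact (abs_le.2 hβ).trans_lt hδd)
        (by rw [Complex.norm_real]; exact h1.trans_le ((min_le_left _ _).trans (min_le_left _ _)))
      rw [hvL, Complex.norm_real, Complex.norm_real, Real.norm_eq_abs, Real.norm_eq_abs] at h5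
      have e1 : Λ n β - (v * (β : ℂ) ^ 2 + 2 * dx (dy L) (0, 0) * β * t n
          + dy (dy L) (0, 0) * (t n : ℂ) ^ 2) / 2
          = (L ((β : ℂ), (t n : ℂ)) - (dy L (0, 0) * t n + (v * (β : ℂ) ^ 2
            + 2 * dx (dy L) (0, 0) * β * t n + dy (dy L) (0, 0) * (t n : ℂ) ^ 2) / 2))
          + Complex.log (X n β / Y n β) := by simp only [hΛ]; ring
      rw [e1]
      refine (norm_add_le _ _).trans ?_
      have h6 : K' * |t n| ^ 3 ≤ K' * (|β| + |t n|) ^ 3 :=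
        mul_le_mul_of_nonneg_left (pow_le_pow_left₀ (abs_nonneg _)
          (le_add_of_nonneg_left (abs_nonneg _)) 3) hK'0
      have h7 : 0 ≤ K' * (|β| + |t n|) ^ 3 := by positivity
      linarith)
  simp only [Complex.ofReal_zero, zero_mul, Complex.exp_zero, one_mul] at key
  rw [hvL]
  have hdiff : Tendsto (fun n : ℕ => (Real.sqrt n : ℂ) * (Complex.exp (n * (dy L (0, 0) * t n))
      * (scale x₀ y₀ n * doubleCoeff (Ft (t n)) y₀ n r)) - Real.sqrt n * ∫ β in (-δ)..δ,
        Complex.exp (β * Complex.I) * Complex.exp (-(n * Λ n β))) atTop (𝓝 0) := by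
    refine squeeze_zero_norm' ?_ (tendsto_sqrt_mul_geometric hq0 hq1 K)
    filter_upwards [hev] with n ⟨h1, h2⟩
    have hne1 : ∀ β ∈ Set.Icc (-δ) δ, X n β / Y n β ≠ 0 := fun β hβ h0 => by
      have h3 := (hloglt n h1 h2 β hβ).trans h2
      rw [h0, zero_sub, norm_neg, norm_one] at h3
      norm_num at h3
    have h3 := hK _ (hnη _ (h1.le.trans ((min_le_left _ _).trans (min_le_right _ _)))) r hr hrε n
    rw [scale_mul_mainPart hx₀ hy₀ hδ.le (Λ := fun β => Λ n β + dy L (0, 0) * t n)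
      fun β hβ => ?_] at h3
    · have e1 : ∫ β in (-δ)..δ, Complex.exp (β * Complex.I) * Complex.exp (-(n * Λ n β))
          = Complex.exp (n * (dy L (0, 0) * t n)) * ∫ β in (-δ)..δ, Complex.exp (β * Complex.I)
            * Complex.exp (-(n * (Λ n β + dy L (0, 0) * t n))) := by
        rw [← intervalIntegral.integral_const_mul]
        refine intervalIntegral.integral_congr fun β _ => ?_
        rw [mul_left_comm, ← Complex.exp_add (n * (dy L (0, 0) * t n))]
        congr 2
        ring
      have e2 : ‖Complex.exp (n * (dy L (0, 0) * t n))‖ = 1 := by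
        rw [Complex.norm_exp]
        simp [hre]
      rw [e1, ← mul_sub, ← mul_sub, norm_mul, norm_mul, e2, one_mul, Complex.norm_real,
        Real.norm_of_nonneg (Real.sqrt_nonneg _)]
      exact mul_le_mul_of_nonneg_left h3 (Real.sqrt_nonneg _)
    · have e3 : Λ n β + dy L (0, 0) * t n
          = L ((β : ℂ), (t n : ℂ)) + Complex.log (X n β / Y n β) := by simp only [hΛ]; ring
      rw [e3, Complex.exp_add, Complex.exp_log (hne1 β (abs_le.1 hβ)), ← mul_assoc,
        mul_div_cancel₀ _ (hYne n β)]
  simpa using key.add hdiff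

/-- Quotient of the preceding asymptotics by its instance t ≡ 0: the scale, √n and the Gaussian
constant cancel. -/
theorem IsSmoothFamily.tendsto_doubleCoeff_div
    (hfam : IsSmoothFamily F F₁ F₂ Ft R S x₀ y₀ B C)
    (hloc : HasLocalization F R S x₀ y₀ ε δ₀ η₀ κ) (hL : IsExponent F F₁ F₂ x₀ y₀ L)
    (hr : 0 < r) (hrε : r < x₀ - ε) (hre : (dy L (0, 0)).re = 0) {t : ℕ → ℝ} {τ : ℝ}
    (ht : Tendsto (fun n : ℕ => t n * Real.sqrt n) atTop (𝓝 τ)) :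
    Tendsto (fun n : ℕ => Complex.exp (n * (dy L (0, 0) * t n))
      * (doubleCoeff (Ft (t n)) y₀ n r / doubleCoeff F y₀ n r)) atTop
      (𝓝 (Complex.exp
        ((dx (dy L) (0, 0) ^ 2 / dx (dx L) (0, 0) - dy (dy L) (0, 0)) * τ ^ 2 / 2))) := by
  have hx₀ := hfam.dominant.x_pos
  have hy₀ := hfam.dominant.y_pos
  obtain ⟨v, hv, hvL⟩ := hfam.exists_dxx_eq hL
  have h1 := hfam.tendsto_sqrt_mul_doubleCoeff hloc hL hr hrε hre ht
  have h2 := hfam.tendsto_sqrt_mul_doubleCoeff hloc hL hr hrε hre (t := fun _ => 0) (τ := 0)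
    (by simp)
  have hA : (2 * Real.pi / dx (dx L) (0, 0)) ^ (1 / 2 : ℂ) ≠ 0 := by
    refine Complex.cpow_ne_zero_iff.2 (Or.inl ?_)
    rw [hvL]
    exact div_ne_zero (mul_ne_zero two_ne_zero (Complex.ofReal_ne_zero.2 Real.pi_pos.ne'))
      (Complex.ofReal_ne_zero.2 hv.ne')
  have h3 := h1.div h2 (mul_ne_zero hA (Complex.exp_ne_zero _))
  rw [mul_div_mul_left _ _ hA] at h3
  simp only [Complex.ofReal_zero, ne_eq, OfNat.ofNat_ne_zero, not_false_eq_true, zero_pow, mul_zero,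
    zero_div, Complex.exp_zero, div_one, one_mul, hfam.zero] at h3
  refine h3.congr' ?_
  filter_upwards [eventually_ge_atTop 1] with n hn
  have hs : (Real.sqrt n : ℂ) ≠ 0 :=
    Complex.ofReal_ne_zero.2 (Real.sqrt_pos.2 (by exact_mod_cast hn)).ne'
  simp only [Pi.div_apply]
  rw [mul_div_mul_left _ _ hs, mul_left_comm, mul_div_mul_left _ _ (scale_ne_zero hx₀ hy₀ n),
    mul_div_assoc]

end CentralLimit

end SingleEquation

namespace SingleEquation

/-! ### Taylor expansion of the coefficients at fixed n. -/

section CoefficientTaylor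

variable {F F₁ F₂ G : ℂ × ℂ → ℂ} {Ft : ℝ → ℂ × ℂ → ℂ} {R S x₀ y₀ B C ε δ₀ η₀ κ r : ℝ}

/-- The general formula needs circles whose radius may depend on G. As w − G has no zeros for |x| ≤
x₀ − ε, the contour can be moved to a radius r common to all G. -/
theorem HasRootFunction.natCast_mul_coeffAt_eq (hrf : HasRootFunction F R S x₀ y₀ ε δ₀ η₀ κ)
    (hF : IsDominantPoint F R S x₀ y₀) (hG : IsNear F G R S η₀)
    (hG0 : ∀ w, ‖w‖ < S → G (0, w) = 0) {y : ℂ → ℂ} (hy : AnalyticAt ℂ y 0) (hy0 : y 0 = 0)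
    (hfix : ∀ᶠ x in 𝓝 (0 : ℂ), y x = G (x, y x)) (hr : 0 < r) (hrε : r < x₀ - ε) {n : ℕ}
    (hn : 1 ≤ n) : (n : ℂ) * coeffAt n y = doubleCoeff G y₀ n r := by
  have hrR : r < R := by linarith [hrf.ε_pos, hF.x_lt]
  obtain ⟨r₀, hr₀, h⟩ := SingleEquation.natCast_mul_coeffAt_eq hG.analytic (hr.trans hrR) hF.y_pos
    hF.y_lt hG0 hy hy0 hfix
  have hr' : 0 < min r (r₀ / 2) := by positivity
  rw [h _ hr' ((min_le_right _ _).trans_lt (half_lt_self hr₀)) n hn, doubleCoeff]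
  congr 1
  refine circleIntegral.integral_congr hF.y_pos.le fun w hw => ?_
  have hw' : ‖w‖ = y₀ := by simpa using hw
  exact innerCoeff_eq_of_ne hG.analytic (hw' ▸ hF.y_lt) hr' (min_le_left _ _) hrR
    (fun x hx => hrf.sub_ne_zero hG (hx.trans hrε.le) hw') n

theorem exists_norm_sub_taylor_two_le {f : ℂ → ℂ} {d : ℝ} (hd : 0 < d)
    (hf : DifferentiableOn ℂ f (Metric.ball 0 d)) :
    ∃ M, ∀ s : ℂ, ‖s‖ ≤ d / 2 →
      ‖f s - (f 0 + deriv f 0 * s + deriv (deriv f) 0 / 2 * s ^ 2)‖ ≤ M * ‖s‖ ^ 3 := by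
  have h1 := hf.deriv Metric.isOpen_ball
  have h2 := h1.deriv Metric.isOpen_ball
  have h3 := h2.deriv Metric.isOpen_ball
  have hsub : Metric.closedBall (0 : ℂ) (d / 2) ⊆ Metric.ball 0 d :=
    Metric.closedBall_subset_ball (half_lt_self hd)
  obtain ⟨M, hM⟩ := (isCompact_closedBall (0 : ℂ) (d / 2)).exists_bound_of_continuousOn
    (h3.continuousOn.mono hsub)
  have hder : ∀ {g : ℂ → ℂ}, DifferentiableOn ℂ g (Metric.ball 0 d) → ∀ z, ‖z‖ < d →
      HasDerivAt g (deriv g z) z := fun hg z hz =>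
    (hg.differentiableAt (Metric.isOpen_ball.mem_nhds (by simpa using hz))).hasDerivAt
  exact ⟨M, fun s hs => norm_sub_taylor_two_le' (hder hf) (hder h1) (hder h2)
    (hs.trans_lt (half_lt_self hd)) fun u hu => hM u (by simpa using hu.trans hs)⟩

/-- Replacing the family by its Taylor polynomial costs O(t³) by Lipschitz dependence on G; the rest
is the expansion of a holomorphic function of s. K depends on n, but d does not. -/
theorem IsSmoothFamily.exists_norm_doubleCoeff_sub_taylor_le
    (hfam : IsSmoothFamily F F₁ F₂ Ft R S x₀ y₀ B C)
    (hrf : HasRootFunction F R S x₀ y₀ ε δ₀ η₀ κ) (hr : 0 < r) (hrε : r < x₀ - ε) :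
    ∃ d > 0, (∀ t : ℝ, |t| < d → IsNear F (Ft t) R S η₀) ∧ ∀ n, ∃ K, ∀ t : ℝ, |t| < d →
      ‖doubleCoeff (Ft t) y₀ n r - (doubleCoeff F y₀ n r
        + deriv (fun s => doubleCoeff (taylorPoly F F₁ F₂ s) y₀ n r) 0 * t
        + deriv (deriv fun s => doubleCoeff (taylorPoly F F₁ F₂ s) y₀ n r) 0 / 2 * (t : ℂ) ^ 2)‖
        ≤ K * |t| ^ 3 := by
  obtain ⟨d₁, hd₁, h₁⟩ := hfam.exists_isNear_taylorPoly hrf.η_pos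
  obtain ⟨d₂, hd₂, h₂⟩ := hfam.exists_isNear hrf.η_pos
  refine ⟨min 1 (min (d₁ / 2) d₂), by positivity, fun t ht =>
    h₂ t (ht.le.trans ((min_le_right _ _).trans (min_le_right _ _))), fun n => ?_⟩
  obtain ⟨K, hK⟩ := exists_norm_doubleCoeff_sub_le hrf hfam.dominant hr hrε n
  obtain ⟨M, hM⟩ := exists_norm_sub_taylor_two_le hd₁ (hfam.differentiableOn_doubleCoeff hrf
    (fun s hs => h₁ s (by simpa using (Metric.ball_subset_closedBall hs))) hr hrε n)
  refine ⟨K * C + M, fun t ht => ?_⟩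
  have ht1 : |t| ≤ 1 := ht.le.trans (min_le_left _ _)
  have htd : ‖(t : ℂ)‖ ≤ d₁ / 2 := by
    rw [Complex.norm_real]
    exact ht.le.trans ((min_le_right _ _).trans (min_le_left _ _))
  have e1 := hK _ _ (h₂ t (ht.le.trans ((min_le_right _ _).trans (min_le_right _ _))))
    (h₁ t (htd.trans (half_le_self hd₁.le))) _ (hfam.taylor t ht1)
  have e2 := hM t htd
  rw [taylorPoly_zero, Complex.norm_real, Real.norm_eq_abs] at e2
  refine (norm_sub_le_norm_sub_add_norm_sub _ (doubleCoeff (taylorPoly F F₁ F₂ t) y₀ n r) _).trans ?_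
  linarith

/-- The imaginary part n · Im c would have to stay bounded. This yields the reality of μ and σ² from
that of mean and variance. -/
theorem im_eq_zero_of_isBigO {v : ℕ → ℝ} {c : ℂ}
    (h : (fun n : ℕ => (v n : ℂ) - n * c) =O[atTop] fun _ => (1 : ℝ)) : c.im = 0 := by
  obtain ⟨K, hK⟩ := h.bound
  by_contra hc
  have h1 : Tendsto (fun n : ℕ => (n : ℝ) * |c.im|) atTop atTop :=
    tendsto_natCast_atTop_atTop.atTop_mul_const (abs_pos.2 hc)
  obtain ⟨n, hn, hn'⟩ := (hK.and (h1.eventually_gt_atTop (K * 1))).exists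
  have h2 := (Complex.abs_im_le_norm _).trans hn
  simp only [Complex.sub_im, Complex.ofReal_im, Complex.mul_im, Complex.natCast_re,
    Complex.natCast_im, zero_mul, add_zero, zero_sub, abs_neg, abs_mul, Nat.abs_cast,
    norm_one] at h2
  linarith

theorem isBigO_one_of_ofReal {v : ℕ → ℝ} {c : ℝ}
    (h : (fun n : ℕ => (v n : ℂ) - n * (c : ℂ)) =O[atTop] fun _ => (1 : ℝ)) :
    (fun n : ℕ => v n - c * n) =O[atTop] fun _ => (1 : ℝ) := by
  refine (isBigO_norm_left.1 ((isBigO_norm_left.2 h).congr_left fun n => ?_))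
  rw [← Complex.norm_real]
  congr 1
  push_cast
  ring

end CoefficientTaylor

end SingleEquation

/-! ### Assembly of the theorem. -/

open SingleEquation in
theorem mainTheorem4
    (a : ℕ → ℕ → Circle → ℂ) (R S x₀ y₀ : ℝ)
    (hF : SingleEquation.IsPositiveEquation a R S)
    (hchar : SingleEquation.IsCharacteristicPoint (SingleEquation.seriesF a) x₀ y₀)
    (hx₀ : x₀ < R) (hy₀ : y₀ < S)
    (y : ℂ → Circle → ℂ)
    (hy : SingleEquation.IsSolution (SingleEquation.seriesF a) y)
    (haper : SingleEquation.IsAperiodic fun n => SingleEquation.coeffAt n fun x => y x 1)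
    {Ω : ℕ → Type*} [∀ n, MeasurableSpace (Ω n)]
    (P : (n : ℕ) → Measure (Ω n)) [∀ n, IsProbabilityMeasure (P n)]
    (X : (n : ℕ) → Ω n → ℤ) (hX : ∀ n, Measurable (X n))
    (hlaw : ∀ n, SingleEquation.coeffAt n (fun x => y x 1) ≠ 0 → ∀ u : Circle,
      ∫ ω, (u : ℂ) ^ (X n ω) ∂(P n)
        = SingleEquation.coeffAt n (fun x => y x u) / SingleEquation.coeffAt n (fun x => y x 1)) :
    (∀ n, SingleEquation.coeffAt n (fun x => y x 1) ≠ 0 →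
      MemLp (fun ω => (X n ω : ℝ)) 2 (P n)) ∧
    ∃ μ σsq : ℝ,
      (μ : ℂ) = SingleEquation.meanConst (SingleEquation.seriesF a) x₀ y₀ ∧
      (σsq : ℂ) = SingleEquation.varConst (SingleEquation.seriesF a) x₀ y₀ ∧
      (fun n : ℕ => (∫ ω, (X n ω : ℝ) ∂(P n)) - μ * n) =O[atTop] (fun _ => (1 : ℝ)) ∧
      (fun n : ℕ => variance (fun ω => (X n ω : ℝ)) (P n) - σsq * n)
        =O[atTop] (fun _ => (1 : ℝ)) ∧
      (0 < σsq →
        TendstoInDistribution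
          (fun (n : ℕ) (ω : Ω n) => ((X n ω : ℝ) - ∫ ω', (X n ω' : ℝ) ∂(P n))
            / Real.sqrt (variance (fun ω' => (X n ω' : ℝ)) (P n)))
          atTop (id : ℝ → ℝ) P (gaussianReal 0 1)) := by
  obtain ⟨R', S', B, C, hR', hS', hfam⟩ := hF.exists_isSmoothFamily hchar hx₀ hy₀ hy haper
  obtain ⟨ε, δ₀, η₀, κ, hloc⟩ := hfam.dominant.exists_hasLocalization
  have hrf := hloc.toHasRootFunction
  obtain ⟨L, hL⟩ := hfam.exists_isExponent
  obtain ⟨r, hr, hrε⟩ : ∃ r, 0 < r ∧ r < x₀ - ε := exists_between (sub_pos.2 hrf.ε_lt)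
  obtain ⟨hQne, hmean, hvar⟩ := hfam.cumulants hloc hL hr hrε
  obtain ⟨d, hd, hnear, htaylor⟩ := hfam.exists_norm_doubleCoeff_sub_taylor_le hrf hr hrε
  set c : ℕ → ℂ := fun n => coeffAt n fun x => y x 1 with hc
  set Q : ℕ → ℂ := fun n => doubleCoeff (atParam a 1) y₀ n r with hQ
  set Q₁ : ℕ → ℂ := fun n => deriv (fun s => doubleCoeff (taylorPoly (atParam a 1) (paramDeriv a 1)
    (paramDeriv a 2) s) y₀ n r) 0 with hQ₁
  set Q₂ : ℕ → ℂ := fun n => deriv (deriv fun s => doubleCoeff (taylorPoly (atParam a 1)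
    (paramDeriv a 1) (paramDeriv a 2) s) y₀ n r) 0 with hQ₂
  have hcoeff : ∀ t : ℝ, |t| < d → ∀ n : ℕ, 1 ≤ n → (n : ℂ) * coeffAt n (fun x => y x (Circle.exp t))
      = doubleCoeff (atParam a (Circle.exp t)) y₀ n r := fun t ht n hn =>
    hrf.natCast_mul_coeffAt_eq hfam.dominant (hnear t ht)
      (fun w hw => hF.atParam_zero_left _ w (hw.trans_le hS')) (hy.analyticAt _) (hy.map_zero _)
      (hy.eq _) hr hrε hn
  have hcQ : ∀ n : ℕ, 1 ≤ n → (n : ℂ) * c n = Q n := fun n hn => by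
    have := hcoeff 0 (by simpa using hd) n hn
    rwa [Circle.exp_zero] at this
  have hn1 : ∀ n, c n ≠ 0 → 1 ≤ n := fun n hn => Nat.one_le_iff_ne_zero.2 fun h0 => hn (by
    simp [hc, h0, coeffAt, hy.map_zero])
  have hn0 : ∀ {n : ℕ}, 1 ≤ n → (n : ℂ) ≠ 0 := fun hn => Nat.cast_ne_zero.2 (by omega)
  -- For u near 1 both coefficients are double contour integrals up to the factor n, which cancels
  -- in the quotient.
  have hchf : ∀ n, c n ≠ 0 → ∀ t : ℝ, |t| < d →
      ∫ ω, Complex.exp (t * ((X n ω : ℝ) : ℂ) * Complex.I) ∂(P n)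
        = doubleCoeff (atParam a (Circle.exp t)) y₀ n r / Q n := fun n hn t ht => by
    have h1 := hn1 n hn
    rw [← hcoeff t ht n h1, ← hcQ n h1, mul_div_mul_left _ _ (hn0 h1), ← hlaw n hn (Circle.exp t)]
    refine integral_congr_ae (Eventually.of_forall fun ω => ?_)
    simp only [Circle.coe_exp]
    rw [← Complex.exp_int_mul]
    congr 1
    push_cast
    ring
  have hQ0 : ∀ n, c n ≠ 0 → Q n ≠ 0 := fun n hn => by
    rw [← hcQ n (hn1 n hn)]
    exact mul_ne_zero (hn0 (hn1 n hn)) hn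
  have hchT : ∀ n, c n ≠ 0 → ∃ K, ∀ t : ℝ, |t| < d →
      ‖(∫ ω, Complex.exp (t * ((X n ω : ℝ) : ℂ) * Complex.I) ∂(P n))
        - (1 + Q₁ n / Q n * t + Q₂ n / Q n / 2 * (t : ℂ) ^ 2)‖ ≤ K * |t| ^ 3 := fun n hn => by
    obtain ⟨K, hK⟩ := htaylor n
    refine ⟨K / ‖Q n‖, fun t ht => ?_⟩
    have hq := hQ0 n hn
    rw [hchf n hn t ht]
    have e : doubleCoeff (atParam a (Circle.exp t)) y₀ n r / Q n
        - (1 + Q₁ n / Q n * t + Q₂ n / Q n / 2 * (t : ℂ) ^ 2)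
        = (doubleCoeff (atParam a (Circle.exp t)) y₀ n r
          - (Q n + Q₁ n * t + Q₂ n / 2 * (t : ℂ) ^ 2)) / Q n := by
      field_simp
    rw [e, norm_div, div_mul_eq_mul_div K]
    exact div_le_div_of_nonneg_right (hK t ht) (norm_nonneg _)
  have hXm : ∀ n, Measurable fun ω => (X n ω : ℝ) := fun n =>
    (measurable_of_countable fun k : ℤ => (k : ℝ)).comp (hX n)
  have hL2 : ∀ n, c n ≠ 0 → MemLp (fun ω => (X n ω : ℝ)) 2 (P n) := fun n hn => by
    obtain ⟨K, hK⟩ := hchT n hn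
    exact memLp_two_of_charFun_taylor (hXm n) hd hK
  have hmom : ∀ n, c n ≠ 0 → Q₁ n / Q n = (∫ ω, (X n ω : ℝ) ∂(P n) : ℝ) * Complex.I ∧
      Q₂ n / Q n / 2 = -(∫ ω, (X n ω : ℝ) ^ 2 ∂(P n) : ℝ) / 2 := fun n hn => by
    obtain ⟨K, hK⟩ := hchT n hn
    exact moments_of_charFun_taylor (hXm n) hd hK
  -- The law of X is prescribed only where yₙ(1) ≠ 0; this covers all large n, which is enough for
  -- the asymptotics.
  have hcne : ∀ᶠ n in atTop, c n ≠ 0 := by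
    filter_upwards [hQne, eventually_ge_atTop 1] with n hn h1 h0
    refine hn ((hcQ n h1).symm.trans ?_)
    rw [h0, mul_zero]
  have hmean' : (fun n : ℕ => ((∫ ω, (X n ω : ℝ) ∂(P n) : ℝ) : ℂ)
      - n * meanConst (seriesF a) x₀ y₀) =O[atTop] fun _ => (1 : ℝ) := by
    refine (hmean.const_mul_left (-Complex.I)).congr' ?_ EventuallyEq.rfl
    filter_upwards [hcne] with n hn
    change -Complex.I * (Q₁ n / Q n + n * dy L (0, 0)) = _
    rw [(hmom n hn).1, meanConst_eq hfam hL]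
    linear_combination (-((∫ ω, (X n ω : ℝ) ∂(P n) : ℝ) : ℂ)
      + n * meanConst (seriesF a) x₀ y₀) * Complex.I_sq
  have hvar' : (fun n : ℕ => (variance (fun ω => (X n ω : ℝ)) (P n) : ℂ)
      - n * varConst (seriesF a) x₀ y₀) =O[atTop] fun _ => (1 : ℝ) := by
    refine hvar.neg_left.congr' ?_ EventuallyEq.rfl
    filter_upwards [hcne] with n hn
    change -(Q₂ n / Q n - (Q₁ n / Q n) ^ 2 - n * (dx (dy L) (0, 0) ^ 2 / dx (dx L) (0, 0)
      - dy (dy L) (0, 0))) = _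
    have h2 : Q₂ n / Q n = -(∫ ω, (X n ω : ℝ) ^ 2 ∂(P n) : ℝ) := by
      have := (hmom n hn).2
      linear_combination 2 * this
    rw [(hmom n hn).1, h2, varConst_eq hF hx₀ hy₀ hfam hL, variance_eq_sub (hL2 n hn)]
    simp only [Pi.pow_apply]
    push_cast
    linear_combination ((∫ ω, (X n ω : ℝ) ∂(P n) : ℝ) : ℂ) ^ 2 * Complex.I_sq
  -- Reality is read off from the asymptotics, not from the formulas. It also makes the linear
  -- coefficient −iμ of the exponent imaginary, as the limit law requires.
  have hμ : ((meanConst (seriesF a) x₀ y₀).re : ℂ) = meanConst (seriesF a) x₀ y₀ :=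
    Complex.ext (by simp) (by simpa using (im_eq_zero_of_isBigO hmean').symm)
  have hσ : ((varConst (seriesF a) x₀ y₀).re : ℂ) = varConst (seriesF a) x₀ y₀ :=
    Complex.ext (by simp) (by simpa using (im_eq_zero_of_isBigO hvar').symm)
  rw [← hμ] at hmean'
  rw [← hσ] at hvar'
  have hm := isBigO_one_of_ofReal hmean'
  have hv := isBigO_one_of_ofReal hvar'
  refine ⟨hL2, _, _, hμ, hσ, hm, hv, fun hpos => ?_⟩
  have hdy : dy L (0, 0) = -Complex.I * ((meanConst (seriesF a) x₀ y₀).re : ℂ) := by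
    rw [hμ]; exact meanConst_eq hfam hL
  refine tendstoInDistribution_of_charFun_asymp P (fun n ω => (X n ω : ℝ)) hXm hpos hm hv
    fun t τ ht => ?_
  have hlim := hfam.tendsto_doubleCoeff_div hloc hL hr hrε (by rw [hdy]; simp) ht
  have e : (dx (dy L) (0, 0) ^ 2 / dx (dx L) (0, 0) - dy (dy L) (0, 0)) * (τ : ℂ) ^ 2 / 2
      = -(((varConst (seriesF a) x₀ y₀).re : ℂ) * τ ^ 2 / 2) := by
    rw [hσ, varConst_eq hF hx₀ hy₀ hfam hL]; ring
  rw [e] at hlim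
  refine hlim.congr' ?_
  have ht0 := (tendsto_zero_of_tendsto_mul_sqrt ht).abs
  rw [abs_zero] at ht0
  filter_upwards [hcne, ht0.eventually (gt_mem_nhds hd)] with n hn htn
  rw [hchf n hn _ htn, hdy]
  congr 2
  ring
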